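/- **Setting.** Let $\tau(t)=1$ if $t\ge 1$ and $\tau(t)=0$ otherwise. Let $k<n$, $d\ge 0$, $A\in\mathbb R^{k\times n}$, $W_i\in\mathbb R^{k_i\times k_{i+1}}$ ($1\le i\le d$) with $k_1=1$, $k_{d+1}=k$, let $\phi_i:\mathbb R\to\mathbb R$ be applied entrywise, and put $$\sigma(x)=W_1\phi_1(W_2\phi_2(\cdots W_d\phi_d(Ax)\cdots)),\qquad M(x)=\tau(\sigma(x)),\qquad x\in\mathbb R^n .$$ For a subspace $V\subset\mathbb R^n$ put $\sigma_V(x)=\sigma((I-P_V)x)$, where $P_V$ is the orthogonal projection onto $V$. Let $\mathrm{Span}(A)$ be the row span of $A$. Let $\gamma,\eta>0$, and let $L_1,\dots,L_d$ and $\kappa_1,\dots,\kappa_{d+1}\ge 0$ be reals such that: 1. each $\phi_i$ is twice differentiable, with $\phi_i(0)=0$, $|\phi_i'|\le L_i$ and $|\phi_i''|\le L_i$ on $\mathbb R$; 2. the spectral norms satisfy $\|W_i\|_2\le\kappa_i$ for $1\le i\le d$ and $\|A\|_2\le\kappa_{d+1}$ (if a weight matrix is scaled so that its least singular value is $1$,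 one may take its condition number); 3. for every subspace $V\subset\mathbb R^n$ with $\dim V<k$, $\Pr_{g\sim\mathcal N(0,I_n)}[\sigma_V(g)\ge 1]\ge\gamma$; 4. for every subspace $V\subset\mathbb R^n$ with $\dim V<k$, with probability at least $\gamma$ over $g\sim\mathcal N(0,I_n)$ one has $\sigma_V(g)\ge 1$ and $|\nabla_g\sigma_V(cg)|\ge\eta$ for all $c>0$ with $\sigma_V(cg)=1$, where $\nabla_g\sigma_V(cg)=\frac{d}{dc}\sigma_V(cg)$ is the directional derivative in the direction $g$. For $\epsilon,\delta\in(0,1)$ let $$N=\Big\lceil n+k+\tfrac1\gamma+\sum_{i=1}^{d}\log(2+L_i)+\sum_{i=1}^{d+1}\log(2+\kappa_i)+\log\big(2+\tfrac1\eta\big)+\log\tfrac1\epsilon+\log\tfrac1\delta\Big\rceil .$$ **Theorem.** There are a single randomized adaptive algorithm and a constant $C$ such that, for every network and all parameters as above, the algorithm, given only $n,k,N$ and query access to $x\mapsto M(x)$, always halts after at most $C N^C$ steps and at most $C N^C$ queries to $M$, and with probability at least $1-\delta$ it returns ($k$ vectors spanning) a subspace $V\subset\mathbb R^n$ of dimension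 $k$ such that $$\|P_{\mathrm{Span}(A)}x\|_2\ \ge\ (1-\epsilon)\|x\|_2\qquad\text{for every }x\in V .$$ Here an algorithm is a fixed finite program for a real random access machine. It has integer registers (constants, addition, truncated subtraction, comparison) and an array of real cells addressed through the integer registers (integer constants, $+,-,\times,/$, square root, comparison). It can branch, run loops whose number of rounds is an integer register, draw an independent $\mathcal N(0,1)$ variable, and query $M$ at a stored vector. Each instruction, branching, loop entry and loop round costs one step. -/

import Mathlib

open MeasureTheory ProbabilityTheory

noncomputable section

/-! ### Thresholded networks -/

/-- The `0/1` threshold: `1` if `1 ≤ t`, and `0` otherwise. -/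
def threshold (t : ℝ) : ℝ := if 1 ≤ t then 1 else 0

/-- The data of a network
`M(x) = τ (W₀ φ₀ (W₁ φ₁ (⋯ W_{d-1} φ_{d-1} (A x))))` on `ℝⁿ`, where `d = depth`, the matrix `W i` has
`width i` rows and `width (i+1)` columns, the innermost matrix `A` has `width d` rows and `n` columns,
and the outermost layer is scalar (`width 0 = 1`).
Only the entries `W i`, `φ i` with `i < depth` are used. -/
structure ThresholdNetwork (n : ℕ) where
  depth : ℕ
  width : ℕ → ℕ
  width_zero : width 0 = 1
  W : (i : ℕ) → Matrix (Fin (width i)) (Fin (width (i + 1))) ℝ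
  φ : ℕ → ℝ → ℝ
  A : Matrix (Fin (width depth)) (Fin n) ℝ

namespace ThresholdNetwork

variable {n : ℕ} (net : ThresholdNetwork n)

/-- The number `k` of rows of the innermost weight matrix. -/
def k : ℕ := net.width net.depth

/-- The outer layers: `y ↦ W₀ φ₀ (W₁ φ₁ (⋯ W_{j-1} φ_{j-1} (y)))`,
each activation being applied entrywise. -/
def outer : (j : ℕ) → (Fin (net.width j) → ℝ) → (Fin (net.width 0) → ℝ)
  | 0, y => y
  | j + 1, y => outer j ((net.W j).mulVec fun a => net.φ j (y a))

/-- The scalar network before the threshold, as a function on `ℝⁿ`. -/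
def sigma (x : EuclideanSpace ℝ (Fin n)) : ℝ :=
  net.outer net.depth (net.A.mulVec fun i => x i) ⟨0, by rw [net.width_zero]; exact Nat.one_pos⟩

/-- The thresholded network `M : ℝⁿ → {0,1} ⊆ ℝ`. -/
def M (x : EuclideanSpace ℝ (Fin n)) : ℝ := threshold (net.sigma x)

/-- `σ_V(x) = σ(A (I - P_V) x)`. -/
def sigmaOff (V : Submodule ℝ (EuclideanSpace ℝ (Fin n))) (x : EuclideanSpace ℝ (Fin n)) : ℝ :=
  net.sigma (x - V.starProjection x)

/-- `Span(A)`: the row span of the innermost weight matrix. -/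
def rowSpan : Submodule ℝ (EuclideanSpace ℝ (Fin n)) :=
  Submodule.span ℝ (Set.range fun a : Fin (net.width net.depth) => WithLp.toLp 2 (net.A a))

/-- The assumptions on the network, with parameters `L i` (activation bounds), `κ i` (scale bounds on
the weight matrices, where `κ depth` is the one for `A`), `γ` and `η`. -/
structure Assumptions (L κ : ℕ → ℝ) (γ η : ℝ) : Prop where
  gamma_pos : 0 < γ
  eta_pos : 0 < η
  /-- The activations are twice differentiable ... -/
  diff : ∀ i < net.depth, Differentiable ℝ (net.φ i)
  diff_deriv : ∀ i < net.depth, Differentiable ℝ (deriv (net.φ i))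
  /-- ... vanish at zero ... -/
  map_zero : ∀ i < net.depth, net.φ i 0 = 0
  /-- ... and have first and second derivatives bounded by `L i`. -/
  deriv_le : ∀ i < net.depth, ∀ t, |deriv (net.φ i) t| ≤ L i
  deriv2_le : ∀ i < net.depth, ∀ t, |deriv (deriv (net.φ i)) t| ≤ L i
  /-- Scale of the weights: the spectral norm of `W i` is at most `κ i`, that of `A` at most `κ depth`.
  (If a matrix is scaled so that its least singular value is `1`, then its spectral norm is its
  condition number, which may then be taken as this bound.) -/
  kappa_nonneg : ∀ i ≤ net.depth, 0 ≤ κ i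
  norm_W_le : ∀ i < net.depth, ∀ v : EuclideanSpace ℝ (Fin (net.width (i + 1))),
    ‖Matrix.toEuclideanLin (net.W i) v‖ ≤ κ i * ‖v‖
  norm_A_le : ∀ v : EuclideanSpace ℝ (Fin n),
    ‖Matrix.toEuclideanLin net.A v‖ ≤ κ net.depth * ‖v‖
  /-- The network is non-zero with probability at least `γ` (which forces `A` to have rank `k`). -/
  nonvanishing : ∀ V : Submodule ℝ (EuclideanSpace ℝ (Fin n)), Module.finrank ℝ V < net.k →
    γ ≤ (stdGaussian (EuclideanSpace ℝ (Fin n))).real {g | 1 ≤ net.sigmaOff V g}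
  /-- Gradients are not arbitrarily small at the threshold: with probability at least `γ` over `g`,
  both `σ_V(g) ≥ 1`, and at all points of the open ray through `g` where `σ_V` takes the value `1` its
  directional derivative in the direction `g` is at least `η` in absolute value. -/
  gradient : ∀ V : Submodule ℝ (EuclideanSpace ℝ (Fin n)), Module.finrank ℝ V < net.k →
    γ ≤ (stdGaussian (EuclideanSpace ℝ (Fin n))).real
      {g | (∀ c : ℝ, 0 < c → net.sigmaOff V (c • g) = 1 →
              η ≤ |lineDeriv ℝ (net.sigmaOff V) (c • g) g|) ∧
           1 ≤ net.sigmaOff V g}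

end ThresholdNetwork

/-- The size parameter `N`. It depends on the network only through the dimensions `n`, `k`, the depth
`d` and the bounds `L`, `κ`, `γ`, `η`. The `2 +` keeps every logarithm positive. -/
def sizeParam (n k d : ℕ) (L κ : ℕ → ℝ) (γ η ε δ : ℝ) : ℕ :=
  ⌈(n : ℝ) + k + 1 / γ + ∑ i ∈ Finset.range d, Real.log (2 + L i)
    + ∑ i ∈ Finset.range (d + 1), Real.log (2 + κ i)
    + Real.log (2 + 1 / η) + Real.log (1 / ε) + Real.log (1 / δ)⌉₊

/-! ### Randomized real random access machines with an oracle

A machine has integer registers `I 0, I 1, …` and an array of real cells `R 0, R 1, …`. Integer registers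
are named directly by the program; real cells are addressed only through the contents of integer
registers. The program text is a finite object that depends on nothing. -/

/-- Programs. -/
inductive RProg : Type
  /-- `I a := v` -/
  | natConst (a v : ℕ)
  /-- `I a := I b + I c` -/
  | natAdd (a b c : ℕ)
  /-- `I a := I b - I c` (truncated) -/
  | natSub (a b c : ℕ)
  /-- `R[I a] := z` -/
  | const (a : ℕ) (z : ℤ)
  /-- `R[I a] := R[I b] + R[I c]` -/
  | add (a b c : ℕ)
  /-- `R[I a] := R[I b] - R[I c]` -/
  | sub (a b c : ℕ)
  /-- `R[I a] := R[I b] * R[I c]` -/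
  | mul (a b c : ℕ)
  /-- `R[I a] := R[I b] / R[I c]` (with value `0` if the divisor is `0`) -/
  | div (a b c : ℕ)
  /-- `R[I a] := √R[I b]` (with value `0` if the argument is negative) -/
  | sqrt (a b : ℕ)
  /-- `R[I a] :=` a fresh standard Gaussian -/
  | gauss (a : ℕ)
  /-- `R[I a] := M(x)` where `x` is the vector in the `n` consecutive cells starting at `R[I b]` -/
  | query (a b : ℕ)
  /-- run the first program, then the second -/
  | seq (p q : RProg)
  /-- if `I a ≤ I b` run the first program, otherwise the second -/
  | ifNatLE (a b : ℕ) (p q : RProg)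
  /-- if `R[I a] ≤ R[I b]` run the first program, otherwise the second -/
  | ifLE (a b : ℕ) (p q : RProg)
  /-- repeat the program; the number of rounds is the value of `I a` on entry -/
  | loop (a : ℕ) (p : RProg)

/-- Configurations: memory, the number of Gaussians drawn so far, the number of steps made so far, and the
number of oracle queries made so far. -/
@[ext]
structure RState where
  I : ℕ → ℕ
  R : ℕ → ℝ
  draws : ℕ
  time : ℕ
  queries : ℕ

namespace RState

/-- Charge one step. -/
def tick (s : RState) : RState := { s with time := s.time + 1 }

/-- Write to an integer register. -/
def setI (s : RState) (a v : ℕ) : RState := { s with I := Function.update s.I a v }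

/-- Write to the real cell addressed by the integer register `a`. -/
def setR (s : RState) (a : ℕ) (r : ℝ) : RState := { s with R := Function.update s.R (s.I a) r }

/-- Read the real cell addressed by the integer register `a`. -/
def getR (s : RState) (a : ℕ) : ℝ := s.R (s.I a)

/-- Read the vector of length `n` in the consecutive real cells starting at `base`. -/
def vec (s : RState) (n base : ℕ) : EuclideanSpace ℝ (Fin n) :=
  WithLp.toLp 2 fun i => s.R (base + i)

/-- The initial configuration on input `(n, k, N)`. -/
def init (n k N : ℕ) : RState where
  I := fun a => if a = 0 then n else if a = 1 then k else if a = 2 then N else 0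
  R := fun _ => 0
  draws := 0
  time := 0
  queries := 0

/-- The subspace of `ℝⁿ` encoded by a configuration: the span of the `k` vectors that are stored one after
the other in the first `k * n` real cells. -/
def output (s : RState) (n k : ℕ) : Submodule ℝ (EuclideanSpace ℝ (Fin n)) :=
  Submodule.span ℝ (Set.range fun j : Fin k => s.vec n (j * n))

end RState

namespace RProg

/-- Execution of a program with oracle `M` and with the sequence `ω` as the source of Gaussians.
Every elementary instruction, every branching and every round of a loop costs one step
(entering a loop, too). -/
def run {n : ℕ} (M : EuclideanSpace ℝ (Fin n) → ℝ) (ω : ℕ → ℝ) : RProg → RState → RState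
  | natConst a v, s => (s.setI a v).tick
  | natAdd a b c, s => (s.setI a (s.I b + s.I c)).tick
  | natSub a b c, s => (s.setI a (s.I b - s.I c)).tick
  | const a z, s => (s.setR a z).tick
  | add a b c, s => (s.setR a (s.getR b + s.getR c)).tick
  | sub a b c, s => (s.setR a (s.getR b - s.getR c)).tick
  | mul a b c, s => (s.setR a (s.getR b * s.getR c)).tick
  | div a b c, s => (s.setR a (s.getR b / s.getR c)).tick
  | sqrt a b, s => (s.setR a (Real.sqrt (s.getR b))).tick
  | gauss a, s => { (s.setR a (ω s.draws)).tick with draws := s.draws + 1 }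
  | query a b, s => { (s.setR a (M (s.vec n (s.I b)))).tick with queries := s.queries + 1 }
  | seq p q, s => run M ω q (run M ω p s)
  | ifNatLE a b p q, s => if s.I a ≤ s.I b then run M ω p s.tick else run M ω q s.tick
  | ifLE a b p q, s =>
      haveI := Classical.propDecidable (s.getR a ≤ s.getR b)
      if s.getR a ≤ s.getR b then run M ω p s.tick else run M ω q s.tick
  | loop a p, s => (fun t => run M ω p t.tick)^[s.I a] s.tick

end RProg

/-- The law of the random source: independent standard Gaussians. -/
def gaussianSource : Measure (ℕ → ℝ) := Measure.infinitePi fun _ : ℕ => gaussianReal 0 1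

end

/-!
The algorithm recovers the row span from gradients of `σ` at points of the decision boundary `σ = 1`. Such a
gradient lies in the row span, and the oracle determines it up to a factor, although it only answers `0` or
`1`. To see this, let `z` be a vector with `σ z ≥ 1`. Since `σ 0 = 0`, bisection finds a point `c • z` of the
boundary. If the base point is shifted by a tiny vector `h • y`, then the boundary on the line in direction
`z` moves by `h * t` with `t ≈ -⟪∇σ, y⟫ / ⟪∇σ, z⟫`, and a second bisection finds this `t`, the *response* to
`y`. So the responses to the coordinate vectors form a multiple of the gradient (`exists_linear_response`),
provided that `⟪∇σ, z⟫` is not small.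

A round draws `g` at random, takes for `z` the component of `g` orthogonal to the vectors found so far, and
appends the normalized part of the response vector that is orthogonal to these vectors. By the gradient
assumption, with `V` the span of the vectors found so far, the round succeeds with probability at least about
`γ` (`accept_of_good`, `Assumptions.ofReal_le_prod_accepts`); the new part is then not small, as its inner
product with `z` is close to `-1`.

It remains to recognize the rounds in which the crossing is ill-conditioned and the response vector is
meaningless. For this the response to a random `y` is compared with its inner product with the response
vector. The oracle is blind to the orthogonal complement of the row span, and so is the response. Hence, if
the response vector has a component `p` in this complement, then the difference of the two quantities is an
affine function of slope `-‖p‖` in the direction of `p`, and Gaussian anticoncentration makes it unlikely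
that the difference is small (`stdGaussian_nonlinearity_le`). An accepted vector therefore lies close to the
row span whatever the reason for its acceptance, and the errors grow by at most a fixed factor with
every vector (`GoodState.update`). As all scales are exponential in a polynomial of `N`, while bisection
takes linearly many steps in the number of digits, even this growth is harmless.

The probability of failure is bounded by induction on the number of rounds, for all good starting states at
once (`gaussianSource_failureSet_le`). Finally, the algorithm `learn` is realized by the program `learnProg`,
whose correctness is `output_learnProg` and whose running time is bounded in `time_learnProg_le`; a query
costs one step, so that the number of queries is bounded as well.
-/

/-! ### Memory semantics of programs -/

/-- The memory of a machine (without its counters), together with the part of the random source that has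
not been read yet. -/
@[ext]
structure Memory where
  I : ℕ → ℕ
  R : ℕ → ℝ
  w : ℕ → ℝ

namespace RProg

open Classical in
/-- The effect of a program on the memory. Drawing a Gaussian removes the head of the stream `w`. -/
noncomputable def eval {n : ℕ} (M : EuclideanSpace ℝ (Fin n) → ℝ) : RProg → Memory → Memory
  | natConst a v, s => { s with I := Function.update s.I a v }
  | natAdd a b c, s => { s with I := Function.update s.I a (s.I b + s.I c) }
  | natSub a b c, s => { s with I := Function.update s.I a (s.I b - s.I c) }
  | const a z, s => { s with R := Function.update s.R (s.I a) z }
  | add a b c, s => { s with R := Function.update s.R (s.I a) (s.R (s.I b) + s.R (s.I c)) }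
  | sub a b c, s => { s with R := Function.update s.R (s.I a) (s.R (s.I b) - s.R (s.I c)) }
  | mul a b c, s => { s with R := Function.update s.R (s.I a) (s.R (s.I b) * s.R (s.I c)) }
  | div a b c, s => { s with R := Function.update s.R (s.I a) (s.R (s.I b) / s.R (s.I c)) }
  | sqrt a b, s => { s with R := Function.update s.R (s.I a) (Real.sqrt (s.R (s.I b))) }
  | gauss a, s => { s with R := Function.update s.R (s.I a) (s.w 0), w := fun i => s.w (i + 1) }
  | query a b, s => { s with
      R := Function.update s.R (s.I a) (M (WithLp.toLp 2 fun i => s.R (s.I b + i))) }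
  | seq p q, s => eval M q (eval M p s)
  | ifNatLE a b p q, s => if s.I a ≤ s.I b then eval M p s else eval M q s
  | ifLE a b p q, s => if s.R (s.I a) ≤ s.R (s.I b) then eval M p s else eval M q s
  | loop a p, s => (eval M p)^[s.I a] s

/-- The integer registers a program may write to. -/
def writes : RProg → List ℕ
  | natConst a _ | natAdd a _ _ | natSub a _ _ => [a]
  | seq p q | ifNatLE _ _ p q | ifLE _ _ p q => writes p ++ writes q
  | loop _ p => writes p
  | _ => []

/-- The integer registers that hold the number of rounds of some loop. -/
def loopRegs : RProg → List ℕ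
  | seq p q | ifNatLE _ _ p q | ifLE _ _ p q => loopRegs p ++ loopRegs q
  | loop a p => a :: loopRegs p
  | _ => []

/-- A bound on the running time in terms of the contents of the loop registers,
valid when the program does not modify them. -/
def cost : RProg → (ℕ → ℕ) → ℕ
  | seq p q, I => cost p I + cost q I
  | ifNatLE _ _ p q, I | ifLE _ _ p q, I => 1 + (cost p I + cost q I)
  | loop a p, I => 1 + I a * (1 + cost p I)
  | _, _ => 1

/-- The memory of a configuration. -/
def _root_.RState.memory (ω : ℕ → ℝ) (s : RState) : Memory := ⟨s.I, s.R, fun i => ω (s.draws + i)⟩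

variable {n : ℕ} (M : EuclideanSpace ℝ (Fin n) → ℝ)

/-- Execution acts on the memory by `eval`; the counters do not influence it. -/
theorem memory_run (ω : ℕ → ℝ) (p : RProg) : ∀ s : RState,
    (p.run M ω s).memory ω = p.eval M (s.memory ω) := by
  induction p with
  | gauss a =>
      intro s
      ext i
      · rfl
      · rfl
      · simp [run, eval, RState.memory, RState.setR, RState.tick, add_comm, add_left_comm]
  | seq p q hp hq => intro s; simp only [run, eval, hq, hp]
  | ifNatLE a b p q hp hq =>
      intro s
      simp only [run, eval]
      rw [show (s.memory ω).I = s.I from rfl]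
      split_ifs
      · exact hp _
      · exact hq _
  | ifLE a b p q hp hq =>
      intro s
      by_cases h : s.getR a ≤ s.getR b
      · have h' : (s.memory ω).R ((s.memory ω).I a) ≤ (s.memory ω).R ((s.memory ω).I b) := h
        rw [run, eval, if_pos h, if_pos h']
        exact hp _
      · have h' : ¬ (s.memory ω).R ((s.memory ω).I a) ≤ (s.memory ω).R ((s.memory ω).I b) := h
        rw [run, eval, if_neg h, if_neg h']
        exact hq _
  | loop a p hp =>
      intro s
      simp only [run, eval]
      rw [show (s.memory ω).I = s.I from rfl]
      have key : ∀ (m : ℕ) (t : RState),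
          ((fun t => run M ω p t.tick)^[m] t).memory ω = (eval M p)^[m] (t.memory ω) := by
        intro m
        induction m with
        | zero => intro t; rfl
        | succ m ih =>
            intro t
            rw [Function.iterate_succ_apply, Function.iterate_succ_apply, ih, hp]
            rfl
      exact key _ _
  | _ => intro s; rfl

theorem eval_I_of_notMem_writes (p : RProg) : ∀ (s : Memory) (r : ℕ), r ∉ p.writes →
    (p.eval M s).I r = s.I r := by
  induction p with
  | natConst a v | natAdd a b c | natSub a b c =>
      intro s r hr
      simp only [writes, List.mem_singleton] at hr
      simp [eval, Function.update_of_ne hr]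
  | seq p q hp hq =>
      intro s r hr
      simp only [writes, List.mem_append, not_or] at hr
      rw [eval, hq _ _ hr.2, hp _ _ hr.1]
  | ifNatLE a b p q hp hq | ifLE a b p q hp hq =>
      intro s r hr
      simp only [writes, List.mem_append, not_or] at hr
      rw [eval]
      split_ifs
      · exact hp _ _ hr.1
      · exact hq _ _ hr.2
  | loop a p hp =>
      intro s r hr
      simp only [writes] at hr
      rw [eval]
      generalize s.I a = m
      induction m with
      | zero => rfl
      | succ m ih => rw [Function.iterate_succ_apply', hp _ _ hr, ih]
  | _ => intro s r _; rfl

theorem run_I_of_notMem_writes (ω : ℕ → ℝ) (p : RProg) (s : RState) (r : ℕ) (hr : r ∉ p.writes) :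
    (p.run M ω s).I r = s.I r :=
  (congrFun (congrArg Memory.I (memory_run M ω p s)) r).trans
    (eval_I_of_notMem_writes M p (s.memory ω) r hr)

theorem cost_congr (p : RProg) : ∀ {I J : ℕ → ℕ}, (∀ r ∈ p.loopRegs, I r = J r) →
    p.cost I = p.cost J := by
  induction p with
  | seq p q hp hq | ifNatLE a b p q hp hq | ifLE a b p q hp hq =>
      intro I J h
      simp only [loopRegs, List.mem_append] at h
      simp only [cost, hp fun r hr => h r (Or.inl hr), hq fun r hr => h r (Or.inr hr)]
  | loop a p hp =>
      intro I J h
      simp only [loopRegs, List.mem_cons] at h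
      simp only [cost, hp fun r hr => h r (Or.inr hr), h a (Or.inl rfl)]
  | _ => intro I J _; rfl

/-- If a program does not write to its own loop registers, then its running time is determined by their
initial contents. -/
theorem time_run_le (ω : ℕ → ℝ) (p : RProg) : (∀ r ∈ p.loopRegs, r ∉ p.writes) → ∀ s : RState,
    (p.run M ω s).time ≤ s.time + p.cost s.I := by
  induction p with
  | seq p q hp hq =>
      intro h s
      simp only [loopRegs, writes, List.mem_append, not_or] at h
      have h1 := hp (fun r hr => (h r (Or.inl hr)).1) s
      have h2 := hq (fun r hr => (h r (Or.inr hr)).2) (p.run M ω s)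
      have h3 : q.cost (p.run M ω s).I = q.cost s.I :=
        cost_congr q fun r hr => run_I_of_notMem_writes M ω p s r (h r (Or.inr hr)).1
      simp only [run, cost]
      omega
  | ifNatLE a b p q hp hq | ifLE a b p q hp hq =>
      intro h s
      simp only [loopRegs, writes, List.mem_append, not_or] at h
      have h1 := hp (fun r hr => (h r (Or.inl hr)).1) s.tick
      have h2 := hq (fun r hr => (h r (Or.inr hr)).2) s.tick
      have h3 : s.tick.time = s.time + 1 := rfl
      have h4 : s.tick.I = s.I := rfl
      rw [h3, h4] at h1 h2
      simp only [run, cost]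
      split_ifs <;> omega
  | loop a p hp =>
      intro h s
      simp only [loopRegs, writes, List.mem_cons] at h
      have key : ∀ m : ℕ, (∀ r ∈ p.loopRegs, ((fun t => run M ω p t.tick)^[m] s.tick).I r = s.I r) ∧
          ((fun t => run M ω p t.tick)^[m] s.tick).time ≤ s.time + 1 + m * (1 + p.cost s.I) := by
        intro m
        induction m with
        | zero => exact ⟨fun r _ => rfl, by simp [RState.tick]⟩
        | succ m ih =>
            rw [Function.iterate_succ_apply']
            generalize (fun t => run M ω p t.tick)^[m] s.tick = u at ih
            have h1 := hp (fun r hr => h r (Or.inr hr)) u.tick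
            have h2 : p.cost u.tick.I = p.cost s.I := cost_congr p ih.1
            have h3 : u.tick.time = u.time + 1 := rfl
            refine ⟨fun r hr => ?_, ?_⟩
            · exact (run_I_of_notMem_writes M ω p u.tick r (h r (Or.inr hr))).trans (ih.1 r hr)
            · have := ih.2
              rw [h2, h3] at h1
              refine h1.trans ?_
              rw [Nat.succ_mul]
              omega
      have := (key (s.I a)).2
      simp only [run, cost]
      omega
  | _ => intro _ s; exact le_refl _

/-- A run makes at most as many queries as steps. -/
theorem queries_add_time_le (ω : ℕ → ℝ) (p : RProg) : ∀ s : RState,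
    (p.run M ω s).queries + s.time ≤ s.queries + (p.run M ω s).time := by
  induction p with
  | seq p q hp hq =>
      intro s
      have h1 := hp s
      have h2 := hq (p.run M ω s)
      simp only [run]
      omega
  | ifNatLE a b p q hp hq | ifLE a b p q hp hq =>
      intro s
      have h1 := hp s.tick
      have h2 := hq s.tick
      have h3 : s.tick.time = s.time + 1 := rfl
      have h4 : s.tick.queries = s.queries := rfl
      simp only [run]
      split_ifs <;> omega
  | loop a p hp =>
      intro s
      have key : ∀ m : ℕ, ((fun t => run M ω p t.tick)^[m] s.tick).queries + s.time ≤
          s.queries + ((fun t => run M ω p t.tick)^[m] s.tick).time := by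
        intro m
        induction m with
        | zero => simp [RState.tick]
        | succ m ih =>
            rw [Function.iterate_succ_apply']
            generalize (fun t => run M ω p t.tick)^[m] s.tick = u at ih
            have h1 := hp u.tick
            have h3 : u.tick.time = u.time + 1 := rfl
            have h4 : u.tick.queries = u.queries := rfl
            omega
      exact key _
  | query a b =>
      intro s
      simp only [run, RState.tick, RState.setR]
      omega
  | _ => intro s; simp [run, RState.tick, RState.setR, RState.setI]

theorem eval_loop_induction {p : RProg} {a : ℕ} {s : Memory} (Inv : ℕ → Memory → Prop) (h0 : Inv 0 s)
    (hs : ∀ i < s.I a, ∀ t, Inv i t → Inv (i + 1) (p.eval M t)) :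
    Inv (s.I a) ((loop a p).eval M s) := by
  have key : ∀ m ≤ s.I a, Inv m ((p.eval M)^[m] s) := by
    intro m
    induction m with
    | zero => exact fun _ => h0
    | succ m ih =>
        intro hm
        rw [Function.iterate_succ_apply']
        exact hs m hm _ (ih (by omega))
  exact key _ le_rfl

end RProg

/-! ### The algorithm -/

/-- One step of the bisection of `[t, t + 2 s]`, stored as the pair `(t, s)`. -/
noncomputable def bisectStep (f : ℝ → ℝ) (p : ℝ × ℝ) : ℝ × ℝ :=
  (if f (p.1 + p.2) ≤ 1 / 2 then p.1 + p.2 else p.1, p.2 * (1 / 2))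

/-- The left end of the interval that remains after `T` bisection steps on `[t, t + 2 s]`, which look for
a change from `0` to `1` of the `0/1`-valued function `f`. -/
noncomputable def bisect (f : ℝ → ℝ) (T : ℕ) (t s : ℝ) : ℝ := ((bisectStep f)^[T] (t, s)).1

section

variable {n : ℕ}

/-- Remove from `x` its components along `V 0, …, V (j-1)`, one after the other. -/
noncomputable def deflate (V : ℕ → EuclideanSpace ℝ (Fin n)) :
    ℕ → EuclideanSpace ℝ (Fin n) → EuclideanSpace ℝ (Fin n)
  | 0, x => x
  | j + 1, x => deflate V j x - inner ℝ (V j) (deflate V j x) • V j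

/-- The point `c` of `[0, 1]`, found by bisection, at which the oracle changes on the segment from `0`
to `g`. -/
noncomputable def crossing (M : EuclideanSpace ℝ (Fin n) → ℝ) (T : ℕ) (g : EuclideanSpace ℝ (Fin n)) :
    ℝ :=
  bisect (fun c => M (c • g)) T 0 (1 / 2)

/-- The displacement `t ∈ [-K, K]`, in units of `h`, along `g` that compensates for a shift of the base
point `c • g` by `h • y`: the oracle changes at `c • g + h • y + t • h • g`. -/
noncomputable def response (M : EuclideanSpace ℝ (Fin n) → ℝ) (K h : ℝ) (T : ℕ)
    (g : EuclideanSpace ℝ (Fin n)) (c : ℝ) (y : EuclideanSpace ℝ (Fin n)) : ℝ :=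
  bisect (fun t => M (c • g + h • y + t • h • g)) T (-K) K

/-- The vector of the responses to shifts along the coordinate axes. If the oracle is a thresholded smooth
function, it is close to a multiple of the gradient. -/
noncomputable def responseVec (M : EuclideanSpace ℝ (Fin n) → ℝ) (K h : ℝ) (T : ℕ)
    (g : EuclideanSpace ℝ (Fin n)) (c : ℝ) : EuclideanSpace ℝ (Fin n) :=
  WithLp.toLp 2 fun i => response M K h T g c (EuclideanSpace.single i 1)

/-- The failure of linearity of the response at the random shift `y`. -/
noncomputable def nonlinearity (M : EuclideanSpace ℝ (Fin n) → ℝ) (K h : ℝ) (T : ℕ)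
    (g y : EuclideanSpace ℝ (Fin n)) : ℝ :=
  response M K h T g (crossing M T g) y - inner ℝ (responseVec M K h T g (crossing M T g)) y

open Classical in
/-- One round: a new unit vector is appended to the list `V 0, …, V (j-1)` if the response is
sufficiently linear and has a sufficiently large component orthogonal to the list. -/
noncomputable def learnStep (M : EuclideanSpace ℝ (Fin n) → ℝ) (k : ℕ) (K h : ℝ) (T : ℕ)
    (s : (ℕ → EuclideanSpace ℝ (Fin n)) × ℕ) (g y : EuclideanSpace ℝ (Fin n)) :
    (ℕ → EuclideanSpace ℝ (Fin n)) × ℕ :=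
  let z := deflate s.1 k g
  let b := deflate s.1 k (responseVec M K h T z (crossing M T z))
  if s.2 < k ∧ nonlinearity M K h T z y * nonlinearity M K h T z y ≤ h ∧ 1 / 2 ≤ K * ‖b‖ ^ 2 then
    (Function.update s.1 s.2 (‖b‖⁻¹ • b), s.2 + 1)
  else s

/-- The first `n` entries of the random source, as a vector. -/
noncomputable def headVec (n : ℕ) (w : ℕ → ℝ) : EuclideanSpace ℝ (Fin n) :=
  WithLp.toLp 2 fun i => w i

/-- The random source without its first `n` entries. -/
def shiftSource (n : ℕ) (w : ℕ → ℝ) : ℕ → ℝ := fun i => w (n + i)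

/-- The state after `R` rounds. -/
noncomputable def learn (M : EuclideanSpace ℝ (Fin n) → ℝ) (k : ℕ) (K h : ℝ) (T : ℕ) :
    ℕ → (ℕ → EuclideanSpace ℝ (Fin n)) × ℕ → (ℕ → ℝ) → (ℕ → EuclideanSpace ℝ (Fin n)) × ℕ
  | 0, s, _ => s
  | R + 1, s, w => learn M k K h T R
      (learnStep M k K h T s (headVec n w) (headVec n (shiftSource n w)))
      (shiftSource n (shiftSource n w))

end

namespace RProg

/-! ### The program -/

/-
Registers: `0`, `1`, `2` hold `n`, `k`, `N`, and `3` holds `1`; `4`, `5`, `6`, `7` hold the exponent of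
`h = (1/2)^·`, the number of bisection steps, the number of rounds, and the exponent of `K = 2^·`; `10`, …,
`16` and `20`, …, `24` hold the addresses of the scalar and vector variables listed in `View`; `25` holds
`k * n`. Registers from `30` on are loop indices and temporary addresses, except for `36`, which holds
the address of the next vector of the list.
-/

/-- Run a program for all values `0, …, n-1` of the index register; register `0` holds `n`, and register `3`
holds `1`. -/
def forEach (idx : ℕ) (body : RProg) : RProg :=
  seq (natConst idx 0) (loop 0 (seq body (natAdd idx idx 3)))

/-- A program without effect. -/
def skip : RProg := natConst 30 0

/-- Fill a vector with Gaussians. -/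
def sampleProg (b : ℕ) : RProg := forEach 30 (seq (natAdd 33 b 30) (gauss 33))

/-- Remove from a vector its component along the vector stored at the address in register `32`. -/
def deflateOnceProg (b : ℕ) : RProg :=
  seq (const 15 0) <|
  seq (forEach 30 (seq (natAdd 33 b 30) (seq (natAdd 34 32 30) (seq (mul 16 34 33) (add 15 15 16)))))
    (forEach 30 (seq (natAdd 33 b 30) (seq (natAdd 34 32 30) (seq (mul 16 15 34) (sub 33 33 16)))))

/-- The program for `deflate`. -/
def deflateProg (b : ℕ) : RProg :=
  seq (natConst 32 0) (loop 1 (seq (deflateOnceProg b) (natAdd 32 32 0)))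

/-- Compute the next query point. -/
def pointProg : RProg :=
  forEach 30 (seq (natAdd 33 22 30) (seq (natAdd 34 20 30) (seq (natAdd 35 21 30)
    (seq (mul 33 13 34) (add 33 35 33)))))

/-- The program for `bisectStep`. -/
def bisectStepProg : RProg :=
  seq (add 13 13 14) (seq pointProg (seq (query 16 22) (seq (ifLE 16 10 skip (sub 13 13 14))
    (mul 14 14 10))))

/-- The program for `bisect`. -/
def bisectProg : RProg := loop 5 bisectStepProg

/-- The program for `crossing`. -/
def crossingProg : RProg :=
  seq (forEach 30 (seq (natAdd 33 21 30) (const 33 0)))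
    (seq (const 13 0) (seq (const 14 0) (seq (add 14 14 10) bisectProg)))

/-- Move the base point to the crossing and rescale the direction. -/
def rebaseProg : RProg :=
  seq (forEach 30 (seq (natAdd 33 21 30) (seq (natAdd 34 20 30) (mul 33 13 34))))
    (forEach 30 (seq (natAdd 34 20 30) (mul 34 11 34)))

/-- Bisection on `[-K, K]`. -/
def windowProg : RProg :=
  seq (const 13 0) (seq (sub 13 13 12) (seq (const 14 0) (seq (add 14 14 12) bisectProg)))

/-- One coordinate of `responseVec`. -/
def responseCoordProg : RProg :=
  seq (natAdd 33 21 31) (seq (add 33 33 11) (seq windowProg (seq (natAdd 33 23 31) (seq (const 33 0)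
    (seq (add 33 33 13) (seq (natAdd 33 21 31) (sub 33 33 11)))))))

/-- The program for `responseVec`. -/
def responseVecProg : RProg := forEach 31 responseCoordProg

/-- Compute the square of the failure of linearity at the random shift. -/
def residualProg : RProg :=
  seq (forEach 30 (seq (natAdd 33 21 30) (seq (natAdd 34 24 30) (seq (mul 16 11 34) (add 33 33 16)))))
    (seq windowProg (seq
      (forEach 30 (seq (natAdd 33 23 30) (seq (natAdd 34 24 30) (seq (mul 16 33 34) (sub 13 13 16)))))
      (mul 13 13 13)))

/-- Compute `‖b‖²` and `K ‖b‖²`. -/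
def normSqProg : RProg :=
  seq (const 15 0) (seq (forEach 30 (seq (natAdd 33 23 30) (seq (mul 16 33 33) (add 15 15 16))))
    (mul 14 12 15))

/-- Append the normalized vector. -/
def storeProg : RProg :=
  seq (sqrt 15 15) (seq (forEach 30 (seq (natAdd 33 36 30) (seq (natAdd 34 23 30) (div 33 34 15))))
    (natAdd 36 36 0))

/-- Decide whether the new vector is accepted. -/
def acceptProg : RProg :=
  ifNatLE 25 36 skip (ifLE 13 11 (ifLE 10 14 storeProg skip) skip)

/-- The program for `learnStep`. -/
def roundProg : RProg :=
  seq (sampleProg 20) (seq (sampleProg 24) (seq (deflateProg 20) (seq crossingProg (seq rebaseProg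
    (seq responseVecProg (seq residualProg (seq (deflateProg 23) (seq normSqProg acceptProg))))))))

/-! ### Memory layout -/

/-- The contents of the integer registers that stay fixed during the rounds. -/
structure Layout (n k m T : ℕ) (I : ℕ → ℕ) : Prop where
  r0 : I 0 = n
  r1 : I 1 = k
  r3 : I 3 = 1
  r5 : I 5 = T
  r10 : I 10 = m
  r11 : I 11 = m + 1
  r12 : I 12 = m + 2
  r13 : I 13 = m + 3
  r14 : I 14 = m + 4
  r15 : I 15 = m + 5
  r16 : I 16 = m + 6
  r20 : I 20 = m + 7
  r21 : I 21 = m + 7 + n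
  r22 : I 22 = m + 7 + 2 * n
  r23 : I 23 = m + 7 + 3 * n
  r24 : I 24 = m + 7 + 4 * n
  r25 : I 25 = m

theorem Layout.congr {n k m T : ℕ} {I J : ℕ → ℕ} (h : Layout n k m T I) (e : ∀ r < 30, J r = I r) :
    Layout n k m T J := by
  constructor <;> (rw [e _ (by norm_num)]; first
    | exact h.r0 | exact h.r1 | exact h.r3 | exact h.r5 | exact h.r10 | exact h.r11 | exact h.r12
    | exact h.r13 | exact h.r14 | exact h.r15 | exact h.r16 | exact h.r20 | exact h.r21 | exact h.r22
    | exact h.r23 | exact h.r24 | exact h.r25)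

variable {n : ℕ} {M : EuclideanSpace ℝ (Fin n) → ℝ}

theorem Layout.eval {k m T : ℕ} {s : Memory} (h : Layout n k m T s.I) {p : RProg}
    (hp : ∀ r ∈ p.writes, 30 ≤ r) : Layout n k m T (p.eval M s).I :=
  h.congr fun r hr => eval_I_of_notMem_writes M p s r fun hm => by have := hp r hm; omega

/-- The vector stored at an address. -/
def vecAt (n : ℕ) (R : ℕ → ℝ) (b : ℕ) : EuclideanSpace ℝ (Fin n) := WithLp.toLp 2 fun i => R (b + i)

/-- The meaningful part of the real memory: constants, scalar variables, four vectors, and the list of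
the vectors found. The query point and one scalar cell are scratch space and do not appear. After the last
bisection of a round, the cells `t` and `s` hold the two quantities that decide about acceptance. -/
structure View (n : ℕ) where
  /-- the constant `1/2` -/
  half : ℝ
  /-- the size of the shifts -/
  h : ℝ
  /-- the bound for the responses -/
  K : ℝ
  /-- the left end of the bisection interval -/
  t : ℝ
  /-- half the length of the bisection interval -/
  s : ℝ
  /-- an accumulator for sums -/
  acc : ℝ
  /-- the direction of the line on which bisection takes place -/
  G : EuclideanSpace ℝ (Fin n)
  /-- the base point of this line -/
  P : EuclideanSpace ℝ (Fin n)
  /-- the response vector -/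
  D : EuclideanSpace ℝ (Fin n)
  /-- the random shift -/
  Y : EuclideanSpace ℝ (Fin n)
  /-- the vectors found -/
  V : ℕ → EuclideanSpace ℝ (Fin n)

/-- The view of a memory in which the list of vectors occupies the first `m` cells. -/
def view (n k m : ℕ) (R : ℕ → ℝ) : View n where
  half := R m
  h := R (m + 1)
  K := R (m + 2)
  t := R (m + 3)
  s := R (m + 4)
  acc := R (m + 5)
  G := vecAt n R (m + 7)
  P := vecAt n R (m + 7 + n)
  D := vecAt n R (m + 7 + 3 * n)
  Y := vecAt n R (m + 7 + 4 * n)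
  V := fun j => if j < k then vecAt n R (j * n) else 0

theorem vecAt_congr {R R' : ℕ → ℝ} {b : ℕ} (h : ∀ i < n, R' (b + i) = R (b + i)) :
    vecAt n R' b = vecAt n R b := by
  unfold vecAt
  congr 1
  funext i
  exact h i i.2

theorem add_lt_of_lt_mul {j k i : ℕ} (hj : j < k) (hi : i < n) : j * n + i < k * n :=
  calc j * n + i < j * n + n := by omega
    _ = (j + 1) * n := by ring
    _ ≤ k * n := Nat.mul_le_mul_right _ hj

theorem viewV_congr {k m : ℕ} (hm : m = k * n) {R R' : ℕ → ℝ} (h : ∀ x < m, R' x = R x) :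
    (view n k m R').V = (view n k m R).V := by
  funext j
  simp only [view]
  split_ifs with hj
  · exact vecAt_congr fun i hi => h _ (hm ▸ add_lt_of_lt_mul hj hi)
  · rfl

/-- The cells that do not appear in a view: one scalar, and the query point. -/
def Scratch (n m x : ℕ) : Prop := x = m + 6 ∨ (m + 7 + 2 * n ≤ x ∧ x < m + 7 + 3 * n)

theorem view_eq_of_V {k m : ℕ} {R' : ℕ → ℝ} {v : View n} (hV : (view n k m R').V = v.V)
    (h0 : R' m = v.half) (h1 : R' (m + 1) = v.h) (h2 : R' (m + 2) = v.K)
    (h3 : R' (m + 3) = v.t) (h4 : R' (m + 4) = v.s) (h5 : R' (m + 5) = v.acc)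
    (hG : vecAt n R' (m + 7) = v.G) (hP : vecAt n R' (m + 7 + n) = v.P)
    (hD : vecAt n R' (m + 7 + 3 * n) = v.D) (hY : vecAt n R' (m + 7 + 4 * n) = v.Y) :
    view n k m R' = v := by
  have e : ∀ v : View n, v = ⟨v.half, v.h, v.K, v.t, v.s, v.acc, v.G, v.P, v.D, v.Y, v.V⟩ := fun _ => rfl
  rw [e (view n k m R'), e v, hV]
  congr 1

theorem view_eq {k m : ℕ} (hm : m = k * n) {R R' : ℕ → ℝ} {v : View n} (hv : v.V = (view n k m R).V)
    (hR : ∀ x < m, R' x = R x) (h0 : R' m = v.half) (h1 : R' (m + 1) = v.h) (h2 : R' (m + 2) = v.K)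
    (h3 : R' (m + 3) = v.t) (h4 : R' (m + 4) = v.s) (h5 : R' (m + 5) = v.acc)
    (hG : vecAt n R' (m + 7) = v.G) (hP : vecAt n R' (m + 7 + n) = v.P)
    (hD : vecAt n R' (m + 7 + 3 * n) = v.D) (hY : vecAt n R' (m + 7 + 4 * n) = v.Y) :
    view n k m R' = v :=
  view_eq_of_V ((viewV_congr hm hR).trans hv.symm) h0 h1 h2 h3 h4 h5 hG hP hD hY

section
variable {k m : ℕ} {R R' : ℕ → ℝ} {r : ℝ} {v : ℕ → ℝ}

/-! The lemmas `view_set_*` translate a change of some cells into a change of one field of the view. -/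

theorem view_of_scratch (hm : m = k * n) (h : ∀ x, ¬ Scratch n m x → R' x = R x) : view n k m R' = view n k m R := by
  apply view_eq (R := R) hm ?_ (fun x hx => h x (by unfold Scratch; omega)) <;> first
    | exact h _ (by unfold Scratch; omega)
    | exact vecAt_congr fun i hi => h _ (by unfold Scratch; omega)
    | rfl

theorem view_set_t (hm : m = k * n) (hr : R' (m + 3) = r) (h : ∀ x, ¬ Scratch n m x → x ≠ m + 3 → R' x = R x) :
    view n k m R' = { view n k m R with t := r } := by
  apply view_eq (R := R) hm ?_ (fun x hx => h x (by unfold Scratch; omega) (by omega)) <;> first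
    | exact hr
    | exact h _ (by unfold Scratch; omega) (by omega)
    | exact vecAt_congr fun i hi => h _ (by unfold Scratch; omega) (by omega)
    | rfl

theorem view_set_s (hm : m = k * n) (hr : R' (m + 4) = r) (h : ∀ x, ¬ Scratch n m x → x ≠ m + 4 → R' x = R x) :
    view n k m R' = { view n k m R with s := r } := by
  apply view_eq (R := R) hm ?_ (fun x hx => h x (by unfold Scratch; omega) (by omega)) <;> first
    | exact hr
    | exact h _ (by unfold Scratch; omega) (by omega)
    | exact vecAt_congr fun i hi => h _ (by unfold Scratch; omega) (by omega)
    | rfl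

theorem view_set_acc (hm : m = k * n) (hr : R' (m + 5) = r) (h : ∀ x, ¬ Scratch n m x → x ≠ m + 5 → R' x = R x) :
    view n k m R' = { view n k m R with acc := r } := by
  apply view_eq (R := R) hm ?_ (fun x hx => h x (by unfold Scratch; omega) (by omega)) <;> first
    | exact hr
    | exact h _ (by unfold Scratch; omega) (by omega)
    | exact vecAt_congr fun i hi => h _ (by unfold Scratch; omega) (by omega)
    | rfl

theorem vecAt_of_eq {R : ℕ → ℝ} {b : ℕ} {v : ℕ → ℝ} (h : ∀ i < n, R (b + i) = v i) :
    vecAt n R b = WithLp.toLp 2 fun i : Fin n => v i := by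
  unfold vecAt
  congr 1
  funext i
  exact h i i.2

theorem view_set_G (hm : m = k * n) (hr : ∀ i < n, R' (m + 7 + i) = v i)
    (h : ∀ x, ¬ Scratch n m x → ¬ (m + 7 ≤ x ∧ x < m + 7 + n) → R' x = R x) :
    view n k m R' = { view n k m R with G := WithLp.toLp 2 fun i : Fin n => v i } := by
  apply view_eq (R := R) hm ?_ (fun x hx => h x (by unfold Scratch; omega) (by omega)) <;> first
    | exact vecAt_of_eq hr
    | exact h _ (by unfold Scratch; omega) (by omega)
    | exact vecAt_congr fun i hi => h _ (by unfold Scratch; omega) (by omega)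
    | rfl

theorem view_set_P (hm : m = k * n) (hr : ∀ i < n, R' (m + 7 + n + i) = v i)
    (h : ∀ x, ¬ Scratch n m x → ¬ (m + 7 + n ≤ x ∧ x < m + 7 + n + n) → R' x = R x) :
    view n k m R' = { view n k m R with P := WithLp.toLp 2 fun i : Fin n => v i } := by
  apply view_eq (R := R) hm ?_ (fun x hx => h x (by unfold Scratch; omega) (by omega)) <;> first
    | exact vecAt_of_eq hr
    | exact h _ (by unfold Scratch; omega) (by omega)
    | exact vecAt_congr fun i hi => h _ (by unfold Scratch; omega) (by omega)
    | rfl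

theorem view_set_D (hm : m = k * n) (hr : ∀ i < n, R' (m + 7 + 3 * n + i) = v i)
    (h : ∀ x, ¬ Scratch n m x → ¬ (m + 7 + 3 * n ≤ x ∧ x < m + 7 + 3 * n + n) → R' x = R x) :
    view n k m R' = { view n k m R with D := WithLp.toLp 2 fun i : Fin n => v i } := by
  apply view_eq (R := R) hm ?_ (fun x hx => h x (by unfold Scratch; omega) (by omega)) <;> first
    | exact vecAt_of_eq hr
    | exact h _ (by unfold Scratch; omega) (by omega)
    | exact vecAt_congr fun i hi => h _ (by unfold Scratch; omega) (by omega)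
    | rfl

theorem view_set_Y (hm : m = k * n) (hr : ∀ i < n, R' (m + 7 + 4 * n + i) = v i)
    (h : ∀ x, ¬ Scratch n m x → ¬ (m + 7 + 4 * n ≤ x ∧ x < m + 7 + 4 * n + n) → R' x = R x) :
    view n k m R' = { view n k m R with Y := WithLp.toLp 2 fun i : Fin n => v i } := by
  apply view_eq (R := R) hm ?_ (fun x hx => h x (by unfold Scratch; omega) (by omega)) <;> first
    | exact vecAt_of_eq hr
    | exact h _ (by unfold Scratch; omega) (by omega)
    | exact vecAt_congr fun i hi => h _ (by unfold Scratch; omega) (by omega)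
    | rfl
end

/-! ### Loops over the coordinates -/

/-- Induction over the rounds of a `forEach` loop, for invariants that concern the real memory and the random
source. -/
theorem forEach_induction {idx : ℕ} {body : RProg} (hidx : 30 ≤ idx) (hw : ∀ r ∈ body.writes, 30 ≤ r)
    (hnot : idx ∉ body.writes) {k m T : ℕ} {s : Memory} (hs : Layout n k m T s.I)
    (Inv : ℕ → (ℕ → ℝ) → (ℕ → ℝ) → Prop) (h0 : Inv 0 s.R s.w)
    (hstep : ∀ i < n, ∀ t : Memory, Layout n k m T t.I → t.I idx = i →
      (∀ r, r ≠ idx → r ∉ body.writes → t.I r = s.I r) → Inv i t.R t.w →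
      Inv (i + 1) (body.eval M t).R (body.eval M t).w) :
    Inv n ((forEach idx body).eval M s).R ((forEach idx body).eval M s).w := by
  have hs' : Layout n k m T (Function.update s.I idx 0) :=
    hs.congr fun r hr => Function.update_of_ne (by omega) _ _
  have hn : (Function.update s.I idx 0) 0 = n := hs'.r0
  have key := eval_loop_induction (M := M) (p := seq body (natAdd idx idx 3)) (a := 0)
    (s := { s with I := Function.update s.I idx 0 })
    (fun i t => Layout n k m T t.I ∧ t.I idx = i ∧
      (∀ r, r ≠ idx → r ∉ body.writes → t.I r = s.I r) ∧ Inv i t.R t.w)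
    ⟨hs', by simp, fun r hr _ => by simp [hr], h0⟩
    (by
      rintro i hi t ⟨ht, hti, htr, hinv⟩
      have hb := ht.eval (M := M) (p := body) hw
      refine ⟨hb.congr fun r hr => ?_, ?_, ?_, ?_⟩
      · simp only [eval]
        exact Function.update_of_ne (by omega) _ _
      · simp only [eval, Function.update_self, hb.r3]
        rw [eval_I_of_notMem_writes M body t idx hnot, hti]
      · intro r hr hr'
        simp only [eval]
        rw [Function.update_of_ne hr, eval_I_of_notMem_writes M body t r hr', htr r hr hr']
      · exact hstep i (by simpa only [hn] using hi) t ht hti htr hinv)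
  have := key.2.2.2
  simp only [hn] at this
  exact this

/-- A loop that computes the entries of a vector one after the other. -/
theorem forEach_map {idx : ℕ} {body : RProg} (hidx : 30 ≤ idx) (hw : ∀ r ∈ body.writes, 30 ≤ r)
    (hnot : idx ∉ body.writes) {k m T : ℕ} {s : Memory} (hs : Layout n k m T s.I) (X : ℕ → Prop) (b : ℕ)
    (v : ℕ → ℝ) (hb : ∀ i < n, ¬ X (b + i))
    (hstep : ∀ i < n, ∀ t : Memory, Layout n k m T t.I → t.I idx = i →
      (∀ r, r ≠ idx → r ∉ body.writes → t.I r = s.I r) →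
      (∀ x, ¬ X x → ¬ (b ≤ x ∧ x < b + i) → t.R x = s.R x) →
      (body.eval M t).w = t.w ∧ (body.eval M t).R (b + i) = v i ∧
      ∀ x, ¬ X x → x ≠ b + i → (body.eval M t).R x = t.R x) :
    ((forEach idx body).eval M s).w = s.w ∧
    (∀ i < n, ((forEach idx body).eval M s).R (b + i) = v i) ∧
    ∀ x, ¬ X x → ¬ (b ≤ x ∧ x < b + n) → ((forEach idx body).eval M s).R x = s.R x := by
  refine forEach_induction (M := M) hidx hw hnot hs
    (fun j R w => w = s.w ∧ (∀ i < j, R (b + i) = v i) ∧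
      ∀ x, ¬ X x → ¬ (b ≤ x ∧ x < b + j) → R x = s.R x) ⟨rfl, by simp, fun _ _ _ => rfl⟩ ?_
  rintro i hi t ht hti htr ⟨h1, h2, h3⟩
  obtain ⟨g1, g2, g3⟩ := hstep i hi t ht hti htr h3
  refine ⟨g1.trans h1, fun j hj => ?_, fun x hx hx' => ?_⟩
  · rcases Nat.lt_succ_iff_lt_or_eq.1 hj with h | rfl
    · rw [g3 _ (hb j (by omega)) (by omega), h2 j h]
    · exact g2
  · rw [g3 x hx (by omega), h3 x hx (by omega)]

/-- A loop that adds up numbers in one cell. -/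
theorem forEach_sum {idx : ℕ} {body : RProg} (hidx : 30 ≤ idx) (hw : ∀ r ∈ body.writes, 30 ≤ r)
    (hnot : idx ∉ body.writes) {k m T : ℕ} {s : Memory} (hs : Layout n k m T s.I) (X : ℕ → Prop) (c : ℕ)
    (f : ℕ → ℝ)
    (hstep : ∀ i < n, ∀ t : Memory, Layout n k m T t.I → t.I idx = i →
      (∀ r, r ≠ idx → r ∉ body.writes → t.I r = s.I r) →
      (∀ x, ¬ X x → x ≠ c → t.R x = s.R x) →
      (body.eval M t).w = t.w ∧ (body.eval M t).R c = t.R c + f i ∧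
      ∀ x, ¬ X x → x ≠ c → (body.eval M t).R x = t.R x) :
    ((forEach idx body).eval M s).w = s.w ∧
    ((forEach idx body).eval M s).R c = s.R c + ∑ i : Fin n, f i ∧
    ∀ x, ¬ X x → x ≠ c → ((forEach idx body).eval M s).R x = s.R x := by
  rw [Fin.sum_univ_eq_sum_range]
  refine forEach_induction (M := M) hidx hw hnot hs
    (fun j R w => w = s.w ∧ R c = s.R c + ∑ i ∈ Finset.range j, f i ∧
      ∀ x, ¬ X x → x ≠ c → R x = s.R x) ⟨rfl, by simp, fun _ _ _ => rfl⟩ ?_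
  rintro i hi t ht hti htr ⟨h1, h2, h3⟩
  obtain ⟨g1, g2, g3⟩ := hstep i hi t ht hti htr h3
  refine ⟨g1.trans h1, ?_, fun x hx hx' => by rw [g3 x hx hx', h3 x hx hx']⟩
  rw [g2, h2, Finset.sum_range_succ, add_assoc]

/-! ### Correctness of the parts of a round -/

section
variable {k m T : ℕ} {s : Memory}

theorem eval_sampleProg_aux (hs : Layout n k m T s.I) {a b : ℕ} (ha : a < 30) (hb : s.I a = b) :
    ((sampleProg a).eval M s).w = shiftSource n s.w ∧
    (∀ i < n, ((sampleProg a).eval M s).R (b + i) = s.w i) ∧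
    ∀ x, ¬ (b ≤ x ∧ x < b + n) → ((sampleProg a).eval M s).R x = s.R x := by
  refine forEach_induction (M := M) le_rfl (by simp [writes]) (by simp [writes]) hs
    (fun j R w => w = (fun i => s.w (j + i)) ∧ (∀ i < j, R (b + i) = s.w i) ∧
      ∀ x, ¬ (b ≤ x ∧ x < b + j) → R x = s.R x) ⟨by simp, by simp, fun _ _ => rfl⟩ ?_
  rintro i hi t ht hti htr ⟨h1, h2, h3⟩
  have hta : t.I a = b := (htr a (by omega) (by simp [writes]; omega)).trans hb
  have hR : ((seq (natAdd 33 a 30) (gauss 33)).eval M t).R = Function.update t.R (b + i) (s.w i) := by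
    simp [eval, hta, hti, h1]
  have hw : ((seq (natAdd 33 a 30) (gauss 33)).eval M t).w = fun j => t.w (j + 1) := rfl
  rw [hR, hw]
  refine ⟨?_, fun j hj => ?_, fun x hx => ?_⟩
  · funext j
    rw [h1]
    exact congrArg s.w (by omega)
  · rcases Nat.lt_succ_iff_lt_or_eq.1 hj with h | rfl
    · rw [Function.update_of_ne (by omega), h2 j h]
    · simp
  · rw [Function.update_of_ne (by omega), h3 x (by omega)]

theorem eval_sampleProg_G (hm : m = k * n) (hs : Layout n k m T s.I) :
    ((sampleProg 20).eval M s).w = shiftSource n s.w ∧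
    view n k m ((sampleProg 20).eval M s).R = { view n k m s.R with G := headVec n s.w } := by
  obtain ⟨h1, h2, h3⟩ := eval_sampleProg_aux (M := M) hs (by norm_num) hs.r20
  exact ⟨h1, view_set_G hm h2 fun x _ hx => h3 x hx⟩

theorem eval_sampleProg_Y (hm : m = k * n) (hs : Layout n k m T s.I) :
    ((sampleProg 24).eval M s).w = shiftSource n s.w ∧
    view n k m ((sampleProg 24).eval M s).R = { view n k m s.R with Y := headVec n s.w } := by
  obtain ⟨h1, h2, h3⟩ := eval_sampleProg_aux (M := M) hs (by norm_num) hs.r24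
  exact ⟨h1, view_set_Y hm h2 fun x _ hx => h3 x hx⟩

/-- One deflation, for the vector at address `b` with the unit vector at address `c`. -/
theorem eval_deflateOnceProg_aux (hs : Layout n k m T s.I) {a b c : ℕ} (ha : a < 30) (hb : s.I a = b)
    (hc : s.I 32 = c) (hcm : c + n ≤ m) (hbm : m + 7 ≤ b)
    (hbX : ∀ i < n, ¬ Scratch n m (b + i)) :
    ((deflateOnceProg a).eval M s).w = s.w ∧
    (∀ i < n, ((deflateOnceProg a).eval M s).R (b + i) = s.R (b + i) -
      (∑ j : Fin n, s.R (c + j) * s.R (b + j)) * s.R (c + i)) ∧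
    ∀ x, ¬ Scratch n m x → x ≠ m + 5 → ¬ (b ≤ x ∧ x < b + n) →
      ((deflateOnceProg a).eval M s).R x = s.R x := by
  set s1 : Memory := { s with R := Function.update s.R (m + 5) 0 } with hs1
  have e1 : (const 15 0).eval M s = s1 := by simp [eval, hs1, hs.r15]
  have hl1 : Layout n k m T s1.I := hs
  set p2 := forEach 30 (seq (natAdd 33 a 30) (seq (natAdd 34 32 30) (seq (mul 16 34 33) (add 15 15 16))))
    with hp2
  set p3 := forEach 30 (seq (natAdd 33 a 30) (seq (natAdd 34 32 30) (seq (mul 16 15 34) (sub 33 33 16))))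
    with hp3
  have w2 : p2.writes = [30, 33, 34, 30] := rfl
  obtain ⟨f1, f2, f3⟩ : (p2.eval M s1).w = s1.w ∧
      (p2.eval M s1).R (m + 5) = s1.R (m + 5) + ∑ j : Fin n, s.R (c + j) * s.R (b + j) ∧
      ∀ x, ¬ Scratch n m x → x ≠ m + 5 → (p2.eval M s1).R x = s1.R x := by
    refine forEach_sum (M := M) le_rfl (by simp [writes]) (by simp [writes]) hl1 (Scratch n m) (m + 5)
      (fun j => s.R (c + j) * s.R (b + j)) ?_
    intro i hi t ht hti htr hR
    have hta : t.I a = b := (htr a (by omega) (by simp [writes]; omega)).trans hb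
    have htc : t.I 32 = c := (htr 32 (by omega) (by simp [writes])).trans hc
    have v1 : t.R (c + i) = s.R (c + i) := by
      rw [hR _ (by unfold Scratch; omega) (by omega)]
      exact Function.update_of_ne (by omega) _ _
    have v2 : t.R (b + i) = s.R (b + i) := by
      rw [hR _ (hbX i hi) (by omega)]
      exact Function.update_of_ne (by omega) _ _
    have hE : ((seq (natAdd 33 a 30) (seq (natAdd 34 32 30) (seq (mul 16 34 33) (add 15 15 16)))).eval M
        t).R = Function.update (Function.update t.R (m + 6) (s.R (c + i) * s.R (b + i))) (m + 5)
          (t.R (m + 5) + s.R (c + i) * s.R (b + i)) := by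
      simp [eval, hta, htc, hti, ht.r15, ht.r16, v1, v2]
    refine ⟨rfl, by simp [hE], fun x hx hx' => ?_⟩
    rw [hE, Function.update_of_ne hx', Function.update_of_ne (fun h => hx (Or.inl h))]
  have hl2 : Layout n k m T (p2.eval M s1).I := hl1.eval (by simp [w2])
  set s2 := p2.eval M s1 with hs2
  have hacc : s2.R (m + 5) = ∑ j : Fin n, s.R (c + j) * s.R (b + j) := by
    rw [f2]; simp [hs1]
  have hoff : ∀ x, ¬ Scratch n m x → x ≠ m + 5 → s2.R x = s.R x := fun x hx hx' => by
    rw [f3 x hx hx']; exact Function.update_of_ne hx' _ _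
  have hI2 : ∀ r, r ≠ 30 → r ≠ 33 → r ≠ 34 → s2.I r = s.I r := fun r h1 h2 h3 =>
    eval_I_of_notMem_writes M p2 s1 r (by simp [w2, h1, h2, h3])
  obtain ⟨g1, g2, g3⟩ : (p3.eval M s2).w = s2.w ∧
      (∀ i < n, (p3.eval M s2).R (b + i) = s.R (b + i) -
        (∑ j : Fin n, s.R (c + j) * s.R (b + j)) * s.R (c + i)) ∧
      ∀ x, ¬ Scratch n m x → ¬ (b ≤ x ∧ x < b + n) → (p3.eval M s2).R x = s2.R x := by
    refine forEach_map (M := M) le_rfl (by simp [writes]) (by simp [writes]) hl2 (Scratch n m) b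
      _ hbX ?_
    intro i hi t ht hti htr hR
    have hta : t.I a = b := (htr a (by omega) (by simp [writes]; omega)).trans
      ((hI2 a (by omega) (by omega) (by omega)).trans hb)
    have htc : t.I 32 = c := (htr 32 (by omega) (by simp [writes])).trans
      ((hI2 32 (by omega) (by omega) (by omega)).trans hc)
    have v1 : t.R (c + i) = s.R (c + i) := by
      rw [hR _ (by unfold Scratch; omega) (by omega), hoff _ (by unfold Scratch; omega) (by omega)]
    have v2 : t.R (b + i) = s.R (b + i) := by
      rw [hR _ (hbX i hi) (by omega), hoff _ (hbX i hi) (by omega)]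
    have v3 : t.R (m + 5) = ∑ j : Fin n, s.R (c + j) * s.R (b + j) := by
      rw [hR _ (by unfold Scratch; omega) (by omega), hacc]
    have hne : b + i ≠ m + 6 := by omega
    have hE : ((seq (natAdd 33 a 30) (seq (natAdd 34 32 30) (seq (mul 16 15 34) (sub 33 33 16)))).eval M
        t).R = Function.update (Function.update t.R (m + 6)
          ((∑ j : Fin n, s.R (c + j) * s.R (b + j)) * s.R (c + i))) (b + i)
          (s.R (b + i) - (∑ j : Fin n, s.R (c + j) * s.R (b + j)) * s.R (c + i)) := by
      simp [eval, hta, htc, hti, ht.r15, ht.r16, v1, v2, v3, Function.update_of_ne hne]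
    refine ⟨rfl, by simp [hE], fun x hx hx' => ?_⟩
    rw [hE, Function.update_of_ne hx', Function.update_of_ne (fun h => hx (Or.inl h))]
  have e : (deflateOnceProg a).eval M s = p3.eval M s2 := by
    rw [hs2, ← e1]; rfl
  rw [e]
  exact ⟨g1.trans f1, g2, fun x hx hx' hx'' => by rw [g3 x hx hx'', hoff x hx hx']⟩

end
/-! ### Correctness of deflation and bisection -/

section
variable {n : ℕ} {M : EuclideanSpace ℝ (Fin n) → ℝ} {k m T : ℕ} {s : Memory}

theorem inner_vecAt (R : ℕ → ℝ) (b c : ℕ) :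
    inner ℝ (vecAt n R b) (vecAt n R c) = ∑ i : Fin n, R (b + i) * R (c + i) := by
  simp [vecAt, PiLp.inner_apply, mul_comm]

theorem eval_deflateProg_aux (hm : m = k * n) (hs : Layout n k m T s.I) {a b : ℕ} (ha : a < 30)
    (hb : s.I a = b) (hbm : m + 7 ≤ b) (hbX : ∀ i < n, ¬ Scratch n m (b + i)) :
    ((deflateProg a).eval M s).w = s.w ∧
    vecAt n ((deflateProg a).eval M s).R b = deflate (view n k m s.R).V k (vecAt n s.R b) ∧
    ∀ x, ¬ Scratch n m x → x ≠ m + 5 → ¬ (b ≤ x ∧ x < b + n) →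
      ((deflateProg a).eval M s).R x = s.R x := by
  have hs' : Layout n k m T (Function.update s.I 32 0) :=
    hs.congr fun r hr => Function.update_of_ne (by omega) _ _
  have hk : (Function.update s.I 32 0) 1 = k := hs'.r1
  have hwr : (deflateOnceProg a).writes = [30, 33, 34, 30, 30, 33, 34, 30] := rfl
  have key := eval_loop_induction (M := M) (p := seq (deflateOnceProg a) (natAdd 32 32 0)) (a := 1)
    (s := { s with I := Function.update s.I 32 0 })
    (fun j t => Layout n k m T t.I ∧ (∀ r < 30, t.I r = s.I r) ∧ t.I 32 = j * n ∧ t.w = s.w ∧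
      vecAt n t.R b = deflate (view n k m s.R).V j (vecAt n s.R b) ∧
      ∀ x, ¬ Scratch n m x → x ≠ m + 5 → ¬ (b ≤ x ∧ x < b + n) → t.R x = s.R x)
    ⟨hs', fun r hr => Function.update_of_ne (by omega) _ _, by simp, rfl, rfl, fun _ _ _ _ => rfl⟩
    (by
      rintro j hj t ⟨ht, htI, ht32, htw, htv, htR⟩
      have hjk : j < k := by simpa only [hk] using hj
      have hcm : j * n + n ≤ m := by
        rw [hm, ← Nat.succ_mul]
        exact Nat.mul_le_mul_right _ hjk
      have hta : t.I a = b := (htI a ha).trans hb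
      obtain ⟨g1, g2, g3⟩ := eval_deflateOnceProg_aux (M := M) ht ha hta ht32 hcm hbm hbX
      have hl := ht.eval (M := M) (p := deflateOnceProg a) (by simp [hwr])
      have hV : vecAt n t.R (j * n) = (view n k m s.R).V j := by
        simp only [view, if_pos hjk]
        exact vecAt_congr fun i hi => htR _ (by unfold Scratch; omega) (by omega) (by omega)
      refine ⟨hl.congr fun r hr => Function.update_of_ne (by omega) _ _, ?_, ?_, g1.trans htw, ?_, ?_⟩
      · intro r hr
        simp only [eval]
        rw [Function.update_of_ne (by omega), eval_I_of_notMem_writes M _ t r, htI r hr]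
        rw [hwr]
        intro hmem
        simp only [List.mem_cons, List.not_mem_nil, or_false] at hmem
        omega
      · simp only [eval, Function.update_self, hl.r0]
        rw [eval_I_of_notMem_writes M _ t 32 (by simp [hwr]), ht32, Nat.succ_mul]
      · change vecAt n ((deflateOnceProg a).eval M t).R b = _
        rw [deflate, ← htv, ← hV, inner_vecAt]
        ext i
        exact g2 i i.2
      · intro x h1 h2 h3
        exact (g3 x h1 h2 h3).trans (htR x h1 h2 h3))
  have e : (deflateProg a).eval M s = (loop 1 (seq (deflateOnceProg a) (natAdd 32 32 0))).eval M
      { s with I := Function.update s.I 32 0 } := rfl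
  rw [e]
  simp only [hk] at key
  exact key.2.2.2

theorem eval_deflateProg_G (hm : m = k * n) (hs : Layout n k m T s.I) :
    ((deflateProg 20).eval M s).w = s.w ∧ ∃ a, view n k m ((deflateProg 20).eval M s).R =
      { view n k m s.R with
        acc := a
        G := deflate (view n k m s.R).V k (view n k m s.R).G } := by
  obtain ⟨h1, h2, h3⟩ := eval_deflateProg_aux (M := M) hm hs (a := 20) (by norm_num) hs.r20 (by omega)
    (fun i hi => by unfold Scratch; omega)
  refine ⟨h1, ((deflateProg 20).eval M s).R (m + 5), ?_⟩
  apply view_eq (R := s.R) hm ?_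
    (fun x hx => h3 x (by unfold Scratch; omega) (by omega) (by omega)) <;> first
    | exact h2
    | exact h3 _ (by unfold Scratch; omega) (by omega) (by omega)
    | exact vecAt_congr fun i hi => h3 _ (by unfold Scratch; omega) (by omega) (by omega)
    | rfl

theorem eval_deflateProg_D (hm : m = k * n) (hs : Layout n k m T s.I) :
    ((deflateProg 23).eval M s).w = s.w ∧ ∃ a, view n k m ((deflateProg 23).eval M s).R =
      { view n k m s.R with
        acc := a
        D := deflate (view n k m s.R).V k (view n k m s.R).D } := by
  obtain ⟨h1, h2, h3⟩ := eval_deflateProg_aux (M := M) hm hs (a := 23) (by norm_num) hs.r23 (by omega)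
    (fun i hi => by unfold Scratch; omega)
  refine ⟨h1, ((deflateProg 23).eval M s).R (m + 5), ?_⟩
  apply view_eq (R := s.R) hm ?_
    (fun x hx => h3 x (by unfold Scratch; omega) (by omega) (by omega)) <;> first
    | exact h2
    | exact h3 _ (by unfold Scratch; omega) (by omega) (by omega)
    | exact vecAt_congr fun i hi => h3 _ (by unfold Scratch; omega) (by omega) (by omega)
    | rfl

theorem eval_pointProg (hs : Layout n k m T s.I) :
    (pointProg.eval M s).w = s.w ∧
    (vecAt n (pointProg.eval M s).R (m + 7 + 2 * n) =
      (view n k m s.R).P + (view n k m s.R).t • (view n k m s.R).G) ∧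
    ∀ x, ¬ (m + 7 + 2 * n ≤ x ∧ x < m + 7 + 2 * n + n) → (pointProg.eval M s).R x = s.R x := by
  obtain ⟨h1, h2, h3⟩ := forEach_map (M := M) (s := s) (idx := 30)
    (body := seq (natAdd 33 22 30) (seq (natAdd 34 20 30) (seq (natAdd 35 21 30)
      (seq (mul 33 13 34) (add 33 35 33))))) le_rfl (by simp [writes]) (by simp [writes]) hs
    (fun _ => False) (m + 7 + 2 * n)
    (fun i => s.R (m + 7 + n + i) + s.R (m + 3) * s.R (m + 7 + i)) (by simp) (by
      intro i hi t ht hti htr hR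
      have v1 : t.R (m + 7 + n + i) = s.R (m + 7 + n + i) := hR _ not_false (by omega)
      have v2 : t.R (m + 7 + i) = s.R (m + 7 + i) := hR _ not_false (by omega)
      have v3 : t.R (m + 3) = s.R (m + 3) := hR _ not_false (by omega)
      have hne : m + 7 + n + i ≠ m + 7 + 2 * n + i := by omega
      have hE : ((seq (natAdd 33 22 30) (seq (natAdd 34 20 30) (seq (natAdd 35 21 30)
        (seq (mul 33 13 34) (add 33 35 33))))).eval M t).R = Function.update t.R (m + 7 + 2 * n + i)
          (s.R (m + 7 + n + i) + s.R (m + 3) * s.R (m + 7 + i)) := by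
        simp [eval, hti, ht.r13, ht.r20, ht.r21, ht.r22, v1, v2, v3, Function.update_of_ne hne]
      refine ⟨rfl, by simp [hE], fun x _ hx' => ?_⟩
      rw [hE, Function.update_of_ne hx'])
  refine ⟨h1, ?_, fun x hx => h3 x not_false hx⟩
  ext i
  exact h2 i i.2

theorem eval_bisectStepProg (hm : m = k * n) (hs : Layout n k m T s.I)
    (hhalf : (view n k m s.R).half = 1 / 2) :
    (bisectStepProg.eval M s).w = s.w ∧ view n k m (bisectStepProg.eval M s).R =
      { view n k m s.R with
        t := (bisectStep (fun t => M ((view n k m s.R).P + t • (view n k m s.R).G))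
          ((view n k m s.R).t, (view n k m s.R).s)).1
        s := (bisectStep (fun t => M ((view n k m s.R).P + t • (view n k m s.R).G))
          ((view n k m s.R).t, (view n k m s.R).s)).2 } := by
  set s1 : Memory := { s with R := Function.update s.R (m + 3) (s.R (m + 3) + s.R (m + 4)) } with hs1
  have e1 : (add 13 13 14).eval M s = s1 := by simp [eval, hs1, hs.r13, hs.r14]
  have hl1 : Layout n k m T s1.I := hs
  have hv1 : view n k m s1.R = { view n k m s.R with t := s.R (m + 3) + s.R (m + 4) } :=
    view_set_t hm (by simp [hs1]) (fun x _ hx => Function.update_of_ne hx _ _)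
  obtain ⟨f1, f2, f3⟩ := eval_pointProg (M := M) hl1
  set s2 := pointProg.eval M s1 with hs2
  have hl2 : Layout n k m T s2.I := hl1.eval (by simp [pointProg, forEach, writes])
  set r : ℝ := M ((view n k m s.R).P + (s.R (m + 3) + s.R (m + 4)) • (view n k m s.R).G) with hr
  set s3 : Memory := { s2 with R := Function.update s2.R (m + 6) r } with hs3
  have e3 : (query 16 22).eval M s2 = s3 := by
    have : M (vecAt n s2.R (m + 7 + 2 * n)) = r := by rw [f2, hv1]
    simp only [eval, hl2.r16, hl2.r22, hs3]
    rw [← this]; rfl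
  have hl3 : Layout n k m T s3.I := hl2
  have hs3R : ∀ x, ¬ Scratch n m x → s3.R x = s1.R x := by
    intro x hx
    unfold Scratch at hx
    rw [← f3 x (by omega)]
    exact Function.update_of_ne (by omega) _ _
  have hv3 : view n k m s3.R = view n k m s1.R := view_of_scratch hm hs3R
  have hr3 : s3.R (m + 6) = r := Function.update_self ..
  have hh3 : s3.R m = 1 / 2 := by
    have : (view n k m s3.R).half = (view n k m s.R).half := by rw [hv3, hv1]
    exact this.trans hhalf
  have ht3 : s3.R (m + 3) = s.R (m + 3) + s.R (m + 4) := by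
    have : (view n k m s3.R).t = (view n k m s1.R).t := by rw [hv3]
    rw [hv1] at this; exact this
  have hss3 : s3.R (m + 4) = s.R (m + 4) := by
    have : (view n k m s3.R).s = (view n k m s1.R).s := by rw [hv3]
    rw [hv1] at this; exact this
  set t' : ℝ := if r ≤ 1 / 2 then s.R (m + 3) + s.R (m + 4) else s.R (m + 3) with ht'
  set s4 := (ifLE 16 10 skip (sub 13 13 14)).eval M s3 with hs4
  have hs4w : s4.w = s3.w := by
    rw [hs4, eval]; split_ifs <;> rfl
  have hl4 : Layout n k m T s4.I := hl3.eval (by simp [skip, writes])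
  have hs4R : s4.R = Function.update s3.R (m + 3) t' := by
    rw [hs4, eval, hl3.r16, hl3.r10, hr3, hh3]
    by_cases h : r ≤ 1 / 2
    · rw [if_pos h, ht', if_pos h, ← ht3, Function.update_eq_self]
      rfl
    · rw [if_neg h, ht', if_neg h]
      simp only [eval, hl3.r13, hl3.r14, ht3, hss3, add_sub_cancel_right]
  have hv4 : view n k m s4.R = { view n k m s3.R with t := t' } :=
    view_set_t hm (by simp [hs4R]) (fun x _ hx => by rw [hs4R]; exact Function.update_of_ne hx _ _)
  have hR5 : ((mul 14 14 10).eval M s4).R = Function.update s4.R (m + 4) (s.R (m + 4) * (1 / 2)) := by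
    have h1 : s4.R (m + 4) = s.R (m + 4) := by
      rw [hs4R, Function.update_of_ne (by omega), hss3]
    have h2 : s4.R m = 1 / 2 := by
      rw [hs4R, Function.update_of_ne (by omega), hh3]
    simp only [eval, hl4.r14, hl4.r10, h1, h2]
  have hv5 : view n k m ((mul 14 14 10).eval M s4).R =
      { view n k m s4.R with s := s.R (m + 4) * (1 / 2) } :=
    view_set_s hm (by simp [hR5]) (fun x _ hx => by rw [hR5]; exact Function.update_of_ne hx _ _)
  have e : bisectStepProg.eval M s = (mul 14 14 10).eval M s4 := by
    rw [hs4, ← e3, hs2, ← e1]; rfl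
  rw [e]
  refine ⟨hs4w.trans f1, ?_⟩
  rw [hv5, hv4, hv3, hv1]
  rfl

theorem eval_bisectProg (hm : m = k * n) (hs : Layout n k m T s.I)
    (hhalf : (view n k m s.R).half = 1 / 2) :
    (bisectProg.eval M s).w = s.w ∧ ∃ a, view n k m (bisectProg.eval M s).R =
      { view n k m s.R with
        t := bisect (fun t => M ((view n k m s.R).P + t • (view n k m s.R).G)) T
          (view n k m s.R).t (view n k m s.R).s
        s := a } := by
  have hwr : ∀ r ∈ bisectStepProg.writes, 30 ≤ r := by
    simp [bisectStepProg, pointProg, forEach, skip, writes]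
  set v := view n k m s.R with hv
  set f := bisectStep (fun t => M (v.P + t • v.G)) with hf
  have key := eval_loop_induction (M := M) (p := bisectStepProg) (a := 5) (s := s)
    (fun j t => Layout n k m T t.I ∧ t.w = s.w ∧
      view n k m t.R = { v with t := (f^[j] (v.t, v.s)).1, s := (f^[j] (v.t, v.s)).2 })
    ⟨hs, rfl, rfl⟩
    (by
      rintro j hj t ⟨ht, htw, htv⟩
      obtain ⟨h1, h2⟩ := eval_bisectStepProg (M := M) hm ht (by rw [htv]; exact hhalf)
      refine ⟨ht.eval hwr, h1.trans htw, ?_⟩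
      rw [h2, htv, Function.iterate_succ_apply'])
  rw [hs.r5] at key
  exact ⟨key.2.1, _, key.2.2⟩

end
/-! ### Correctness of the computation of the response -/

section
variable {n : ℕ} {M : EuclideanSpace ℝ (Fin n) → ℝ} {k m T : ℕ} {s : Memory}

theorem eval_crossingProg (hm : m = k * n) (hs : Layout n k m T s.I)
    (hhalf : (view n k m s.R).half = 1 / 2) :
    (crossingProg.eval M s).w = s.w ∧ ∃ P a, view n k m (crossingProg.eval M s).R =
      { view n k m s.R with
        t := crossing M T (view n k m s.R).G
        s := a
        P := P } := by
  set p1 := forEach 30 (seq (natAdd 33 21 30) (const 33 0)) with hp1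
  obtain ⟨f1, f2, f3⟩ : (p1.eval M s).w = s.w ∧ (∀ i < n, (p1.eval M s).R (m + 7 + n + i) = 0) ∧
      ∀ x, ¬ False → ¬ (m + 7 + n ≤ x ∧ x < m + 7 + n + n) → (p1.eval M s).R x = s.R x := by
    refine forEach_map (M := M) le_rfl (by simp [writes]) (by simp [writes]) hs
      (fun _ => False) (m + 7 + n) (fun _ => 0) (by simp) ?_
    intro i hi t ht hti htr hR
    have hE : ((seq (natAdd 33 21 30) (const 33 0)).eval M t).R =
        Function.update t.R (m + 7 + n + i) 0 := by
      simp [eval, hti, ht.r21]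
    refine ⟨rfl, by simp [hE], fun x _ hx' => ?_⟩
    rw [hE, Function.update_of_ne hx']
  set s1 := p1.eval M s with hs1
  have hl1 : Layout n k m T s1.I := hs.eval (by simp [hp1, forEach, writes])
  have hv1 := view_set_P hm (R := s.R) (v := fun _ => 0) f2 fun x _ hx => f3 x not_false hx
  set s2 : Memory := { s1 with R := Function.update s1.R (m + 3) 0 } with hs2
  have hv2 : view n k m s2.R = { view n k m s1.R with t := 0 } :=
    view_set_t hm (by simp [hs2]) (fun x _ hx => Function.update_of_ne hx _ _)
  set s3 : Memory := { s2 with R := Function.update s2.R (m + 4) (1 / 2) } with hs3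
  have hv3 : view n k m s3.R = { view n k m s2.R with s := 1 / 2 } :=
    view_set_s hm (by simp [hs3]) (fun x _ hx => Function.update_of_ne hx _ _)
  have e : crossingProg.eval M s = bisectProg.eval M s3 := by
    have h : (add 14 14 10).eval M ((const 14 0).eval M ((const 13 0).eval M s1)) = s3 := by
      have hh : s1.R m = 1 / 2 := by
        rw [f3 m not_false (by omega)]; exact hhalf
      simp [eval, hl1.r13, hl1.r14, hl1.r10, hs3, hs2, hh]
    rw [← h]
    rfl
  obtain ⟨g1, a, g2⟩ := eval_bisectProg (M := M) (s := s3) (T := T) hm hl1 (by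
    rw [hv3, hv2, hv1]; exact hhalf)
  rw [e]
  refine ⟨g1.trans f1, WithLp.toLp 2 fun _ => 0, a, ?_⟩
  rw [g2, hv3, hv2, hv1]
  have : (fun t : ℝ => M (WithLp.toLp 2 (fun _ : Fin n => (0 : ℝ)) + t • (view n k m s.R).G)) =
      fun t : ℝ => M (t • (view n k m s.R).G) := by
    funext t
    congr 1
    ext i
    simp
  simp only [this]
  rfl

theorem eval_rebaseProg (hm : m = k * n) (hs : Layout n k m T s.I) :
    (rebaseProg.eval M s).w = s.w ∧ view n k m (rebaseProg.eval M s).R =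
      { view n k m s.R with
        P := (view n k m s.R).t • (view n k m s.R).G
        G := (view n k m s.R).h • (view n k m s.R).G } := by
  set p1 := forEach 30 (seq (natAdd 33 21 30) (seq (natAdd 34 20 30) (mul 33 13 34))) with hp1
  set p2 := forEach 30 (seq (natAdd 34 20 30) (mul 34 11 34)) with hp2
  obtain ⟨f1, f2, f3⟩ : (p1.eval M s).w = s.w ∧
      (∀ i < n, (p1.eval M s).R (m + 7 + n + i) = s.R (m + 3) * s.R (m + 7 + i)) ∧
      ∀ x, ¬ False → ¬ (m + 7 + n ≤ x ∧ x < m + 7 + n + n) → (p1.eval M s).R x = s.R x := by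
    refine forEach_map (M := M) le_rfl (by simp [writes]) (by simp [writes]) hs
      (fun _ => False) (m + 7 + n) (fun i => s.R (m + 3) * s.R (m + 7 + i)) (by simp) ?_
    intro i hi t ht hti htr hR
    have v2 : t.R (m + 7 + i) = s.R (m + 7 + i) := hR _ not_false (by omega)
    have v3 : t.R (m + 3) = s.R (m + 3) := hR _ not_false (by omega)
    have hE : ((seq (natAdd 33 21 30) (seq (natAdd 34 20 30) (mul 33 13 34))).eval M t).R =
        Function.update t.R (m + 7 + n + i) (s.R (m + 3) * s.R (m + 7 + i)) := by
      simp [eval, hti, ht.r21, ht.r20, ht.r13, v2, v3]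
    refine ⟨rfl, by simp [hE], fun x _ hx' => ?_⟩
    rw [hE, Function.update_of_ne hx']
  set s1 := p1.eval M s with hs1
  have hl1 : Layout n k m T s1.I := hs.eval (by simp [hp1, forEach, writes])
  obtain ⟨g1, g2, g3⟩ : (p2.eval M s1).w = s1.w ∧
      (∀ i < n, (p2.eval M s1).R (m + 7 + i) = s.R (m + 1) * s.R (m + 7 + i)) ∧
      ∀ x, ¬ False → ¬ (m + 7 ≤ x ∧ x < m + 7 + n) → (p2.eval M s1).R x = s1.R x := by
    refine forEach_map (M := M) le_rfl (by simp [writes]) (by simp [writes]) hl1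
      (fun _ => False) (m + 7) (fun i => s.R (m + 1) * s.R (m + 7 + i)) (by simp) ?_
    intro i hi t ht hti htr hR
    have v2 : t.R (m + 7 + i) = s.R (m + 7 + i) :=
      (hR _ not_false (by omega)).trans (f3 _ not_false (by omega))
    have v3 : t.R (m + 1) = s.R (m + 1) :=
      (hR _ not_false (by omega)).trans (f3 _ not_false (by omega))
    have hE : ((seq (natAdd 34 20 30) (mul 34 11 34)).eval M t).R =
        Function.update t.R (m + 7 + i) (s.R (m + 1) * s.R (m + 7 + i)) := by
      simp [eval, hti, ht.r20, ht.r11, v2, v3]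
    refine ⟨rfl, by simp [hE], fun x _ hx' => ?_⟩
    rw [hE, Function.update_of_ne hx']
  have e : rebaseProg.eval M s = p2.eval M s1 := rfl
  rw [e]
  refine ⟨g1.trans f1, ?_⟩
  rw [view_set_G hm g2 fun x _ hx => g3 x not_false hx,
    view_set_P hm f2 fun x _ hx => f3 x not_false hx]
  rfl

theorem eval_windowProg (hm : m = k * n) (hs : Layout n k m T s.I)
    (hhalf : (view n k m s.R).half = 1 / 2) :
    (windowProg.eval M s).w = s.w ∧ ∃ a, view n k m (windowProg.eval M s).R =
      { view n k m s.R with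
        t := bisect (fun t => M ((view n k m s.R).P + t • (view n k m s.R).G)) T
          (-(view n k m s.R).K) (view n k m s.R).K
        s := a } := by
  set s2 : Memory := { s with R := Function.update s.R (m + 3) (-s.R (m + 2)) } with hs2
  have hv2 : view n k m s2.R = { view n k m s.R with t := -s.R (m + 2) } :=
    view_set_t hm (by simp [hs2]) (fun x _ hx => Function.update_of_ne hx _ _)
  set s3 : Memory := { s2 with R := Function.update s2.R (m + 4) (s.R (m + 2)) } with hs3
  have hv3 : view n k m s3.R = { view n k m s2.R with s := s.R (m + 2) } :=
    view_set_s hm (by simp [hs3]) (fun x _ hx => Function.update_of_ne hx _ _)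
  have e : windowProg.eval M s = bisectProg.eval M s3 := by
    have h : (add 14 14 12).eval M ((const 14 0).eval M ((sub 13 13 12).eval M
        ((const 13 0).eval M s))) = s3 := by
      simp [eval, hs.r13, hs.r14, hs.r12, hs3, hs2]
    rw [← h]
    rfl
  obtain ⟨g1, a, g2⟩ := eval_bisectProg (M := M) (s := s3) (T := T) hm hs (by
    rw [hv3, hv2]; exact hhalf)
  rw [e]
  refine ⟨g1, a, ?_⟩
  rw [g2, hv3, hv2]
  rfl

theorem writes_windowProg : ∀ r ∈ windowProg.writes, r = 30 ∨ r = 33 ∨ r = 34 ∨ r = 35 := by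
  simp [windowProg, bisectProg, bisectStepProg, pointProg, forEach, skip, writes]

/-- The program for one coordinate of `responseVec`, at index `i`. -/
theorem eval_responseCoordProg (hm : m = k * n) (hs : Layout n k m T s.I)
    (hhalf : (view n k m s.R).half = 1 / 2) (i : Fin n) (hi : s.I 31 = i) :
    (responseCoordProg.eval M s).w = s.w ∧ ∃ a b, view n k m (responseCoordProg.eval M s).R =
      { view n k m s.R with
        t := a
        s := b
        D := WithLp.toLp 2 (Function.update (view n k m s.R).D i
          (bisect (fun t => M ((view n k m s.R).P + (view n k m s.R).h • EuclideanSpace.single i 1 +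
            t • (view n k m s.R).G)) T (-(view n k m s.R).K) (view n k m s.R).K)) } := by
  set v := view n k m s.R with hv
  -- shift the base point
  set s1 := (add 33 33 11).eval M ((natAdd 33 21 31).eval M s) with hs1
  have hl1 : Layout n k m T s1.I := hs.congr fun r hr => Function.update_of_ne (by omega) _ _
  have hR1 : s1.R = Function.update s.R (m + 7 + n + i) (s.R (m + 7 + n + i) + s.R (m + 1)) := by
    simp [hs1, eval, hs.r21, hs.r11, hi]
  have hv1 : view n k m s1.R = { v with P := v.P + v.h • EuclideanSpace.single i 1 } := by
    rw [view_set_P hm (R := s.R) (v := fun j => s1.R (m + 7 + n + j)) (fun _ _ => rfl)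
      fun x _ hx => by rw [hR1]; exact Function.update_of_ne (by omega) _ _]
    suffices h : WithLp.toLp 2 (fun j : Fin n => s1.R (m + 7 + n + j)) =
      v.P + v.h • EuclideanSpace.single i 1 by rw [h]
    ext j
    simp only [hR1, Function.update_apply]
    by_cases hj : j = i
    · subst hj
      simp [hv, view, vecAt]
    · have : (j : ℕ) ≠ i := fun h => hj (Fin.ext h)
      simp [hv, view, vecAt, this, hj]
  obtain ⟨f1, a, f2⟩ := eval_windowProg (M := M) hm hl1 (by rw [hv1]; exact hhalf)
  set s2 := windowProg.eval M s1 with hs2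
  have hl2 : Layout n k m T s2.I := hl1.eval fun r hr => by
    rcases writes_windowProg r hr with h | h | h | h <;> omega
  have h31 : s2.I 31 = i := by
    rw [hs2, eval_I_of_notMem_writes M _ _ _ fun h => ?_]
    · simp [hs1, eval, hi]
    · have := writes_windowProg _ h
      omega
  rw [hv1] at f2
  -- store the result
  set s3 := (add 33 33 13).eval M ((const 33 0).eval M ((natAdd 33 23 31).eval M s2)) with hs3
  have hl3 : Layout n k m T s3.I := hl2.congr fun r hr => Function.update_of_ne (by omega) _ _
  have h31' : s3.I 31 = i := by simp [hs3, eval, h31]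
  have hR3 : s3.R = Function.update s2.R (m + 7 + 3 * n + i) (s2.R (m + 3)) := by
    have hne : m + 3 ≠ m + 7 + 3 * n + i := by omega
    simp [hs3, eval, hl2.r23, hl2.r13, h31, Function.update_of_ne hne]
  have hv3 : view n k m s3.R = { view n k m s2.R with D := WithLp.toLp 2 (Function.update
      (view n k m s2.R).D i (view n k m s2.R).t) } := by
    rw [view_set_D hm (R := s2.R) (v := fun j => s3.R (m + 7 + 3 * n + j)) (fun _ _ => rfl)
      fun x _ hx => by rw [hR3]; exact Function.update_of_ne (by omega) _ _]
    suffices h : (fun j : Fin n => s3.R (m + 7 + 3 * n + j)) =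
      Function.update (view n k m s2.R).D i (view n k m s2.R).t by rw [h]
    ext j
    simp only [hR3, Function.update_apply]
    by_cases hj : j = i
    · subst hj
      simp [view]
    · have : (j : ℕ) ≠ i := fun h => hj (Fin.ext h)
      simp [view, vecAt, this, hj]
  -- undo the shift
  set s4 := (sub 33 33 11).eval M ((natAdd 33 21 31).eval M s3) with hs4
  have hR4 : s4.R = Function.update s3.R (m + 7 + n + i) (s3.R (m + 7 + n + i) - s3.R (m + 1)) := by
    simp [hs4, eval, hl3.r21, hl3.r11, h31']
  have hP3 : (view n k m s3.R).P = v.P + v.h • EuclideanSpace.single i 1 := by rw [hv3, f2]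
  have hh3 : (view n k m s3.R).h = v.h := by rw [hv3, f2]
  have hv4 : view n k m s4.R = { view n k m s3.R with P := v.P } := by
    rw [view_set_P hm (R := s3.R) (v := fun j => s4.R (m + 7 + n + j)) (fun _ _ => rfl)
      fun x _ hx => by rw [hR4]; exact Function.update_of_ne (by omega) _ _]
    suffices h : WithLp.toLp 2 (fun j : Fin n => s4.R (m + 7 + n + j)) = v.P by rw [h]
    ext j
    have hPj : s3.R (m + 7 + n + j) =
        (v.P + v.h • EuclideanSpace.single i 1 : EuclideanSpace ℝ (Fin n)) j := by
      rw [← hP3]; rfl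
    have hh : s3.R (m + 1) = v.h := hh3
    simp only [hR4, Function.update_apply]
    by_cases hj : j = i
    · subst hj
      simp [hPj, hh]
    · have : (j : ℕ) ≠ i := fun h => hj (Fin.ext h)
      simp [this, hPj, hj]
  have e : responseCoordProg.eval M s = s4 := rfl
  rw [e]
  refine ⟨f1, bisect (fun t => M (v.P + v.h • EuclideanSpace.single i 1 + t • v.G)) T (-v.K) v.K, a, ?_⟩
  rw [hv4, hv3, f2]

theorem eval_responseVecProg (hm : m = k * n) (hs : Layout n k m T s.I)
    (hhalf : (view n k m s.R).half = 1 / 2) :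
    (responseVecProg.eval M s).w = s.w ∧ ∃ a b, view n k m (responseVecProg.eval M s).R =
      { view n k m s.R with
        t := a
        s := b
        D := WithLp.toLp 2 fun i : Fin n =>
          bisect (fun t => M ((view n k m s.R).P + (view n k m s.R).h • EuclideanSpace.single i 1 +
            t • (view n k m s.R).G)) T (-(view n k m s.R).K) (view n k m s.R).K } := by
  set v := view n k m s.R with hv
  set f : Fin n → ℝ := fun i => bisect (fun t => M (v.P + v.h • EuclideanSpace.single i 1 + t • v.G)) T
    (-v.K) v.K with hf
  have hwr : ∀ r ∈ responseCoordProg.writes, r = 30 ∨ r = 33 ∨ r = 34 ∨ r = 35 := by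
    simp [responseCoordProg, windowProg, bisectProg, bisectStepProg, pointProg, forEach, skip, writes]
  obtain ⟨h1, a, b, D, h2, h3⟩ := forEach_induction (M := M) (s := s) (idx := 31)
    (body := responseCoordProg) (by omega)
    (fun r hr => by rcases hwr r hr with h | h | h | h <;> omega)
    (fun hr => by rcases hwr _ hr with h | h | h | h <;> omega) hs
    (fun j R w => w = s.w ∧ ∃ a b D, view n k m R = { v with t := a, s := b, D := D } ∧
      ∀ i : Fin n, (i : ℕ) < j → D i = f i)
    ⟨rfl, v.t, v.s, v.D, rfl, by simp⟩ (by
      rintro i hi t ht hti htr ⟨h1, a, b, D, h2, h3⟩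
      obtain ⟨g1, a', b', g2⟩ := eval_responseCoordProg (M := M) hm ht (by rw [h2]; exact hhalf) ⟨i, hi⟩
        hti
      rw [h2] at g2
      refine ⟨g1.trans h1, a', b', _, g2, fun j hj => ?_⟩
      by_cases hji : j = ⟨i, hi⟩
      · subst hji
        simp [hf]
      · have : (j : ℕ) ≠ i := fun h => hji (Fin.ext h)
        simp [Function.update_of_ne hji, h3 j (by omega)])
  refine ⟨h1, a, b, ?_⟩
  have hD : D = WithLp.toLp 2 f := by
    ext i
    exact h3 i i.2
  rw [← hD]
  exact h2

end
/-! ### Correctness of a round -/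

section
variable {n : ℕ} {M : EuclideanSpace ℝ (Fin n) → ℝ} {k m T : ℕ} {s : Memory}

theorem eval_residualProg (hm : m = k * n) (hs : Layout n k m T s.I)
    (hhalf : (view n k m s.R).half = 1 / 2) :
    (residualProg.eval M s).w = s.w ∧ ∃ P r a, view n k m (residualProg.eval M s).R =
      { view n k m s.R with
        t := r * r
        s := a
        P := P } ∧
      r = bisect (fun t => M ((view n k m s.R).P + (view n k m s.R).h • (view n k m s.R).Y +
            t • (view n k m s.R).G)) T (-(view n k m s.R).K) (view n k m s.R).K -
          inner ℝ (view n k m s.R).D (view n k m s.R).Y := by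
  set v := view n k m s.R with hv
  set p1 := forEach 30 (seq (natAdd 33 21 30) (seq (natAdd 34 24 30) (seq (mul 16 11 34) (add 33 33 16))))
    with hp1
  obtain ⟨f1, f2, f3⟩ : (p1.eval M s).w = s.w ∧
      (∀ i < n, (p1.eval M s).R (m + 7 + n + i) =
        s.R (m + 7 + n + i) + s.R (m + 1) * s.R (m + 7 + 4 * n + i)) ∧
      ∀ x, ¬ Scratch n m x → ¬ (m + 7 + n ≤ x ∧ x < m + 7 + n + n) → (p1.eval M s).R x = s.R x := by
    refine forEach_map (M := M) le_rfl (by simp [writes]) (by simp [writes]) hs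
      (Scratch n m) (m + 7 + n)
      (fun i => s.R (m + 7 + n + i) + s.R (m + 1) * s.R (m + 7 + 4 * n + i))
      (fun i hi => by unfold Scratch; omega) ?_
    intro i hi t ht hti htr hR
    have v1 : t.R (m + 7 + n + i) = s.R (m + 7 + n + i) := hR _ (by unfold Scratch; omega) (by omega)
    have v2 : t.R (m + 7 + 4 * n + i) = s.R (m + 7 + 4 * n + i) :=
      hR _ (by unfold Scratch; omega) (by omega)
    have v3 : t.R (m + 1) = s.R (m + 1) := hR _ (by unfold Scratch; omega) (by omega)
    have hne : m + 7 + n + i ≠ m + 6 := by omega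
    have hE : ((seq (natAdd 33 21 30) (seq (natAdd 34 24 30) (seq (mul 16 11 34) (add 33 33 16)))).eval M
        t).R = Function.update (Function.update t.R (m + 6) (s.R (m + 1) * s.R (m + 7 + 4 * n + i)))
          (m + 7 + n + i) (s.R (m + 7 + n + i) + s.R (m + 1) * s.R (m + 7 + 4 * n + i)) := by
      simp [eval, hti, ht.r21, ht.r24, ht.r16, ht.r11, v1, v2, v3, Function.update_of_ne hne]
    refine ⟨rfl, by simp [hE], fun x hx hx' => ?_⟩
    rw [hE, Function.update_of_ne hx', Function.update_of_ne (fun h => hx (Or.inl h))]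
  set s1 := p1.eval M s with hs1
  have hl1 : Layout n k m T s1.I := hs.eval (by simp [hp1, forEach, writes])
  have hv1 : view n k m s1.R = { v with P := v.P + v.h • v.Y } :=
    view_set_P hm f2 fun x hx hx' => f3 x hx hx'
  obtain ⟨g1, a, g2⟩ := eval_windowProg (M := M) hm hl1 (by rw [hv1]; exact hhalf)
  set s2 := windowProg.eval M s1 with hs2
  have hl2 : Layout n k m T s2.I := hl1.eval fun r hr => by
    rcases writes_windowProg r hr with h | h | h | h <;> omega
  rw [hv1] at g2
  set p3 := forEach 30 (seq (natAdd 33 23 30) (seq (natAdd 34 24 30) (seq (mul 16 33 34) (sub 13 13 16))))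
    with hp3
  obtain ⟨k1, k2, k3⟩ : (p3.eval M s2).w = s2.w ∧
      (p3.eval M s2).R (m + 3) = s2.R (m + 3) +
        ∑ i : Fin n, -(s2.R (m + 7 + 3 * n + i) * s2.R (m + 7 + 4 * n + i)) ∧
      ∀ x, ¬ Scratch n m x → x ≠ m + 3 → (p3.eval M s2).R x = s2.R x := by
    refine forEach_sum (M := M) le_rfl (by simp [writes]) (by simp [writes]) hl2 (Scratch n m) (m + 3)
      (fun i => -(s2.R (m + 7 + 3 * n + i) * s2.R (m + 7 + 4 * n + i))) ?_
    intro i hi t ht hti htr hR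
    have v1 : t.R (m + 7 + 3 * n + i) = s2.R (m + 7 + 3 * n + i) :=
      hR _ (by unfold Scratch; omega) (by omega)
    have v2 : t.R (m + 7 + 4 * n + i) = s2.R (m + 7 + 4 * n + i) :=
      hR _ (by unfold Scratch; omega) (by omega)
    have hE : ((seq (natAdd 33 23 30) (seq (natAdd 34 24 30) (seq (mul 16 33 34) (sub 13 13 16)))).eval M
        t).R = Function.update (Function.update t.R (m + 6)
          (s2.R (m + 7 + 3 * n + i) * s2.R (m + 7 + 4 * n + i))) (m + 3)
          (t.R (m + 3) + -(s2.R (m + 7 + 3 * n + i) * s2.R (m + 7 + 4 * n + i))) := by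
      simp [eval, hti, ht.r23, ht.r24, ht.r16, ht.r13, v1, v2, sub_eq_add_neg]
    refine ⟨rfl, by simp [hE], fun x hx hx' => ?_⟩
    rw [hE, Function.update_of_ne hx', Function.update_of_ne (fun h => hx (Or.inl h))]
  set s3 := p3.eval M s2 with hs3
  have hl3 : Layout n k m T s3.I := hl2.eval (by simp [hp3, forEach, writes])
  set r : ℝ := bisect (fun t => M (v.P + v.h • v.Y + t • v.G)) T (-v.K) v.K - inner ℝ v.D v.Y with hr
  have hr3 : s3.R (m + 3) = r := by
    have h1 : s2.R (m + 3) = (view n k m s2.R).t := rfl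
    have h2 : inner ℝ v.D v.Y = ∑ i : Fin n, s2.R (m + 7 + 3 * n + i) * s2.R (m + 7 + 4 * n + i) := by
      rw [← inner_vecAt]
      change _ = inner ℝ (view n k m s2.R).D (view n k m s2.R).Y
      rw [g2]
    rw [k2, h1, g2, hr, h2, Finset.sum_neg_distrib, sub_eq_add_neg]
  have hv3 : view n k m s3.R = { view n k m s2.R with t := r } := view_set_t hm hr3 k3
  have hR4 : ((mul 13 13 13).eval M s3).R = Function.update s3.R (m + 3) (r * r) := by
    simp only [eval, hl3.r13, hr3]
  have hv4 : view n k m ((mul 13 13 13).eval M s3).R = { view n k m s3.R with t := r * r } :=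
    view_set_t hm (by simp [hR4]) (fun x _ hx => by rw [hR4]; exact Function.update_of_ne hx _ _)
  have e : residualProg.eval M s = (mul 13 13 13).eval M s3 := rfl
  rw [e]
  refine ⟨(k1.trans g1).trans f1, v.P + v.h • v.Y, r, a, ?_, rfl⟩
  rw [hv4, hv3, g2]

theorem eval_normSqProg (hm : m = k * n) (hs : Layout n k m T s.I) :
    (normSqProg.eval M s).w = s.w ∧ view n k m (normSqProg.eval M s).R =
      { view n k m s.R with
        acc := ‖(view n k m s.R).D‖ ^ 2
        s := (view n k m s.R).K * ‖(view n k m s.R).D‖ ^ 2 } := by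
  set v := view n k m s.R with hv
  set s1 : Memory := { s with R := Function.update s.R (m + 5) 0 } with hs1
  have e1 : (const 15 0).eval M s = s1 := by simp [eval, hs1, hs.r15]
  have hl1 : Layout n k m T s1.I := hs
  set p2 := forEach 30 (seq (natAdd 33 23 30) (seq (mul 16 33 33) (add 15 15 16))) with hp2
  obtain ⟨k1, k2, k3⟩ : (p2.eval M s1).w = s1.w ∧
      (p2.eval M s1).R (m + 5) = s1.R (m + 5) +
        ∑ i : Fin n, s.R (m + 7 + 3 * n + i) * s.R (m + 7 + 3 * n + i) ∧
      ∀ x, ¬ Scratch n m x → x ≠ m + 5 → (p2.eval M s1).R x = s1.R x := by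
    refine forEach_sum (M := M) le_rfl (by simp [writes]) (by simp [writes]) hl1 (Scratch n m) (m + 5)
      (fun i => s.R (m + 7 + 3 * n + i) * s.R (m + 7 + 3 * n + i)) ?_
    intro i hi t ht hti htr hR
    have v1 : t.R (m + 7 + 3 * n + i) = s.R (m + 7 + 3 * n + i) := by
      rw [hR _ (by unfold Scratch; omega) (by omega)]
      exact Function.update_of_ne (by omega) _ _
    have hE : ((seq (natAdd 33 23 30) (seq (mul 16 33 33) (add 15 15 16))).eval M t).R =
        Function.update (Function.update t.R (m + 6)
          (s.R (m + 7 + 3 * n + i) * s.R (m + 7 + 3 * n + i))) (m + 5)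
          (t.R (m + 5) + s.R (m + 7 + 3 * n + i) * s.R (m + 7 + 3 * n + i)) := by
      simp [eval, hti, ht.r23, ht.r16, ht.r15, v1]
    refine ⟨rfl, by simp [hE], fun x hx hx' => ?_⟩
    rw [hE, Function.update_of_ne hx', Function.update_of_ne (fun h => hx (Or.inl h))]
  set s2 := p2.eval M s1 with hs2
  have hl2 : Layout n k m T s2.I := hl1.eval (by simp [hp2, forEach, writes])
  have hacc : s2.R (m + 5) = ‖v.D‖ ^ 2 := by
    rw [k2, ← inner_vecAt, ← real_inner_self_eq_norm_sq]
    simp [hs1, hv, view]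
  have hv2 : view n k m s2.R = { v with acc := ‖v.D‖ ^ 2 } :=
    view_set_acc hm hacc fun x hx hx' => by rw [k3 x hx hx']; exact Function.update_of_ne hx' _ _
  have hR3 : ((mul 14 12 15).eval M s2).R = Function.update s2.R (m + 4) (v.K * ‖v.D‖ ^ 2) := by
    have : s2.R (m + 2) = (view n k m s2.R).K := rfl
    simp only [eval, hl2.r14, hl2.r12, hl2.r15, hacc, this, hv2]
  have hv3 : view n k m ((mul 14 12 15).eval M s2).R =
      { view n k m s2.R with s := v.K * ‖v.D‖ ^ 2 } :=
    view_set_s hm (by simp [hR3]) (fun x _ hx => by rw [hR3]; exact Function.update_of_ne hx _ _)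
  have e : normSqProg.eval M s = (mul 14 12 15).eval M s2 := by
    rw [hs2, ← e1]; rfl
  rw [e]
  exact ⟨k1, by rw [hv3, hv2]⟩

theorem eval_storeProg (hm : m = k * n) (hs : Layout n k m T s.I) {j : ℕ} (hj : j < k)
    (h36 : s.I 36 = j * n) (hacc : (view n k m s.R).acc = ‖(view n k m s.R).D‖ ^ 2) :
    (storeProg.eval M s).w = s.w ∧ (storeProg.eval M s).I 36 = (j + 1) * n ∧
    ∃ a, view n k m (storeProg.eval M s).R =
      { view n k m s.R with
        acc := a
        V := Function.update (view n k m s.R).V j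
          (‖(view n k m s.R).D‖⁻¹ • (view n k m s.R).D) } := by
  set v := view n k m s.R with hv
  set s1 : Memory := { s with R := Function.update s.R (m + 5) ‖v.D‖ } with hs1
  have e1 : (sqrt 15 15).eval M s = s1 := by
    have : s.R (m + 5) = ‖v.D‖ ^ 2 := hacc
    simp [eval, hs1, hs.r15, this]
  have hl1 : Layout n k m T s1.I := hs
  set p2 := forEach 30 (seq (natAdd 33 36 30) (seq (natAdd 34 23 30) (div 33 34 15))) with hp2
  have hjn : j * n + n ≤ m := by
    rw [hm, ← Nat.succ_mul]
    exact Nat.mul_le_mul_right _ hj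
  obtain ⟨k1, k2, k3⟩ : (p2.eval M s1).w = s1.w ∧
      (∀ i < n, (p2.eval M s1).R (j * n + i) = s.R (m + 7 + 3 * n + i) / ‖v.D‖) ∧
      ∀ x, ¬ False → ¬ (j * n ≤ x ∧ x < j * n + n) → (p2.eval M s1).R x = s1.R x := by
    refine forEach_map (M := M) le_rfl (by simp [writes]) (by simp [writes]) hl1 (fun _ => False) (j * n)
      (fun i => s.R (m + 7 + 3 * n + i) / ‖v.D‖) (by simp) ?_
    intro i hi t ht hti htr hR
    have ht36 : t.I 36 = j * n := (htr 36 (by omega) (by simp [writes])).trans h36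
    have v1 : t.R (m + 7 + 3 * n + i) = s.R (m + 7 + 3 * n + i) := by
      rw [hR _ not_false (by omega)]
      exact Function.update_of_ne (by omega) _ _
    have v2 : t.R (m + 5) = ‖v.D‖ := by
      rw [hR _ not_false (by omega)]
      exact Function.update_self ..
    have hE : ((seq (natAdd 33 36 30) (seq (natAdd 34 23 30) (div 33 34 15))).eval M t).R =
        Function.update t.R (j * n + i) (s.R (m + 7 + 3 * n + i) / ‖v.D‖) := by
      simp [eval, hti, ht.r23, ht.r15, ht36, v1, v2]
    refine ⟨rfl, by simp [hE], fun x _ hx' => ?_⟩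
    rw [hE, Function.update_of_ne hx']
  set s2 := p2.eval M s1 with hs2
  have hl2 : Layout n k m T s2.I := hl1.eval (by simp [hp2, forEach, writes])
  have h36' : s2.I 36 = j * n := by
    rw [hs2, eval_I_of_notMem_writes M p2 s1 36 (by simp [hp2, forEach, writes])]
    exact h36
  have e : storeProg.eval M s = (natAdd 36 36 0).eval M s2 := by
    rw [hs2, ← e1]; rfl
  rw [e]
  refine ⟨k1, by simp [eval, h36', hl2.r0, Nat.succ_mul], ‖v.D‖, ?_⟩
  have hoff : ∀ x, m ≤ x → x ≠ m + 5 → s2.R x = s.R x := fun x hx hx' => by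
    rw [k3 x not_false (by omega)]
    exact Function.update_of_ne hx' _ _
  have hVj : (view n k m s2.R).V = Function.update v.V j (‖v.D‖⁻¹ • v.D) := by
    funext l
    by_cases hl : l = j
    · subst hl
      rw [Function.update_self]
      simp only [view, if_pos hj]
      ext i
      exact (k2 i i.2).trans (by rw [div_eq_inv_mul]; rfl)
    · rw [Function.update_of_ne hl]
      simp only [hv, view]
      split_ifs with hlk
      · refine vecAt_congr fun i hi => ?_
        have hlt := hm ▸ add_lt_of_lt_mul hlk hi
        rw [k3 _ not_false ?_]
        · exact Function.update_of_ne (by omega) _ _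
        · rcases lt_or_gt_of_ne hl with h | h
          · have := add_lt_of_lt_mul h hi
            omega
          · have : (j + 1) * n ≤ l * n := Nat.mul_le_mul_right _ h
            rw [Nat.succ_mul] at this
            omega
      · rfl
  change view n k m s2.R = _
  apply view_eq_of_V hVj <;> first
    | exact hoff _ (by omega) (by omega)
    | exact vecAt_congr fun i hi => hoff _ (by omega) (by omega)
    | exact (k3 (m + 5) not_false (by omega)).trans (Function.update_self ..)

open Classical in
theorem eval_acceptProg (hn : 0 < n) (hm : m = k * n) (hs : Layout n k m T s.I) {j : ℕ}
    (h36 : s.I 36 = j * n) (hacc : (view n k m s.R).acc = ‖(view n k m s.R).D‖ ^ 2) :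
    (acceptProg.eval M s).w = s.w ∧ ∃ a V, view n k m (acceptProg.eval M s).R =
      { view n k m s.R with
        acc := a
        V := V } ∧
      ((acceptProg.eval M s).I 36 = (if j < k ∧ (view n k m s.R).t ≤ (view n k m s.R).h ∧
        (view n k m s.R).half ≤ (view n k m s.R).s then j + 1 else j) * n) ∧
      V = if j < k ∧ (view n k m s.R).t ≤ (view n k m s.R).h ∧
        (view n k m s.R).half ≤ (view n k m s.R).s then
        Function.update (view n k m s.R).V j (‖(view n k m s.R).D‖⁻¹ • (view n k m s.R).D)
        else (view n k m s.R).V := by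
  set v := view n k m s.R with hv
  have hskip : (skip.eval M s).w = s.w ∧ view n k m (skip.eval M s).R = { v with acc := v.acc, V := v.V } ∧
      (skip.eval M s).I 36 = j * n := ⟨rfl, rfl, by simp [skip, eval, h36]⟩
  have h1 : (s.I 25 ≤ s.I 36) ↔ k ≤ j := by
    rw [hs.r25, h36, hm]
    exact Nat.mul_le_mul_right_iff hn
  have h2 : s.R (s.I 13) ≤ s.R (s.I 11) ↔ v.t ≤ v.h := by rw [hs.r13, hs.r11]; rfl
  have h3 : s.R (s.I 10) ≤ s.R (s.I 14) ↔ v.half ≤ v.s := by rw [hs.r10, hs.r14]; rfl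
  have e : acceptProg.eval M s = if j < k ∧ v.t ≤ v.h ∧ v.half ≤ v.s then storeProg.eval M s
      else skip.eval M s := by
    simp only [acceptProg, eval, h1, h2, h3]
    by_cases c1 : k ≤ j
    · rw [if_pos c1, if_neg fun h => by omega]
    · by_cases c2 : v.t ≤ v.h <;> by_cases c3 : v.half ≤ v.s <;> simp [c1, c2, c3, not_le.1 c1]
  by_cases hc : j < k ∧ v.t ≤ v.h ∧ v.half ≤ v.s
  · obtain ⟨g1, g2, a, g3⟩ := eval_storeProg (M := M) hm hs hc.1 h36 hacc
    rw [e]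
    simp only [if_pos hc]
    exact ⟨g1, a, _, g3, g2, rfl⟩
  · rw [e]
    simp only [if_neg hc]
    exact ⟨hskip.1, v.acc, v.V, hskip.2.1, hskip.2.2, rfl⟩

/-- The constants used in the rounds. -/
def HasConstants (v : View n) (K h : ℝ) : Prop := v.half = 1 / 2 ∧ v.h = h ∧ v.K = K

/-- One round of the program performs `learnStep`. -/
theorem eval_roundProg (hn : 0 < n) (hm : m = k * n) (hs : Layout n k m T s.I) {j : ℕ}
    (h36 : s.I 36 = j * n) {K h : ℝ} (hc : HasConstants (view n k m s.R) K h) :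
    Layout n k m T (roundProg.eval M s).I ∧
    (roundProg.eval M s).w = shiftSource n (shiftSource n s.w) ∧
    HasConstants (view n k m (roundProg.eval M s).R) K h ∧
    (roundProg.eval M s).I 36 = (learnStep M k K h T ((view n k m s.R).V, j) (headVec n s.w)
      (headVec n (shiftSource n s.w))).2 * n ∧
    (view n k m (roundProg.eval M s).R).V = (learnStep M k K h T ((view n k m s.R).V, j)
      (headVec n s.w) (headVec n (shiftSource n s.w))).1 := by
  obtain ⟨hhalf, hh, hK⟩ := hc
  set v := view n k m s.R with hv
  -- for a part of the program that does not touch the pointer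
  have h36' : ∀ (p : RProg) (s : Memory), 36 ∉ p.writes → s.I 36 = j * n → (p.eval M s).I 36 = j * n :=
    fun p s hp h => (eval_I_of_notMem_writes M p s 36 hp).trans h
  unfold roundProg
  simp only [eval]
  obtain ⟨a1, b1⟩ := eval_sampleProg_G (M := M) hm hs
  have l1 : Layout n k m T ((sampleProg 20).eval M s).I := hs.eval (by decide)
  have p1 : ((sampleProg 20).eval M s).I 36 = j * n := h36' _ _ (by decide) h36
  generalize (sampleProg 20).eval M s = s1 at *
  obtain ⟨a2, b2⟩ := eval_sampleProg_Y (M := M) hm l1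
  have l2 : Layout n k m T ((sampleProg 24).eval M s1).I := l1.eval (by decide)
  have p2 : ((sampleProg 24).eval M s1).I 36 = j * n := h36' _ _ (by decide) p1
  rw [a1, b1] at b2
  rw [a1] at a2
  generalize (sampleProg 24).eval M s1 = s2 at *
  obtain ⟨a3, c3, b3⟩ := eval_deflateProg_G (M := M) hm l2
  have l3 : Layout n k m T ((deflateProg 20).eval M s2).I := l2.eval (by decide)
  have p3 : ((deflateProg 20).eval M s2).I 36 = j * n := h36' _ _ (by decide) p2
  rw [b2] at b3
  generalize (deflateProg 20).eval M s2 = s3 at *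
  obtain ⟨a4, P4, c4, b4⟩ := eval_crossingProg (M := M) hm l3 (by rw [b3]; exact hhalf)
  have l4 : Layout n k m T (crossingProg.eval M s3).I := l3.eval (by decide)
  have p4 : (crossingProg.eval M s3).I 36 = j * n := h36' _ _ (by decide) p3
  rw [b3] at b4
  generalize crossingProg.eval M s3 = s4 at *
  obtain ⟨a5, b5⟩ := eval_rebaseProg (M := M) hm l4
  have l5 : Layout n k m T (rebaseProg.eval M s4).I := l4.eval (by decide)
  have p5 : (rebaseProg.eval M s4).I 36 = j * n := h36' _ _ (by decide) p4
  rw [b4] at b5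
  generalize rebaseProg.eval M s4 = s5 at *
  obtain ⟨a6, c6, d6, b6⟩ := eval_responseVecProg (M := M) hm l5 (by rw [b5]; exact hhalf)
  have l6 : Layout n k m T (responseVecProg.eval M s5).I := l5.eval (by decide)
  have p6 : (responseVecProg.eval M s5).I 36 = j * n := h36' _ _ (by decide) p5
  rw [b5] at b6
  generalize responseVecProg.eval M s5 = s6 at *
  obtain ⟨a7, P7, r, c7, b7, hr⟩ := eval_residualProg (M := M) hm l6 (by rw [b6]; exact hhalf)
  have l7 : Layout n k m T (residualProg.eval M s6).I := l6.eval (by decide)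
  have p7 : (residualProg.eval M s6).I 36 = j * n := h36' _ _ (by decide) p6
  rw [b6] at b7 hr
  generalize residualProg.eval M s6 = s7 at *
  obtain ⟨a8, c8, b8⟩ := eval_deflateProg_D (M := M) hm l7
  have l8 : Layout n k m T ((deflateProg 23).eval M s7).I := l7.eval (by decide)
  have p8 : ((deflateProg 23).eval M s7).I 36 = j * n := h36' _ _ (by decide) p7
  rw [b7] at b8
  generalize (deflateProg 23).eval M s7 = s8 at *
  obtain ⟨a9, b9⟩ := eval_normSqProg (M := M) hm l8
  have l9 : Layout n k m T (normSqProg.eval M s8).I := l8.eval (by decide)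
  have p9 : (normSqProg.eval M s8).I 36 = j * n := h36' _ _ (by decide) p8
  rw [b8] at b9
  generalize normSqProg.eval M s8 = s9 at *
  obtain ⟨a10, c10, V10, b10, i10, hV10⟩ := eval_acceptProg (M := M) hn hm l9 p9 (by rw [b9])
  rw [b9] at b10 i10 hV10
  have hw : (acceptProg.eval M s9).w = shiftSource n (shiftSource n s.w) := by
    rw [a10, a9, a8, a7, a6, a5, a4, a3, a2]
  subst hh hK
  have hr' : r = nonlinearity M v.K v.h T (deflate v.V k (headVec n s.w))
    (headVec n (shiftSource n s.w)) := hr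
  have hD : deflate v.V k (WithLp.toLp 2 fun i : Fin n => bisect (fun t => M (
      crossing M T (deflate v.V k (headVec n s.w)) • deflate v.V k (headVec n s.w) +
        v.h • EuclideanSpace.single i 1 + t • v.h • deflate v.V k (headVec n s.w))) T (-v.K) v.K) =
      deflate v.V k (responseVec M v.K v.h T (deflate v.V k (headVec n s.w))
        (crossing M T (deflate v.V k (headVec n s.w)))) := rfl
  simp only [hr', ← hv, hhalf] at i10 hV10
  rw [hD] at i10 hV10
  refine ⟨l9.eval (by decide), hw, ?_, ?_, ?_⟩
  · rw [b10]
    exact ⟨hhalf, rfl, rfl⟩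
  · rw [i10, learnStep]
    simp only
    split_ifs <;> rfl
  · rw [b10]
    simp only
    rw [hV10, learnStep]
    simp only
    split_ifs <;> rfl

end

/-! ### Initialization and the whole program -/

/-- Compute the numbers of rounds and the addresses of the variables. -/
def initRegsProg : RProg :=
  seq (natConst 3 1) <| seq (loop 1 (natAdd 25 25 0)) <| seq (loop 2 (natAdd 26 26 2)) <|
  seq (natAdd 7 2 2) <| seq (natAdd 7 7 7) <| seq (natAdd 7 7 7) <| seq (natAdd 7 7 7) <|
  seq (natAdd 7 7 7) <|
  seq (natAdd 6 26 26) <| seq (natAdd 6 6 6) <| seq (natAdd 6 6 6) <| seq (natAdd 6 6 6) <|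
  seq (natAdd 4 6 6) <| seq (natAdd 4 4 4) <| seq (natAdd 4 4 4) <| seq (natAdd 4 4 4) <|
  seq (natAdd 4 4 4) <| seq (natAdd 5 4 4) <|
  seq (natAdd 10 25 27) <| seq (natAdd 11 10 3) <| seq (natAdd 12 11 3) <| seq (natAdd 13 12 3) <|
  seq (natAdd 14 13 3) <| seq (natAdd 15 14 3) <| seq (natAdd 16 15 3) <| seq (natAdd 20 16 3) <|
  seq (natAdd 21 20 0) <| seq (natAdd 22 21 0) <| seq (natAdd 23 22 0) (natAdd 24 23 0)

/-- Compute the constants `1/2`, `h` and `K`. -/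
def initConstsProg : RProg :=
  seq (const 10 1) <| seq (const 11 2) <| seq (div 10 10 11) <| seq (const 11 1) <|
  seq (loop 4 (mul 11 11 10)) <| seq (const 12 1) (loop 7 (add 12 12 12))

/-- The program that learns the span. -/
def learnProg : RProg := seq initRegsProg (seq initConstsProg (loop 6 roundProg))

variable {n : ℕ} {M : EuclideanSpace ℝ (Fin n) → ℝ}

theorem eval_seq (p q : RProg) (s : Memory) : (seq p q).eval M s = q.eval M (p.eval M s) := rfl

theorem run_seq (ω : ℕ → ℝ) (p q : RProg) (s : RState) :
    (seq p q).run M ω s = q.run M ω (p.run M ω s) := rfl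

theorem eval_loop (a : ℕ) (p : RProg) (s : Memory) : (loop a p).eval M s = (p.eval M)^[s.I a] s := rfl

theorem eval_loop_natAdd {a r b : ℕ} (hba : b ≠ a) (s : Memory) :
    (loop r (natAdd a a b)).eval M s =
      { s with I := Function.update s.I a (s.I a + s.I r * s.I b) } := by
  have := eval_loop_induction (M := M) (p := natAdd a a b) (a := r) (s := s)
    (fun i t => t = { s with I := Function.update s.I a (s.I a + i * s.I b) }) (by simp) (by
      rintro i _ t rfl
      simp [eval, Function.update_of_ne hba, Nat.succ_mul, add_assoc])
  exact this

theorem eval_initRegsProg (k N : ℕ) (s : Memory) (h0 : s.I 0 = n) (h1 : s.I 1 = k) (h2 : s.I 2 = N)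
    (h : ∀ r, 3 ≤ r → s.I r = 0) :
    Layout n k (k * n) (1024 * N ^ 2) (initRegsProg.eval M s).I ∧
    (initRegsProg.eval M s).R = s.R ∧ (initRegsProg.eval M s).w = s.w ∧
    (initRegsProg.eval M s).I 4 = 512 * N ^ 2 ∧ (initRegsProg.eval M s).I 6 = 16 * N ^ 2 ∧
    (initRegsProg.eval M s).I 7 = 32 * N ∧ (initRegsProg.eval M s).I 36 = 0 := by
  have e : ∃ J, initRegsProg.eval M s = { s with I := J } ∧ J 0 = n ∧ J 1 = k ∧ J 3 = 1 ∧
      J 5 = 1024 * N ^ 2 ∧ J 10 = k * n ∧ J 11 = k * n + 1 ∧ J 12 = k * n + 2 ∧ J 13 = k * n + 3 ∧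
      J 14 = k * n + 4 ∧ J 15 = k * n + 5 ∧ J 16 = k * n + 6 ∧ J 20 = k * n + 7 ∧
      J 21 = k * n + 7 + n ∧ J 22 = k * n + 7 + 2 * n ∧ J 23 = k * n + 7 + 3 * n ∧
      J 24 = k * n + 7 + 4 * n ∧ J 25 = k * n ∧ J 4 = 512 * N ^ 2 ∧ J 6 = 16 * N ^ 2 ∧ J 7 = 32 * N ∧
      J 36 = 0 := by
    unfold initRegsProg
    rw [eval_seq, eval_seq, eval, eval_loop_natAdd (by norm_num), eval_seq,
      eval_loop_natAdd (by norm_num)]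
    simp only [eval]
    refine ⟨_, rfl, ?_⟩
    simp [h0, h1, h2, h]
    refine ⟨?_, ?_, ?_, ?_, ?_, ?_, ?_⟩ <;> ring
  obtain ⟨J, hJ, e0, e1, e3, e5, e10, e11, e12, e13, e14, e15, e16, e20, e21, e22, e23, e24, e25, e4, e6,
    e7, e36⟩ := e
  rw [hJ]
  exact ⟨⟨e0, e1, e3, e5, e10, e11, e12, e13, e14, e15, e16, e20, e21, e22, e23, e24, e25⟩, rfl, rfl, e4,
    e6, e7, e36⟩

theorem writes_initConstsProg : initConstsProg.writes = [] := rfl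

theorem eval_initConstsProg_I (s : Memory) : (initConstsProg.eval M s).I = s.I := by
  funext r
  rw [eval_I_of_notMem_writes M initConstsProg s r]
  rw [writes_initConstsProg]
  exact List.not_mem_nil

theorem run_initConstsProg_I (ω : ℕ → ℝ) (s : RState) : (initConstsProg.run M ω s).I = s.I := by
  funext r
  rw [run_I_of_notMem_writes M ω initConstsProg s r]
  rw [writes_initConstsProg]
  exact List.not_mem_nil

theorem eval_initConstsProg {k m T H r : ℕ} {s : Memory} (hm : m = k * n) (hs : Layout n k m T s.I)
    (hH : s.I 4 = H) (hr : s.I 7 = r) (hR : s.R = fun _ => 0) :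
    (initConstsProg.eval M s).w = s.w ∧
    HasConstants (view n k m (initConstsProg.eval M s).R) (2 ^ r) ((1 / 2) ^ H) ∧
    (view n k m (initConstsProg.eval M s).R).V = fun _ => 0 := by
  set s1 : Memory := { s with R := Function.update (Function.update s.R m (1 / 2)) (m + 1) 1 } with hs1
  have e1 : (const 11 1).eval M ((div 10 10 11).eval M ((const 11 2).eval M ((const 10 1).eval M s))) =
      s1 := by
    simp only [eval, hs.r10, hs.r11, hs1, hR]
    congr 1
    funext x
    simp only [Function.update_apply]
    split_ifs <;> norm_num
    omega
  have hl1 : Layout n k m T s1.I := hs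
  have hR1 : s1.R m = 1 / 2 := by simp [hs1]
  have f : (loop 4 (mul 11 11 10)).eval M s1 =
      { s1 with R := Function.update s1.R (m + 1) ((1 / 2) ^ H) } := by
    have := eval_loop_induction (M := M) (p := mul 11 11 10) (a := 4) (s := s1)
      (fun i t => t = { s1 with R := Function.update s1.R (m + 1) ((1 / 2) ^ i) })
      (by simp [hs1]) (by
        rintro i _ t rfl
        simp [eval, hl1.r11, hl1.r10, hR1, pow_succ])
    rwa [show s1.I 4 = H from hH] at this
  set s2 : Memory := { s1 with R := Function.update s1.R (m + 1) ((1 / 2) ^ H) } with hs2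
  set s3 : Memory := { s2 with R := Function.update s2.R (m + 2) 1 } with hs3
  have e3 : (const 12 1).eval M s2 = s3 := by
    simp [eval, hs3, hs2, hl1.r12]
  have hl3 : Layout n k m T s3.I := hs
  have g : (loop 7 (add 12 12 12)).eval M s3 =
      { s3 with R := Function.update s3.R (m + 2) (2 ^ r) } := by
    have := eval_loop_induction (M := M) (p := add 12 12 12) (a := 7) (s := s3)
      (fun i t => t = { s3 with R := Function.update s3.R (m + 2) (2 ^ i) })
      (by simp [hs3]) (by
        rintro i _ t rfl
        simp [eval, hl3.r12, pow_succ, mul_two])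
    rwa [show s3.I 7 = r from hr] at this
  have e : initConstsProg.eval M s = { s3 with R := Function.update s3.R (m + 2) (2 ^ r) } := by
    unfold initConstsProg
    rw [eval_seq, eval_seq, eval_seq, eval_seq, e1, eval_seq, f, eval_seq, e3, g]
  rw [e]
  refine ⟨rfl, ⟨?_, ?_, ?_⟩, ?_⟩
  · simp [view, hs3, hs2, hs1]
  · simp [view, hs3, hs2]
  · simp [view]
  · rw [viewV_congr hm (R := s.R)]
    · funext j
      simp only [view, hR, vecAt]
      split_ifs
      · rfl
      · rfl
    · intro x hx
      have h1 : x ≠ m := by omega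
      have h2 : x ≠ m + 1 := by omega
      have h3 : x ≠ m + 2 := by omega
      simp [hs3, hs2, hs1, h1, h2, h3]

theorem eval_loop_roundProg (hn : 0 < n) {k m T : ℕ} (hm : m = k * n) {K h : ℝ} (R : ℕ) :
    ∀ (s : Memory) (j : ℕ), Layout n k m T s.I → s.I 36 = j * n →
      HasConstants (view n k m s.R) K h →
      (view n k m (((roundProg.eval M)^[R] s).R)).V =
        (learn M k K h T R ((view n k m s.R).V, j) s.w).1 := by
  induction R with
  | zero => intro s j _ _ _; rfl
  | succ R ih =>
      intro s j hs hj hc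
      obtain ⟨h1, h2, h3, h4, h5⟩ := eval_roundProg (M := M) hn hm hs hj hc
      rw [Function.iterate_succ_apply, ih _ _ h1 h4 h3, learn, h5, h2]

/-- The output of the program, in terms of `learn`. -/
theorem output_learnProg (hn : 0 < n) (k N : ℕ) (ω : ℕ → ℝ) :
    (learnProg.run M ω (RState.init n k N)).output n k =
      Submodule.span ℝ (Set.range fun j : Fin k =>
        (learn M k (2 ^ (32 * N)) ((1 / 2) ^ (512 * N ^ 2)) (1024 * N ^ 2) (16 * N ^ 2)
          (fun _ => 0, 0) ω).1 j) := by
  have hrun := memory_run M ω learnProg (RState.init n k N)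
  generalize learnProg.run M ω (RState.init n k N) = t at *
  obtain ⟨s0, hs0⟩ : ∃ s0, (RState.init n k N).memory ω = s0 := ⟨_, rfl⟩
  have hw0 : s0.w = ω := by
    funext i
    simp [← hs0, RState.memory, RState.init]
  have hR0 : s0.R = fun _ => 0 := by rw [← hs0]; rfl
  have hI0 : ∀ r, s0.I r = if r = 0 then n else if r = 1 then k else if r = 2 then N else 0 := by
    rw [← hs0]
    exact fun _ => rfl
  obtain ⟨h1, h2, h3, h4, h6, h7, h36⟩ := eval_initRegsProg (M := M) (n := n) k N s0
    (by simp [hI0]) (by simp [hI0]) (by simp [hI0])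
    (fun r hr => by rw [hI0, if_neg (by omega), if_neg (by omega), if_neg (by omega)])
  rw [hs0, learnProg, eval_seq, eval_seq, eval_loop] at hrun
  generalize initRegsProg.eval M s0 = s1 at *
  obtain ⟨g1, g2, g3⟩ := eval_initConstsProg (M := M) rfl h1 h4 h7 (by rw [h2, hR0])
  have hI := eval_initConstsProg_I (M := M) s1
  rw [hI, h6] at hrun
  generalize initConstsProg.eval M s1 = s2 at *
  have key := eval_loop_roundProg (M := M) hn rfl (16 * N ^ 2) s2 0 (by rw [hI]; exact h1)
    (by rw [hI, h36, zero_mul]) g2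
  rw [← hrun, g3, g1, h3, hw0] at key
  rw [RState.output, ← key]
  refine congrArg (fun f => Submodule.span ℝ (Set.range f)) (funext fun j => ?_)
  simp only [view, if_pos j.2]
  rfl

/-! ### Running time -/

theorem time_learnProg_le {k N : ℕ} (hnN : n ≤ N) (hkN : k ≤ N) (hN : 1 ≤ N) (ω : ℕ → ℝ) :
    (learnProg.run M ω (RState.init n k N)).time ≤ 10 ^ 7 * N ^ 6 := by
  set s0 := RState.init n k N with hs0
  obtain ⟨h1, -, -, h4, h6, h7, -⟩ := eval_initRegsProg (M := M) (n := n) k N (s0.memory ω) rfl rfl rfl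
    (fun r hr => by
      simp only [hs0, RState.memory, RState.init]
      rw [if_neg (by omega), if_neg (by omega), if_neg (by omega)])
  rw [← memory_run] at h1 h4 h6 h7
  set s1 := initRegsProg.run M ω s0 with hs1
  have t1 : s1.time ≤ s0.time + initRegsProg.cost s0.I := time_run_le M ω _ (by decide) s0
  set s2 := initConstsProg.run M ω s1 with hs2
  have t2 : s2.time ≤ s1.time + initConstsProg.cost s1.I := time_run_le M ω _ (by decide) s1
  have hround : ∀ r ∈ (loop 6 roundProg).loopRegs, r ∉ (loop 6 roundProg).writes := by
    have h : ∀ r ∈ (loop 6 roundProg).loopRegs, r < 30 := by decide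
    have h' : ∀ r ∈ (loop 6 roundProg).writes, 30 ≤ r := by decide
    exact fun r hr hr' => absurd (h' r hr') (not_le.2 (h r hr))
  have t3 : ((loop 6 roundProg).run M ω s2).time ≤ s2.time + (loop 6 roundProg).cost s2.I :=
    time_run_le M ω _ hround s2
  have hI : s2.I = s1.I := run_initConstsProg_I ω s1
  have e : learnProg.run M ω s0 = (loop 6 roundProg).run M ω s2 := by
    rw [learnProg, run_seq, run_seq]
  have i1 : s1.I 1 = k := h1.r1
  have i0 : s1.I 0 = n := h1.r0
  have i5 : s1.I 5 = 1024 * N ^ 2 := h1.r5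
  have i4 : s1.I 4 = 512 * N ^ 2 := h4
  have i6 : s1.I 6 = 16 * N ^ 2 := h6
  have i7 : s1.I 7 = 32 * N := h7
  have c1 : initRegsProg.cost s0.I ≤ 100 + 4 * N := by
    simp only [initRegsProg, cost, hs0, RState.init]
    norm_num
    omega
  have c2 : initConstsProg.cost s1.I ≤ 100 + 1024 * N ^ 2 + 64 * N := by
    simp only [initConstsProg, cost, i4, i7]
    omega
  have c3 : (loop 6 roundProg).cost s2.I ≤ 1 + 16 * N ^ 2 * (1 + roundProg.cost s1.I) := by
    rw [hI, cost, i6]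
  have q1 : N ≤ N ^ 4 := Nat.le_self_pow (by norm_num) N
  have q2 : N ^ 2 ≤ N ^ 4 := Nat.pow_le_pow_right hN (by norm_num)
  have q3 : N ^ 3 ≤ N ^ 4 := Nat.pow_le_pow_right hN (by norm_num)
  have q0 : 1 ≤ N ^ 4 := Nat.one_le_pow _ _ hN
  have c4 : roundProg.cost s1.I ≤ 200000 * N ^ 4 := by
    have hb : bisectProg.cost s1.I ≤ 19000 * N ^ 3 := by
      have q5 : N ^ 2 ≤ N ^ 3 := Nat.pow_le_pow_right hN (by norm_num)
      have q6 : 1 ≤ N ^ 3 := Nat.one_le_pow _ _ hN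
      have q4 : N ^ 2 * n ≤ N ^ 3 := by
        rw [pow_succ N 2]
        exact Nat.mul_le_mul_left _ hnN
      simp only [bisectProg, bisectStepProg, pointProg, forEach, skip, cost, i0, i5]
      linarith
    have q5 : N ^ 3 ≤ N ^ 4 := Nat.pow_le_pow_right hN (by norm_num)
    have q6 : k * n ≤ N ^ 2 := by
      rw [sq]
      exact Nat.mul_le_mul hkN hnN
    have q7 : n * bisectProg.cost s1.I ≤ 19000 * N ^ 4 :=
      (Nat.mul_le_mul hnN hb).trans (le_of_eq (by ring))
    simp only [roundProg, sampleProg, deflateProg, deflateOnceProg, crossingProg, rebaseProg,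
      responseVecProg, responseCoordProg, residualProg, normSqProg, acceptProg, storeProg, windowProg,
      forEach, skip, cost, i0, i1]
    generalize bisectProg.cost s1.I = B at *
    linarith
  have e0 : s0.time = 0 := rfl
  have r1 : N ≤ N ^ 6 := Nat.le_self_pow (by norm_num) N
  have r2 : N ^ 2 ≤ N ^ 6 := Nat.pow_le_pow_right hN (by norm_num)
  have r0 : 1 ≤ N ^ 6 := Nat.one_le_pow _ _ hN
  have r6 : N ^ 2 * N ^ 4 = N ^ 6 := by ring
  have r7 : 16 * N ^ 2 * (1 + roundProg.cost s1.I) ≤ 16 * N ^ 2 * (1 + 200000 * N ^ 4) :=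
    Nat.mul_le_mul_left _ (Nat.add_le_add_left c4 _)
  rw [e]
  linarith

end RProg

/-! ### Smoothness of the network -/

/-- Second order Taylor estimate for a function with bounded second derivative. -/
theorem abs_sub_sub_deriv_mul_le {f : ℝ → ℝ} {L : ℝ} (h1 : Differentiable ℝ f)
    (h2 : Differentiable ℝ (deriv f)) (hL : ∀ t, |deriv (deriv f) t| ≤ L) (s v : ℝ) :
    |f (s + v) - f s - deriv f s * v| ≤ L * v ^ 2 := by
  have hL0 : 0 ≤ L := (abs_nonneg _).trans (hL 0)
  have hlip : ∀ x y : ℝ, |deriv f x - deriv f y| ≤ L * |x - y| := fun x y =>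
    Convex.norm_image_sub_le_of_norm_deriv_le (𝕜 := ℝ) (fun z _ => h2 z) (fun z _ => hL z) convex_univ
      (Set.mem_univ y) (Set.mem_univ x)
  have hd : ∀ t : ℝ, HasDerivAt (fun t => f (s + t) - deriv f s * t) (deriv f (s + t) - deriv f s) t := by
    intro t
    have e1 : HasDerivAt (fun t => f (s + t)) (deriv f (s + t)) t :=
      HasDerivAt.comp_const_add s t (h1 (s + t)).hasDerivAt
    exact (e1.sub ((hasDerivAt_id t).const_mul (deriv f s))).congr_deriv (by simp)
  have key := Convex.norm_image_sub_le_of_norm_hasDerivWithin_le (𝕜 := ℝ) (s := Set.uIcc 0 v)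
    (C := L * |v|) (x := 0) (y := v) (fun t _ => (hd t).hasDerivWithinAt) (fun t ht => ?_)
    (convex_uIcc 0 v) Set.left_mem_uIcc Set.right_mem_uIcc
  · simp only [Real.norm_eq_abs, add_zero, mul_zero, sub_zero] at key
    rw [mul_assoc, ← sq, sq_abs] at key
    convert key using 2
    ring
  · refine (hlip _ _).trans (mul_le_mul_of_nonneg_left ?_ hL0)
    rw [add_sub_cancel_left]
    simpa using Set.abs_sub_left_of_mem_uIcc ht

/-- `f` is approximated near every point by a linear form of norm at most `Λ`, up to a quadratic error
with constant `B`. -/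
def TaylorBound {E : Type*} [NormedAddCommGroup E] [NormedSpace ℝ E] (f : E → ℝ) (Λ B : ℝ) : Prop :=
  ∀ x, ∃ ℓ : E →ₗ[ℝ] ℝ, (∀ v, |ℓ v| ≤ Λ * ‖v‖) ∧ ∀ v, |f (x + v) - f x - ℓ v| ≤ B * ‖v‖ ^ 2

theorem TaylorBound.mono {E : Type*} [NormedAddCommGroup E] [NormedSpace ℝ E] {f : E → ℝ}
    {Λ B Λ' B' : ℝ} (h : TaylorBound f Λ B) (hΛ : Λ ≤ Λ') (hB : B ≤ B') : TaylorBound f Λ' B' := by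
  intro x
  obtain ⟨ℓ, h1, h2⟩ := h x
  exact ⟨ℓ, fun v => (h1 v).trans (by gcongr), fun v => (h2 v).trans (by gcongr)⟩

theorem TaylorBound.continuous {E : Type*} [NormedAddCommGroup E] [NormedSpace ℝ E] {f : E → ℝ} {Λ B : ℝ}
    (h : TaylorBound f Λ B) : Continuous f := by
  refine continuous_iff_continuousAt.2 fun x => ?_
  obtain ⟨ℓ, h1, h2⟩ := h x
  have hb : ∀ y, |f y - f x| ≤ Λ * ‖y - x‖ + B * ‖y - x‖ ^ 2 := by
    intro y
    have e1 := h1 (y - x)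
    have e2 := h2 (y - x)
    rw [add_sub_cancel] at e2
    calc |f y - f x| = |ℓ (y - x) + (f y - f x - ℓ (y - x))| := by congr 1; ring
      _ ≤ _ := (abs_add_le _ _).trans (add_le_add e1 e2)
  have hc : Filter.Tendsto (fun y => Λ * ‖y - x‖ + B * ‖y - x‖ ^ 2) (nhds x) (nhds 0) := by
    have : Continuous fun y => Λ * ‖y - x‖ + B * ‖y - x‖ ^ 2 := by fun_prop
    simpa using this.tendsto x
  exact tendsto_sub_nhds_zero_iff.1 (squeeze_zero_norm (f := fun y => f y - f x) hb hc)

theorem TaylorBound.comp_linear {E F : Type*} [NormedAddCommGroup E] [NormedSpace ℝ E]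
    [NormedAddCommGroup F] [NormedSpace ℝ F] {f : F → ℝ} {Λ B κ : ℝ} (h : TaylorBound f Λ B)
    (hΛ : 0 ≤ Λ) (hB : 0 ≤ B) (A : E →ₗ[ℝ] F) (hA : ∀ v, ‖A v‖ ≤ κ * ‖v‖) :
    TaylorBound (fun x => f (A x)) (Λ * κ) (B * κ ^ 2) := by
  intro x
  obtain ⟨ℓ, h1, h2⟩ := h (A x)
  refine ⟨ℓ ∘ₗ A, fun v => ?_, fun v => ?_⟩
  · calc |ℓ (A v)| ≤ Λ * ‖A v‖ := h1 _
      _ ≤ Λ * (κ * ‖v‖) := by gcongr; exact hA v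
      _ = Λ * κ * ‖v‖ := by ring
  · calc |f (A (x + v)) - f (A x) - ℓ (A v)| ≤ B * ‖A v‖ ^ 2 := by rw [map_add]; exact h2 _
      _ ≤ B * (κ * ‖v‖) ^ 2 := by gcongr; exact hA v
      _ = B * κ ^ 2 * ‖v‖ ^ 2 := by ring

theorem norm_toLp_le_of_abs_le {m : ℕ} {x y : Fin m → ℝ} (h : ∀ a, |x a| ≤ |y a|) :
    ‖WithLp.toLp 2 x‖ ≤ ‖WithLp.toLp 2 y‖ := by
  rw [EuclideanSpace.norm_eq, EuclideanSpace.norm_eq]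
  exact Real.sqrt_le_sqrt (Finset.sum_le_sum fun a _ => by
    simpa using pow_le_pow_left₀ (abs_nonneg _) (h a) 2)

/-- Composition with an entrywise activation whose first and second derivatives are bounded by `L`. -/
theorem TaylorBound.comp_activation {m : ℕ} {f : EuclideanSpace ℝ (Fin m) → ℝ} {Λ B L : ℝ}
    (h : TaylorBound f Λ B) (hΛ : 0 ≤ Λ) (hB : 0 ≤ B) {φ : ℝ → ℝ} (d1 : Differentiable ℝ φ)
    (d2 : Differentiable ℝ (deriv φ)) (b1 : ∀ t, |deriv φ t| ≤ L) (b2 : ∀ t, |deriv (deriv φ) t| ≤ L) :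
    TaylorBound (fun x : EuclideanSpace ℝ (Fin m) => f (WithLp.toLp 2 fun a => φ (x a))) (Λ * L) (B * L ^ 2 + Λ * L) := by
  have hL : 0 ≤ L := (abs_nonneg _).trans (b1 0)
  intro x
  obtain ⟨ℓ, h1, h2⟩ := h (WithLp.toLp 2 fun a => φ (x a))
  let D : EuclideanSpace ℝ (Fin m) →ₗ[ℝ] EuclideanSpace ℝ (Fin m) :=
    { toFun := fun v => WithLp.toLp 2 fun a => deriv φ (x a) * v a
      map_add' := fun v w => by ext a; simp [mul_add]
      map_smul' := fun c v => by ext a; simp [mul_left_comm] }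
  have hscale : ∀ v : EuclideanSpace ℝ (Fin m), L * ‖v‖ = ‖WithLp.toLp 2 fun a => L * v a‖ := by
    intro v
    have : (WithLp.toLp 2 fun a => L * v a) = L • v := by ext a; simp
    rw [this, norm_smul, Real.norm_of_nonneg hL]
  have hD : ∀ v, ‖D v‖ ≤ L * ‖v‖ := by
    intro v
    rw [hscale]
    refine norm_toLp_le_of_abs_le fun a => ?_
    rw [abs_mul, abs_mul, abs_of_nonneg hL]
    exact mul_le_mul_of_nonneg_right (b1 _) (abs_nonneg _)
  refine ⟨ℓ ∘ₗ D, fun v => ?_, fun v => ?_⟩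
  · calc |ℓ (D v)| ≤ Λ * ‖D v‖ := h1 _
      _ ≤ Λ * (L * ‖v‖) := by gcongr; exact hD v
      _ = Λ * L * ‖v‖ := by ring
  · set p : EuclideanSpace ℝ (Fin m) := WithLp.toLp 2 fun a => φ (x a) with hp
    set Δ : EuclideanSpace ℝ (Fin m) := WithLp.toLp 2 fun a => φ (x a + v a) - φ (x a) with hΔ
    have e0 : (WithLp.toLp 2 fun a => φ ((x + v) a)) = p + Δ := by
      ext a; simp [hp, hΔ]
    have hΔn : ‖Δ‖ ≤ L * ‖v‖ := by
      rw [hscale]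
      refine norm_toLp_le_of_abs_le fun a => ?_
      rw [abs_mul, abs_of_nonneg hL]
      have := Convex.norm_image_sub_le_of_norm_deriv_le (𝕜 := ℝ) (fun z _ => d1 z) (fun z _ => b1 z)
        convex_univ (Set.mem_univ (x a)) (Set.mem_univ (x a + v a))
      simpa using this
    have herr : ‖Δ - D v‖ ≤ L * ‖v‖ ^ 2 := by
      have hv : ∀ a, |v a| ≤ ‖v‖ := fun a => by simpa using PiLp.norm_apply_le v a
      have : L * ‖v‖ ^ 2 = ‖WithLp.toLp 2 fun a => (L * ‖v‖) * v a‖ := by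
        have : (WithLp.toLp 2 fun a => (L * ‖v‖) * v a) = (L * ‖v‖) • v := by ext a; simp
        rw [this, norm_smul, Real.norm_of_nonneg (by positivity)]
        ring
      rw [this]
      have e : Δ - D v = WithLp.toLp 2 fun a => φ (x a + v a) - φ (x a) - deriv φ (x a) * v a := by
        ext a; simp [hΔ, D]
      rw [e]
      refine norm_toLp_le_of_abs_le fun a => (abs_sub_sub_deriv_mul_le d1 d2 b2 _ _).trans ?_
      rw [abs_mul, abs_of_nonneg (by positivity : 0 ≤ L * ‖v‖), mul_assoc, ← sq_abs, sq]
      gcongr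
      exact hv a
    beta_reduce
    rw [e0]
    calc |f (p + Δ) - f p - ℓ (D v)| = |(f (p + Δ) - f p - ℓ Δ) + ℓ (Δ - D v)| := by
          rw [map_sub]; congr 1; ring
      _ ≤ B * ‖Δ‖ ^ 2 + Λ * ‖Δ - D v‖ := (abs_add_le _ _).trans (add_le_add (h2 _) (h1 _))
      _ ≤ B * (L * ‖v‖) ^ 2 + Λ * (L * ‖v‖ ^ 2) := by gcongr
      _ = (B * L ^ 2 + Λ * L) * ‖v‖ ^ 2 := by ring

namespace ThresholdNetwork

variable {n : ℕ} (net : ThresholdNetwork n)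

/-- The scalar function computed by the outermost `j` layers. -/
def outerScalar (j : ℕ) (y : EuclideanSpace ℝ (Fin (net.width j))) : ℝ :=
  net.outer j y ⟨0, by rw [net.width_zero]; exact Nat.one_pos⟩

variable {net} {L κ : ℕ → ℝ} {γ η : ℝ}

theorem Assumptions.L_nonneg (h : net.Assumptions L κ γ η) {i : ℕ} (hi : i < net.depth) : 0 ≤ L i :=
  (abs_nonneg _).trans (h.deriv_le i hi 0)

theorem Assumptions.taylorBound_outerScalar (h : net.Assumptions L κ γ η) :
    ∀ j ≤ net.depth, TaylorBound (net.outerScalar j) (∏ i ∈ Finset.range j, (2 + L i) * (2 + κ i))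
      ((∏ i ∈ Finset.range j, (2 + L i) * (2 + κ i)) ^ 2) ∧
      1 ≤ ∏ i ∈ Finset.range j, (2 + L i) * (2 + κ i) := by
  intro j
  induction j with
  | zero =>
      intro _
      refine ⟨fun x => ⟨EuclideanSpace.projₗ ⟨0, by rw [net.width_zero]; exact Nat.one_pos⟩, fun v => ?_, fun v => ?_⟩, by simp⟩
      · simpa using PiLp.norm_apply_le v _
      · simp [outerScalar, outer]
  | succ j ih =>
      intro hj
      obtain ⟨ih, hC⟩ := ih (by omega)
      set C := ∏ i ∈ Finset.range j, (2 + L i) * (2 + κ i) with hCdef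
      have hL := h.L_nonneg (i := j) (by omega)
      have hκ := h.kappa_nonneg j (by omega)
      have hC0 : 0 ≤ C := by linarith
      have h1 := ih.comp_linear hC0 (sq_nonneg C) (Matrix.toEuclideanLin (net.W j))
        (h.norm_W_le j (by omega))
      have h2 := h1.comp_activation (by positivity) (by positivity) (h.diff j (by omega))
        (h.diff_deriv j (by omega)) (h.deriv_le j (by omega)) (h.deriv2_le j (by omega))
      have e : (fun x : EuclideanSpace ℝ (Fin (net.width (j + 1))) => net.outerScalar j
          (Matrix.toEuclideanLin (net.W j) (WithLp.toLp 2 fun a => net.φ j (x a)))) =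
          net.outerScalar (j + 1) := rfl
      rw [e] at h2
      have hle : C * κ j * L j ≤ C * ((2 + L j) * (2 + κ j)) := by
        rw [mul_assoc]
        exact mul_le_mul_of_nonneg_left (by nlinarith) hC0
      rw [Finset.prod_range_succ, ← hCdef]
      refine ⟨h2.mono hle ?_, ?_⟩
      · have hx : κ j * L j * (κ j * L j + 1) ≤ ((2 + L j) * (2 + κ j)) ^ 2 := by
          have : κ j * L j + 1 ≤ (2 + L j) * (2 + κ j) := by nlinarith
          rw [sq]
          refine mul_le_mul (by nlinarith) this (by positivity) (by positivity)
        calc C ^ 2 * κ j ^ 2 * L j ^ 2 + C * κ j * L j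
            ≤ C ^ 2 * κ j ^ 2 * L j ^ 2 + C ^ 2 * (κ j * L j) := by
              have : C ≤ C ^ 2 := by nlinarith
              have : C * (κ j * L j) ≤ C ^ 2 * (κ j * L j) := by gcongr
              nlinarith
          _ = C ^ 2 * (κ j * L j * (κ j * L j + 1)) := by ring
          _ ≤ C ^ 2 * ((2 + L j) * (2 + κ j)) ^ 2 := by gcongr
          _ = _ := by ring
      · have : 1 ≤ (2 + L j) * (2 + κ j) := by nlinarith
        nlinarith

/-- The bound for the gradient of the network; its square bounds the second derivative. -/
noncomputable def gradBound (d : ℕ) (L κ : ℕ → ℝ) : ℝ :=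
  (∏ i ∈ Finset.range d, (2 + L i) * (2 + κ i)) * (2 + κ d)

theorem Assumptions.taylorBound_sigma (h : net.Assumptions L κ γ η) :
    TaylorBound net.sigma (gradBound net.depth L κ) (gradBound net.depth L κ ^ 2) := by
  obtain ⟨h1, hC⟩ := h.taylorBound_outerScalar net.depth le_rfl
  have hκ := h.kappa_nonneg net.depth le_rfl
  set C := ∏ i ∈ Finset.range net.depth, (2 + L i) * (2 + κ i) with hCdef
  have h2 := h1.comp_linear (by linarith) (sq_nonneg C) (Matrix.toEuclideanLin net.A) h.norm_A_le
  have h3 : TaylorBound net.sigma (C * κ net.depth) (C ^ 2 * κ net.depth ^ 2) := h2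
  unfold gradBound
  refine h3.mono ?_ ?_
  · gcongr
    linarith
  · rw [mul_pow]
    gcongr
    linarith

theorem Assumptions.gradBound_eq_exp (h : net.Assumptions L κ γ η) :
    gradBound net.depth L κ = Real.exp (∑ i ∈ Finset.range net.depth, Real.log (2 + L i) +
      ∑ i ∈ Finset.range (net.depth + 1), Real.log (2 + κ i)) := by
  have e1 : ∀ i ∈ Finset.range net.depth, Real.exp (Real.log (2 + L i)) = 2 + L i := fun i hi =>
    Real.exp_log (by have := h.L_nonneg (Finset.mem_range.1 hi); linarith)
  have e2 : ∀ i ∈ Finset.range (net.depth + 1), Real.exp (Real.log (2 + κ i)) = 2 + κ i := fun i hi =>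
    Real.exp_log (by have := h.kappa_nonneg i (by have := Finset.mem_range.1 hi; omega); linarith)
  rw [Real.exp_add, Real.exp_sum, Real.exp_sum, Finset.prod_congr rfl e1, Finset.prod_congr rfl e2,
    gradBound, Finset.prod_range_succ, Finset.prod_mul_distrib, mul_assoc]

theorem Assumptions.sigma_zero (h : net.Assumptions L κ γ η) : net.sigma 0 = 0 := by
  have key : ∀ j ≤ net.depth, net.outerScalar j 0 = 0 := by
    intro j
    induction j with
    | zero => intro _; simp [outerScalar, outer]
    | succ j ih =>
        intro hj
        have e : net.outerScalar (j + 1) 0 = net.outerScalar j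
          (Matrix.toEuclideanLin (net.W j) (WithLp.toLp 2 fun _ => net.φ j 0)) := rfl
        have e0 : (WithLp.toLp 2 fun _ : Fin (net.width (j + 1)) => (0 : ℝ)) = 0 := rfl
        rw [e, h.map_zero j (by omega), e0, _root_.map_zero, ih (by omega)]
  have e : net.sigma 0 = net.outerScalar net.depth (Matrix.toEuclideanLin net.A 0) := rfl
  rw [e, _root_.map_zero, key _ le_rfl]

variable (net) in
/-- The network does not see the orthogonal complement of the row span. -/
theorem M_add_of_mem_orthogonal {x z : EuclideanSpace ℝ (Fin n)} (hz : z ∈ net.rowSpanᗮ) :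
    net.M (x + z) = net.M x := by
  have h0 : ∀ a, inner ℝ (WithLp.toLp 2 (net.A a)) z = 0 := fun a =>
    (Submodule.mem_orthogonal _ _).1 hz _ (Submodule.subset_span ⟨a, rfl⟩)
  have h1 : (net.A.mulVec fun i => (x + z) i) = net.A.mulVec fun i => x i := by
    funext a
    have := h0 a
    simp only [PiLp.inner_apply, RCLike.inner_apply, conj_trivial] at this
    simp only [Matrix.mulVec, dotProduct, PiLp.add_apply, mul_add, Finset.sum_add_distrib]
    rw [add_eq_left, ← this]
    exact Finset.sum_congr rfl fun i _ => mul_comm _ _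
  simp only [M, sigma, h1]

theorem Assumptions.measurable_M (h : net.Assumptions L κ γ η) : Measurable net.M := by
  have h1 : Measurable net.sigma := h.taylorBound_sigma.continuous.measurable
  exact Measurable.ite (measurableSet_le measurable_const h1) measurable_const measurable_const

end ThresholdNetwork

/-! ### Bisection -/

/-- Bisection keeps the invariant that `f ≤ 1/2` at the left end, unless this end has never moved, and
`1/2 < f` at the right end, unless that end has never moved. No monotonicity of `f` is needed. -/
theorem bisect_spec (f : ℝ → ℝ) (T : ℕ) : ∀ (t s : ℝ), 0 ≤ s →
    t ≤ bisect f T t s ∧ bisect f T t s + 2 * s * (1 / 2) ^ T ≤ t + 2 * s ∧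
    (bisect f T t s = t ∨ f (bisect f T t s) ≤ 1 / 2) ∧
    (bisect f T t s + 2 * s * (1 / 2) ^ T = t + 2 * s ∨
      1 / 2 < f (bisect f T t s + 2 * s * (1 / 2) ^ T)) := by
  induction T with
  | zero => intro t s _; simp [bisect]
  | succ T ih =>
      intro t s hs
      have e : bisect f (T + 1) t s = bisect f T (if f (t + s) ≤ 1 / 2 then t + s else t) (s * (1 / 2)) := by
        simp only [bisect, Function.iterate_succ_apply]
        rfl
      have e2 : 2 * s * (1 / 2 : ℝ) ^ (T + 1) = 2 * (s * (1 / 2)) * (1 / 2) ^ T := by ring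
      obtain ⟨h1, h2, h3, h4⟩ := ih (if f (t + s) ≤ 1 / 2 then t + s else t) (s * (1 / 2)) (by linarith)
      rw [e, e2]
      split_ifs at h1 h2 h3 h4 ⊢ with hf
      · refine ⟨by linarith, by linarith, Or.inr ?_, h4.imp_left fun h => by linarith⟩
        rcases h3 with h | h
        · rw [h]; exact hf
        · exact h
      · refine ⟨h1, by linarith, h3, Or.inr ?_⟩
        rcases h4 with h | h
        · rw [h]
          rw [not_le] at hf
          rwa [show t + 2 * (s * (1 / 2)) = t + s by ring]
        · exact h

/-- If `f` changes from `0` to `1` within `E` of `x`, then bisection finds `x` approximately. -/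
theorem abs_bisect_sub_le {f : ℝ → ℝ} {T : ℕ} {K E x : ℝ} (hK : 0 ≤ K) (hE : 0 ≤ E) (hx : |x| ≤ K)
    (h1 : ∀ t, |t| ≤ K → x + E < t → 1 / 2 < f t) (h0 : ∀ t, |t| ≤ K → t < x - E → f t ≤ 1 / 2) :
    |bisect f T (-K) K - x| ≤ E + 2 * K * (1 / 2) ^ T := by
  obtain ⟨g1, g2, g3, g4⟩ := bisect_spec f T (-K) K hK
  set r := bisect f T (-K) K
  have hp : 0 ≤ 2 * K * (1 / 2 : ℝ) ^ T := by positivity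
  set w := 2 * K * (1 / 2 : ℝ) ^ T
  rw [abs_le] at hx
  have a1 : r ≤ x + E := by
    rcases g3 with h | h
    · linarith
    · by_contra hc
      have := h1 r (abs_le.2 ⟨by linarith, by linarith⟩) (by linarith)
      linarith
  have a2 : x - E ≤ r + w := by
    rcases g4 with h | h
    · linarith
    · by_contra hc
      have := h0 (r + w) (abs_le.2 ⟨by linarith, by linarith⟩) (by linarith)
      linarith
  exact abs_le.2 ⟨by linarith, by linarith⟩

theorem abs_bisect_le {f : ℝ → ℝ} {T : ℕ} {K : ℝ} (hK : 0 ≤ K) : |bisect f T (-K) K| ≤ K := by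
  obtain ⟨g1, g2, -, -⟩ := bisect_spec f T (-K) K hK
  have hp : 0 ≤ 2 * K * (1 / 2 : ℝ) ^ T := by positivity
  exact abs_le.2 ⟨g1, by linarith⟩

/-! ### Deflation -/

section
variable {n : ℕ}

/-- The first `j` vectors are orthonormal and the others vanish. Thus deflation along more than `j` vectors
is the same as deflation along the first `j` of them. -/
structure OrthonormalUpTo (V : ℕ → EuclideanSpace ℝ (Fin n)) (j : ℕ) : Prop where
  norm_eq_one : ∀ i < j, ‖V i‖ = 1
  eq_zero : ∀ i, j ≤ i → V i = 0
  inner_eq_zero : ∀ i l, i ≠ l → inner ℝ (V i) (V l) = 0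

/-- The span of the first `j` vectors. -/
def spanUpTo (V : ℕ → EuclideanSpace ℝ (Fin n)) (j : ℕ) : Submodule ℝ (EuclideanSpace ℝ (Fin n)) :=
  Submodule.span ℝ (Set.range fun i : Fin j => V i)

variable {V : ℕ → EuclideanSpace ℝ (Fin n)} {j : ℕ}

theorem finrank_spanUpTo_le (V : ℕ → EuclideanSpace ℝ (Fin n)) (j : ℕ) :
    Module.finrank ℝ (spanUpTo V j) ≤ j := by
  exact (finrank_range_le_card (R := ℝ) (fun i : Fin j => V i)).trans (by simp)

theorem OrthonormalUpTo.mem_spanUpTo (h : OrthonormalUpTo V j) (i : ℕ) : V i ∈ spanUpTo V j := by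
  by_cases hi : i < j
  · exact Submodule.subset_span ⟨⟨i, hi⟩, rfl⟩
  · rw [h.eq_zero i (by omega)]
    exact zero_mem _

theorem OrthonormalUpTo.sub_deflate_mem (h : OrthonormalUpTo V j) (m : ℕ) (x : EuclideanSpace ℝ (Fin n)) :
    x - deflate V m x ∈ spanUpTo V j := by
  induction m with
  | zero => simp [deflate]
  | succ m ih =>
      rw [deflate, sub_sub_eq_add_sub, add_sub_right_comm]
      exact add_mem ih (Submodule.smul_mem _ _ (h.mem_spanUpTo m))

theorem OrthonormalUpTo.inner_deflate (h : OrthonormalUpTo V j) (m : ℕ) (x : EuclideanSpace ℝ (Fin n)) :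
    ∀ i < m, inner ℝ (V i) (deflate V m x) = 0 := by
  induction m with
  | zero => intro i hi; omega
  | succ m ih =>
      intro i hi
      rw [deflate, inner_sub_right, real_inner_smul_right]
      rcases Nat.lt_succ_iff_lt_or_eq.1 hi with hi | rfl
      · rw [ih i hi, h.inner_eq_zero i m (by omega), mul_zero, sub_zero]
      · by_cases hij : i < j
        · rw [real_inner_self_eq_norm_sq, h.norm_eq_one i hij]
          ring
        · rw [h.eq_zero i (by omega)]
          simp

theorem OrthonormalUpTo.deflate_mem_orthogonal (h : OrthonormalUpTo V j) {k : ℕ} (hjk : j ≤ k)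
    (x : EuclideanSpace ℝ (Fin n)) : deflate V k x ∈ (spanUpTo V j)ᗮ := by
  rw [Submodule.mem_orthogonal]
  intro u hu
  induction hu using Submodule.span_induction with
  | mem u hu =>
      obtain ⟨i, rfl⟩ := hu
      exact h.inner_deflate k x i (by omega)
  | zero => simp
  | add u v _ _ hu hv => rw [inner_add_left, hu, hv, add_zero]
  | smul c u _ hu => rw [real_inner_smul_left, hu, mul_zero]

/-- Deflation is the orthogonal projection onto the complement of the span. -/
theorem OrthonormalUpTo.deflate_eq (h : OrthonormalUpTo V j) {k : ℕ} (hjk : j ≤ k)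
    (x : EuclideanSpace ℝ (Fin n)) : deflate V k x = x - (spanUpTo V j).starProjection x := by
  have : (spanUpTo V j).starProjection x = x - deflate V k x :=
    Submodule.eq_starProjection_of_mem_of_inner_eq_zero (h.sub_deflate_mem k x) fun w hw => by
      rw [sub_sub_cancel, real_inner_comm]
      exact (Submodule.mem_orthogonal _ _).1 (h.deflate_mem_orthogonal hjk x) w hw
  rw [this, sub_sub_cancel]

theorem OrthonormalUpTo.inner_deflate_eq (h : OrthonormalUpTo V j) {k : ℕ} (hjk : j ≤ k)
    (x y : EuclideanSpace ℝ (Fin n)) :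
    inner ℝ (deflate V k x) (deflate V k y) = inner ℝ x (deflate V k y) := by
  have := (Submodule.mem_orthogonal _ _).1 (h.deflate_mem_orthogonal hjk y) _ (h.sub_deflate_mem k x)
  rw [inner_sub_left] at this
  linarith

theorem OrthonormalUpTo.norm_le_one (h : OrthonormalUpTo V j) (i : ℕ) : ‖V i‖ ≤ 1 := by
  by_cases hi : i < j
  · exact (h.norm_eq_one i hi).le
  · rw [h.eq_zero i (by omega)]
    simp

theorem OrthonormalUpTo.norm_deflate_le (h : OrthonormalUpTo V j) (m : ℕ)
    (x : EuclideanSpace ℝ (Fin n)) : ‖deflate V m x‖ ≤ ‖x‖ := by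
  induction m with
  | zero => exact le_rfl
  | succ m ih =>
      refine le_trans ?_ ih
      rw [deflate]
      set y := deflate V m x
      refine abs_le_of_sq_le_sq' ?_ (norm_nonneg y) |>.2
      rw [norm_sub_sq_real, real_inner_smul_right, real_inner_comm y, norm_smul, mul_pow, Real.norm_eq_abs,
        sq_abs]
      have h1 : ‖V m‖ ^ 2 ≤ 1 := pow_le_one₀ (norm_nonneg _) (h.norm_le_one m)
      nlinarith [sq_nonneg (inner ℝ (V m) y : ℝ)]

/-! ### Good rounds are accepted -/

/-- The scales of the algorithm: `q` dominates all parameters of the problem, and `h` is far smaller than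
any fixed power of `1 / q` that matters. -/
structure Scales (q h : ℝ) (T : ℕ) : Prop where
  two_le : 2 ≤ q
  h_pos : 0 < h
  half_pow : (1 / 2 : ℝ) ^ T = h ^ 2
  small : q ^ 38 * h ≤ 1

variable {q h : ℝ} {T : ℕ}

theorem Scales.pow_mul_le (hq : Scales q h T) {a : ℕ} (ha : a ≤ 38) : q ^ a * h ≤ 1 := by
  refine le_trans ?_ hq.small
  have := hq.h_pos
  gcongr
  exact (by linarith [hq.two_le] : (1 : ℝ) ≤ q)

theorem one_half_lt_threshold_iff {t : ℝ} : 1 / 2 < threshold t ↔ 1 ≤ t := by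
  unfold threshold
  split_ifs with h
  · simp [h]; norm_num
  · simp [h]

theorem threshold_le_half_iff {t : ℝ} : threshold t ≤ 1 / 2 ↔ t < 1 := by
  rw [← not_lt, one_half_lt_threshold_iff, not_le]

set_option maxHeartbeats 1000000 in
/-- Near a well-conditioned crossing the response is approximately linear. The linear form `ℓ` is the
derivative of `σ` at the crossing. -/
theorem exists_linear_response (hq : Scales q h T) {σ : EuclideanSpace ℝ (Fin n) → ℝ}
    (hσ : TaylorBound σ q q) (h0 : σ 0 = 0) {z : EuclideanSpace ℝ (Fin n)} (hz : ‖z‖ ≤ q) (h1 : 1 ≤ σ z)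
    {η : ℝ} (hη : 1 ≤ q * η)
    (hgrad : ∀ c : ℝ, 0 < c → σ (c • z) = 1 → ∀ ℓ : EuclideanSpace ℝ (Fin n) →ₗ[ℝ] ℝ,
      (∀ v, |σ (c • z + v) - σ (c • z) - ℓ v| ≤ q * ‖v‖ ^ 2) → η ≤ |ℓ z|) :
    ∃ ℓ : EuclideanSpace ℝ (Fin n) →ₗ[ℝ] ℝ, 0 < ℓ z ∧ ∀ y, ‖y‖ ≤ q →
      |response (fun x => threshold (σ x)) (q ^ 4) h T z
        (crossing (fun x => threshold (σ x)) T z) y - -(ℓ y / ℓ z)| ≤ q ^ 16 * h := by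
  have q2 := hq.two_le
  have hh := hq.h_pos
  have hh1 : h ≤ 1 := by simpa using hq.pow_mul_le (a := 0) (by norm_num)
  have hη0 : 0 < η := by
    by_contra hc
    nlinarith
  -- an exact crossing `c` lies within `h ^ 2` to the right of the computed point `c0`
  obtain ⟨b1, b2, b3, b4⟩ := bisect_spec (fun c => threshold (σ (c • z))) T 0 (1 / 2) (by norm_num)
  change 0 ≤ crossing (fun x => threshold (σ x)) T z at b1
  rw [show bisect (fun c => threshold (σ (c • z))) T 0 (1 / 2) =
    crossing (fun x => threshold (σ x)) T z from rfl] at b2 b3 b4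
  set c0 := crossing (fun x => threshold (σ x)) T z with hc0
  rw [show 2 * (1 / 2) * (1 / 2 : ℝ) ^ T = h ^ 2 by rw [hq.half_pow]; ring] at b2 b4
  have hlo : σ (c0 • z) < 1 := by
    rcases b3 with e | e
    · rw [e, zero_smul, h0]; norm_num
    · exact threshold_le_half_iff.1 e
  have hhi : 1 ≤ σ ((c0 + h ^ 2) • z) := by
    rcases b4 with e | e
    · rw [e]
      simpa using h1
    · exact one_half_lt_threshold_iff.1 e
  have hcont : Continuous fun t : ℝ => σ (t • z) := hσ.continuous.comp (by fun_prop)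
  obtain ⟨c, ⟨hc1, hc2⟩, hc3⟩ := intermediate_value_Icc (by nlinarith : c0 ≤ c0 + h ^ 2)
    hcont.continuousOn (show (1 : ℝ) ∈ Set.Icc (σ (c0 • z)) (σ ((c0 + h ^ 2) • z)) from ⟨hlo.le, hhi⟩)
  have hc3 : σ (c • z) = 1 := hc3
  have hcc : c0 < c := lt_of_le_of_ne hc1 fun e => by rw [e, hc3] at hlo; exact lt_irrefl _ hlo
  obtain ⟨ℓ, l1, l2⟩ := hσ (c • z)
  have hℓ := hgrad c (b1.trans_lt hcc) hc3 ℓ l2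
  rw [hc3] at l2
  set d := c - c0 with hd
  have hd0 : 0 < d := by linarith
  have hd1 : d ≤ h ^ 2 := by linarith
  -- `σ` increases at `c`, since `σ < 1` just to the left of it
  have ha : η ≤ ℓ z := by
    rcases le_abs.1 hℓ with e | e
    · exact e
    · exfalso
      have e1 := l2 ((-d) • z)
      have e2 : c • z + (-d) • z = c0 • z := by rw [← add_smul]; congr 1; rw [hd]; ring
      rw [e2, map_smul, smul_eq_mul, norm_smul, Real.norm_eq_abs, abs_neg, abs_of_pos hd0] at e1
      have e3 := (abs_le.1 e1).1
      have e4 : (d * ‖z‖) ^ 2 ≤ d * (h * q ^ 2) := by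
        have : ‖z‖ ^ 2 ≤ q ^ 2 := by gcongr
        have : d ≤ h := by nlinarith
        calc (d * ‖z‖) ^ 2 = d * (d * ‖z‖ ^ 2) := by ring
          _ ≤ d * (h * q ^ 2) := by gcongr
      have e5 : q * (h * q ^ 2) ≤ η := by
        have : q ^ 4 * h ≤ 1 := hq.pow_mul_le (by norm_num)
        have : q * (q * (h * q ^ 2)) ≤ q * η := by nlinarith
        exact le_of_mul_le_mul_left this (by linarith)
      have e6 : q * (d * ‖z‖) ^ 2 ≤ d * η := by
        calc q * (d * ‖z‖) ^ 2 ≤ q * (d * (h * q ^ 2)) := by gcongr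
          _ = d * (q * (h * q ^ 2)) := by ring
          _ ≤ d * η := by gcongr
      nlinarith
  have ha0 : 0 < ℓ z := by linarith
  have hqa : 1 ≤ q * ℓ z := by nlinarith
  set a := ℓ z with hadef
  refine ⟨ℓ, ha0, fun y hy => ?_⟩
  set x := -(ℓ y / a) with hx
  have hxa : ℓ y = -(a * x) := by rw [hx]; field_simp
  have hxK : |x| ≤ q ^ 4 := by
    rw [hx, abs_neg, abs_div, abs_of_pos ha0, div_le_iff₀ ha0]
    have : |ℓ y| ≤ q * q := (l1 y).trans (by gcongr)
    calc |ℓ y| ≤ q ^ 2 * 1 := by linarith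
      _ ≤ q ^ 2 * (q * (q * a)) := by
          gcongr
          nlinarith
      _ = q ^ 4 * a := by ring
  -- the value of the network at the query points
  have key : ∀ t, |t| ≤ q ^ 4 →
      |σ (c0 • z + h • y + t • h • z) - 1 - (-d * a + h * (a * (t - x)))| ≤ 9 * q ^ 12 * h ^ 2 * a := by
    intro t ht
    set v := (-d) • z + h • (y + t • z) with hv
    have e1 : c0 • z + h • y + t • h • z = c • z + v := by
      rw [hv, hd]; module
    have e2 : ℓ v = -d * a + h * (a * (t - x)) := by
      rw [hv, map_add, map_smul, map_smul, map_add, map_smul, hxa]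
      simp only [smul_eq_mul]
      ring
    have e3 : ‖v‖ ≤ 3 * q ^ 5 * h := by
      calc ‖v‖ ≤ ‖(-d) • z‖ + ‖h • (y + t • z)‖ := norm_add_le _ _
        _ ≤ h * q + h * (q + q ^ 4 * q) := by
            rw [norm_smul, norm_smul, Real.norm_eq_abs, Real.norm_eq_abs, abs_neg, abs_of_pos hd0,
              abs_of_pos hh]
            have : d ≤ h := by nlinarith
            have : ‖y + t • z‖ ≤ q + q ^ 4 * q := by
              refine (norm_add_le _ _).trans ?_
              rw [norm_smul, Real.norm_eq_abs]
              gcongr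
            gcongr
        _ ≤ 3 * q ^ 5 * h := by
            have : q ≤ q ^ 5 := le_self_pow₀ (by linarith) (by norm_num)
            nlinarith
    rw [e1, ← e2]
    calc _ ≤ q * ‖v‖ ^ 2 := l2 v
      _ ≤ q * (3 * q ^ 5 * h) ^ 2 := by gcongr
      _ = 9 * q ^ 11 * h ^ 2 * 1 := by ring
      _ ≤ 9 * q ^ 11 * h ^ 2 * (q * a) := by gcongr
      _ = _ := by ring
  have q12 : 1 ≤ q ^ 12 := one_le_pow₀ (by linarith)
  have hfin := abs_bisect_sub_le (T := T) (K := q ^ 4) (E := 10 * q ^ 12 * h) (x := x)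
    (f := fun t => threshold (σ (c0 • z + h • y + t • h • z))) (by positivity) (by positivity) hxK
    (fun t ht htx => by
      refine one_half_lt_threshold_iff.2 ?_
      have e := (abs_le.1 (key t ht)).1
      have e1 : h * (a * (10 * q ^ 12 * h)) ≤ h * (a * (t - x)) := by
        gcongr
        linarith
      have e2 : d * a ≤ h ^ 2 * a := by gcongr
      have e3 : h ^ 2 * a * 1 ≤ h ^ 2 * a * q ^ 12 := by gcongr
      linarith)
    (fun t ht htx => by
      refine threshold_le_half_iff.2 ?_
      have e := (abs_le.1 (key t ht)).2
      have e1 : h * (a * (t - x)) ≤ h * (a * -(10 * q ^ 12 * h)) := by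
        gcongr
        linarith
      have e3 : 0 < h ^ 2 * a * q ^ 12 := by positivity
      have e4 : 0 < d * a := by positivity
      linarith)
  refine hfin.trans ?_
  rw [hq.half_pow]
  have h5 : q ^ 4 ≤ q ^ 12 := pow_le_pow_right₀ (by linarith) (by norm_num)
  have h6 : (2 : ℝ) ^ 4 ≤ q ^ 4 := by gcongr
  have h7 : 2 * q ^ 4 * h ^ 2 ≤ 2 * q ^ 12 * h := by
    have : h ^ 2 ≤ h := by nlinarith
    gcongr
  have h8 : 12 * (q ^ 12 * h) ≤ q ^ 4 * (q ^ 12 * h) := by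
    gcongr
    linarith
  have h9 : q ^ 16 * h = q ^ 4 * (q ^ 12 * h) := by ring
  linarith

/-- If the responses to the coordinate vectors are given by a linear form up to `E`, then the response vector
represents this form approximately. -/
theorem abs_inner_responseVec_sub_le {M : EuclideanSpace ℝ (Fin n) → ℝ} {K c E : ℝ}
    {z : EuclideanSpace ℝ (Fin n)} {m : EuclideanSpace ℝ (Fin n) →ₗ[ℝ] ℝ}
    (hm : ∀ i, |response M K h T z c (EuclideanSpace.single i 1) - m (EuclideanSpace.single i 1)| ≤ E)
    (y : EuclideanSpace ℝ (Fin n)) :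
    |inner ℝ (responseVec M K h T z c) y - m y| ≤ n * E * ‖y‖ := by
  have e1 : m y = ∑ i, y i * m (EuclideanSpace.single i 1) := by
    conv_lhs => rw [← (EuclideanSpace.basisFun (Fin n) ℝ).sum_repr y]
    simp [map_sum]
  have e2 : inner ℝ (responseVec M K h T z c) y =
      ∑ i, y i * response M K h T z c (EuclideanSpace.single i 1) := by
    simp [responseVec, PiLp.inner_apply]
  rw [e1, e2, ← Finset.sum_sub_distrib]
  calc _ ≤ ∑ i, |y i * response M K h T z c (EuclideanSpace.single i 1) -
        y i * m (EuclideanSpace.single i 1)| := Finset.abs_sum_le_sum_abs _ _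
    _ ≤ ∑ _i : Fin n, ‖y‖ * E := Finset.sum_le_sum fun i _ => by
        rw [← mul_sub, abs_mul]
        have : |y i| ≤ ‖y‖ := by simpa using PiLp.norm_apply_le y i
        gcongr
        exact hm i
    _ = n * E * ‖y‖ := by simp; ring

/-- In a round with a well-conditioned crossing, a new vector is accepted. In the second claim, the inner product
of the response vector with `deflate V k g` is close to `-1`, so that its part orthogonal to the list is not
small. -/
theorem accept_of_good (hq : Scales q h T) (hn : (n : ℝ) ≤ q) {σ : EuclideanSpace ℝ (Fin n) → ℝ}
    (hσ : TaylorBound σ q q) (h0 : σ 0 = 0) {k : ℕ} (hV : OrthonormalUpTo V j) (hjk : j ≤ k)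
    {g y : EuclideanSpace ℝ (Fin n)} (hg : ‖g‖ ≤ q) (hy : ‖y‖ ≤ q) (h1 : 1 ≤ σ (deflate V k g))
    {η : ℝ} (hη : 1 ≤ q * η)
    (hgrad : ∀ c : ℝ, 0 < c → σ (c • deflate V k g) = 1 → ∀ ℓ : EuclideanSpace ℝ (Fin n) →ₗ[ℝ] ℝ,
      (∀ v, |σ (c • deflate V k g + v) - σ (c • deflate V k g) - ℓ v| ≤ q * ‖v‖ ^ 2) →
        η ≤ |ℓ (deflate V k g)|) :
    nonlinearity (fun x => threshold (σ x)) (q ^ 4) h T (deflate V k g) y *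
      nonlinearity (fun x => threshold (σ x)) (q ^ 4) h T (deflate V k g) y ≤ h ∧
    1 / 2 ≤ q ^ 4 * ‖deflate V k (responseVec (fun x => threshold (σ x)) (q ^ 4) h T (deflate V k g)
      (crossing (fun x => threshold (σ x)) T (deflate V k g)))‖ ^ 2 := by
  have q2 := hq.two_le
  have hh := hq.h_pos
  have hz : ‖deflate V k g‖ ≤ q := (hV.norm_deflate_le k g).trans hg
  obtain ⟨ℓ, ha, hℓ⟩ := exists_linear_response hq hσ h0 hz h1 hη hgrad
  set z := deflate V k g with hzdef
  set c := crossing (fun x => threshold (σ x)) T z with hc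
  set m : EuclideanSpace ℝ (Fin n) →ₗ[ℝ] ℝ := (-(ℓ z)⁻¹) • ℓ with hm
  have hmy : ∀ y, m y = -(ℓ y / ℓ z) := fun y => by
    simp only [hm, LinearMap.smul_apply, smul_eq_mul]
    rw [div_eq_inv_mul]
    ring
  have hb := abs_inner_responseVec_sub_le (M := fun x => threshold (σ x)) (K := q ^ 4) (h := h) (T := T)
    (z := z) (c := c) (E := q ^ 16 * h) (m := m) (fun i => by
      rw [hmy]
      refine hℓ _ ?_
      simp
      linarith)
  have hb' : ∀ y : EuclideanSpace ℝ (Fin n), ‖y‖ ≤ q →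
      |inner ℝ (responseVec (fun x => threshold (σ x)) (q ^ 4) h T z c) y - m y| ≤ q ^ 18 * h := by
    intro y hy
    refine (hb y).trans ?_
    calc n * (q ^ 16 * h) * ‖y‖ ≤ q * (q ^ 16 * h) * q := by gcongr
      _ = q ^ 18 * h := by ring
  have hsq : q ^ 2 ≤ q ^ 18 := pow_le_pow_right₀ (by linarith) (by norm_num)
  constructor
  · have e1 : |nonlinearity (fun x => threshold (σ x)) (q ^ 4) h T z y| ≤ q ^ 19 * h := by
      have e2 := hℓ y hy
      have e3 := hb' y hy
      rw [← hmy] at e2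
      have e4 : nonlinearity (fun x => threshold (σ x)) (q ^ 4) h T z y =
        (response (fun x => threshold (σ x)) (q ^ 4) h T z c y - m y) -
        (inner ℝ (responseVec (fun x => threshold (σ x)) (q ^ 4) h T z c) y - m y) := by
        rw [nonlinearity, ← hc]; ring
      rw [e4]
      refine (abs_sub _ _).trans ((add_le_add e2 e3).trans ?_)
      have : q ^ 16 ≤ q ^ 18 := pow_le_pow_right₀ (by linarith) (by norm_num)
      calc q ^ 16 * h + q ^ 18 * h ≤ q ^ 18 * h + q ^ 18 * h := by gcongr
        _ = 2 * (q ^ 18 * h) := by ring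
        _ ≤ q * (q ^ 18 * h) := by gcongr
        _ = q ^ 19 * h := by ring
    rw [← sq, ← sq_abs]
    calc _ ≤ (q ^ 19 * h) ^ 2 := by gcongr
      _ = (q ^ 38 * h) * h := by ring
      _ ≤ 1 * h := by gcongr; exact hq.small
      _ = h := one_mul h
  · -- the form `m` takes the value `-1` at `z`
    set b := responseVec (fun x => threshold (σ x)) (q ^ 4) h T z c with hbdef
    have e1 := hb' z hz
    have e2 : m z = -1 := by rw [hmy, div_self ha.ne']
    have e3 : q ^ 18 * h ≤ 1 / 2 := by
      have h1 : q ^ 19 * h ≤ 1 := hq.pow_mul_le (by norm_num)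
      have h2 : 2 * (q ^ 18 * h) ≤ q * (q ^ 18 * h) := by gcongr
      have h3 : q * (q ^ 18 * h) = q ^ 19 * h := by ring
      linarith
    have e4 : 1 / 2 ≤ |inner ℝ b z| := by
      rw [e2] at e1
      have := (abs_le.1 e1).2
      exact le_abs.2 (Or.inr (by linarith))
    have e5 : |inner ℝ b z| ≤ ‖deflate V k b‖ * q := by
      rw [hzdef, ← hV.inner_deflate_eq hjk, ← hzdef]
      exact (abs_real_inner_le_norm _ _).trans (by gcongr)
    have e6 : 1 / 4 ≤ ‖deflate V k b‖ ^ 2 * q ^ 2 := by nlinarith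
    have e7 : (2 : ℝ) ^ 2 ≤ q ^ 2 := by gcongr
    nlinarith

end

/-! ### The distance of the found vectors from the row span -/

section
variable {n : ℕ} {V : ℕ → EuclideanSpace ℝ (Fin n)} {j : ℕ}

/-- A state of the algorithm that consists of orthonormal vectors whose components in `S` are at most
`τ * W ^ j`, where `j` is their number. It is used for the orthogonal complement `S` of the row span. -/
structure GoodState (S : Submodule ℝ (EuclideanSpace ℝ (Fin n))) (τ W : ℝ)
    (s : (ℕ → EuclideanSpace ℝ (Fin n)) × ℕ) : Prop where
  orthonormal : OrthonormalUpTo s.1 s.2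
  near : ∀ i, ‖S.starProjection (s.1 i)‖ ≤ τ * W ^ s.2

/-- Deflation along vectors that are nearly orthogonal to `S` hardly changes the component in `S`. -/
theorem OrthonormalUpTo.norm_starProjection_sub_deflate_le (h : OrthonormalUpTo V j)
    {S : Submodule ℝ (EuclideanSpace ℝ (Fin n))} {d : ℝ} (hd : ∀ i, ‖S.starProjection (V i)‖ ≤ d)
    (m : ℕ) (x : EuclideanSpace ℝ (Fin n)) :
    ‖S.starProjection (x - deflate V m x)‖ ≤ m * ‖x‖ * d := by
  induction m with
  | zero => simp [deflate]
  | succ m ih =>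
      rw [deflate, sub_sub_eq_add_sub, add_sub_right_comm, map_add, map_smul]
      refine (norm_add_le _ _).trans ?_
      have e : ‖(inner ℝ (V m) (deflate V m x) : ℝ) • S.starProjection (V m)‖ ≤ ‖x‖ * d := by
        rw [norm_smul]
        have h1 : ‖(inner ℝ (V m) (deflate V m x) : ℝ)‖ ≤ ‖x‖ := by
          refine (norm_inner_le_norm _ _).trans ?_
          calc _ ≤ 1 * ‖x‖ := mul_le_mul (h.norm_le_one m) (h.norm_deflate_le m x) (norm_nonneg _) zero_le_one
            _ = ‖x‖ := one_mul _
        exact mul_le_mul h1 (hd m) (norm_nonneg _) (norm_nonneg _)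
      push_cast
      linarith

theorem OrthonormalUpTo.deflate_eq_zero (h : OrthonormalUpTo V j) {k : ℕ} (hjk : j ≤ k)
    {x : EuclideanSpace ℝ (Fin n)} (hx : x ∈ spanUpTo V j) : deflate V k x = 0 := by
  rw [h.deflate_eq hjk, Submodule.starProjection_eq_self_iff.2 hx, sub_self]

theorem OrthonormalUpTo.finrank_spanUpTo (h : OrthonormalUpTo V j) :
    Module.finrank ℝ (spanUpTo V j) = j := by
  have h1 : Orthonormal ℝ fun i : Fin j => V i :=
    ⟨fun i => h.norm_eq_one i i.2, fun i l hil => h.inner_eq_zero i l fun e => hil (Fin.ext e)⟩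
  exact (finrank_span_eq_card h1.linearIndependent).trans (by simp)

theorem OrthonormalUpTo.update (h : OrthonormalUpTo V j) {v : EuclideanSpace ℝ (Fin n)} (hv : ‖v‖ = 1)
    (hV : ∀ i < j, inner ℝ (V i) v = 0) : OrthonormalUpTo (Function.update V j v) (j + 1) where
  norm_eq_one i hi := by
    by_cases e : i = j
    · subst e; simpa using hv
    · rw [Function.update_of_ne e]; exact h.norm_eq_one i (by omega)
  eq_zero i hi := by
    rw [Function.update_of_ne (by omega)]; exact h.eq_zero i (by omega)
  inner_eq_zero i l hil := by
    have hV' : ∀ i, i ≠ j → inner ℝ (V i) v = 0 := fun i hi => by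
      rcases lt_or_ge i j with h1 | h1
      · exact hV i h1
      · rw [h.eq_zero i h1, inner_zero_left]
    by_cases e : i = j
    · subst e
      rw [Function.update_self, Function.update_of_ne (Ne.symm hil), real_inner_comm]
      exact hV' l (Ne.symm hil)
    · rw [Function.update_of_ne e]
      by_cases e' : l = j
      · subst e'
        rw [Function.update_self]
        exact hV' i e
      · rw [Function.update_of_ne e']
        exact h.inner_eq_zero i l hil

/-- A good state with small errors spans a space that is close to the row span. -/
theorem GoodState.one_sub_mul_norm_le {R : Submodule ℝ (EuclideanSpace ℝ (Fin n))} {τ W ε : ℝ}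
    {s : (ℕ → EuclideanSpace ℝ (Fin n)) × ℕ} (h : GoodState Rᗮ τ W s)
    (hε : s.2 * (τ * W ^ s.2) ≤ ε) {x : EuclideanSpace ℝ (Fin n)} (hx : x ∈ spanUpTo s.1 s.2) :
    (1 - ε) * ‖x‖ ≤ ‖R.starProjection x‖ := by
  have h1 := h.orthonormal.norm_starProjection_sub_deflate_le h.near s.2 x
  rw [h.orthonormal.deflate_eq_zero le_rfl hx, sub_zero] at h1
  have h2 : x = R.starProjection x + Rᗮ.starProjection x := by
    rw [Submodule.starProjection_add_starProjection_orthogonal]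
  have h3 : ‖x‖ ≤ ‖R.starProjection x‖ + ‖Rᗮ.starProjection x‖ := by
    conv_lhs => rw [h2]
    exact norm_add_le _ _
  have h4 : s.2 * (τ * W ^ s.2) * ‖x‖ ≤ ε * ‖x‖ := by gcongr
  linarith

theorem norm_responseVec_le (M : EuclideanSpace ℝ (Fin n) → ℝ) {K : ℝ} (hK : 0 ≤ K) (h : ℝ) (T : ℕ)
    (g : EuclideanSpace ℝ (Fin n)) (c : ℝ) : ‖responseVec M K h T g c‖ ≤ n * K := by
  refine abs_le_of_sq_le_sq' ?_ (by positivity) |>.2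
  rw [EuclideanSpace.norm_sq_eq]
  calc ∑ i, ‖responseVec M K h T g c i‖ ^ 2 ≤ ∑ _i : Fin n, K ^ 2 := by
        refine Finset.sum_le_sum fun i _ => ?_
        gcongr
        exact abs_bisect_le hK
    _ = n * K ^ 2 := by simp
    _ ≤ (n : ℝ) ^ 2 * K ^ 2 := by
        gcongr
        exact_mod_cast Nat.le_self_pow (by norm_num) n
    _ = (n * K) ^ 2 := by ring

/-- Appending an accepted vector preserves good states, provided that the response vector nearly lies in
the row span. -/
theorem GoodState.update {S : Submodule ℝ (EuclideanSpace ℝ (Fin n))} {τ q : ℝ} {k : ℕ}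
    {s : (ℕ → EuclideanSpace ℝ (Fin n)) × ℕ} (h : GoodState S τ (q ^ 12) s) (hτ : 0 ≤ τ) (hq : 2 ≤ q)
    (hn : (n : ℝ) ≤ q) (hk : (k : ℝ) ≤ q) (hjk : s.2 < k) {b : EuclideanSpace ℝ (Fin n)}
    (hb : ‖b‖ ≤ n * q ^ 4) (hbS : ‖S.starProjection b‖ ≤ τ)
    (hb' : 1 / 2 ≤ q ^ 4 * ‖deflate s.1 k b‖ ^ 2) :
    GoodState S τ (q ^ 12)
      (Function.update s.1 s.2 (‖deflate s.1 k b‖⁻¹ • deflate s.1 k b), s.2 + 1) := by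
  set b' := deflate s.1 k b with hb'def
  have hpos : 0 < ‖b'‖ := by
    rcases (norm_nonneg b').lt_or_eq with e | e
    · exact e
    · rw [← e] at hb'; norm_num at hb'
  have q1 : 1 ≤ q := by linarith
  have hW1 : 1 ≤ (q ^ 12) ^ s.2 := one_le_pow₀ (one_le_pow₀ q1)
  have hinv : ‖b'‖⁻¹ ≤ 2 * q ^ 4 := by
    rw [inv_le_comm₀ hpos (by positivity)]
    have h1 : 1 ≤ q ^ 4 := one_le_pow₀ q1
    have h2 : 1 ≤ (2 * q ^ 4 * ‖b'‖) ^ 2 := by nlinarith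
    have h3 : 1 ≤ 2 * q ^ 4 * ‖b'‖ := by
      by_contra hc
      have : 0 ≤ 2 * q ^ 4 * ‖b'‖ := by positivity
      nlinarith
    rw [inv_le_iff_one_le_mul₀ (by positivity)]
    linarith
  refine ⟨h.orthonormal.update ?_ ?_, fun i => ?_⟩
  · rw [norm_smul, norm_inv, norm_norm, inv_mul_cancel₀ hpos.ne']
  · intro i hi
    rw [real_inner_smul_right, h.orthonormal.inner_deflate k b i (by omega), mul_zero]
  · change ‖S.starProjection (Function.update s.1 s.2 (‖b'‖⁻¹ • b') i)‖ ≤ τ * (q ^ 12) ^ (s.2 + 1)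
    have hmono : τ * (q ^ 12) ^ s.2 ≤ τ * (q ^ 12) ^ (s.2 + 1) := by
      gcongr
      · exact one_le_pow₀ q1
      · omega
    by_cases e : i = s.2
    · subst e
      rw [Function.update_self, map_smul, norm_smul, norm_inv, norm_norm]
      have h1 := h.orthonormal.norm_starProjection_sub_deflate_le h.near k b
      have h2 : ‖S.starProjection b'‖ ≤ τ + k * (n * q ^ 4) * (τ * (q ^ 12) ^ s.2) := by
        have e1 : S.starProjection b' = S.starProjection b - S.starProjection (b - b') := by
          rw [← map_sub, sub_sub_cancel]
        rw [e1]
        refine (norm_sub_le _ _).trans (add_le_add hbS (h1.trans ?_))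
        gcongr
      calc ‖b'‖⁻¹ * ‖S.starProjection b'‖
          ≤ 2 * q ^ 4 * (τ + q * (q * q ^ 4) * (τ * (q ^ 12) ^ s.2)) := by
            gcongr
            refine h2.trans ?_
            gcongr
        _ ≤ 2 * q ^ 4 * (q * (q * q ^ 4) * (τ * (q ^ 12) ^ s.2) + q * (q * q ^ 4) * (τ * (q ^ 12) ^ s.2)) := by
            gcongr
            have h3 : 1 ≤ q * (q * q ^ 4) := by
              rw [show q * (q * q ^ 4) = q ^ 6 by ring]; exact one_le_pow₀ q1
            calc τ = 1 * (τ * 1) := by ring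
              _ ≤ _ := by gcongr
        _ = 2 ^ 2 * q ^ 10 * (τ * (q ^ 12) ^ s.2) := by ring
        _ ≤ q ^ 2 * q ^ 10 * (τ * (q ^ 12) ^ s.2) := by gcongr
        _ = τ * (q ^ 12) ^ (s.2 + 1) := by ring
    · rw [Function.update_of_ne e]
      exact (h.near i).trans hmono

end

/-! ### Measurability of the algorithm -/

theorem measurable_bisect {α : Type*} [MeasurableSpace α] {f : α → ℝ → ℝ}
    (hf : Measurable (Function.uncurry f)) (T : ℕ) {t s : α → ℝ} (ht : Measurable t) (hs : Measurable s) :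
    Measurable fun a => bisect (f a) T (t a) (s a) := by
  have key : Measurable fun a => (bisectStep (f a))^[T] (t a, s a) := by
    induction T with
    | zero => exact ht.prodMk hs
    | succ T ih =>
        simp only [Function.iterate_succ_apply']
        have h1 : Measurable fun a => ((bisectStep (f a))^[T] (t a, s a)).1 +
            ((bisectStep (f a))^[T] (t a, s a)).2 := ih.fst.add ih.snd
        refine Measurable.prodMk (Measurable.ite ?_ h1 ih.fst) (ih.snd.mul_const _)
        exact measurableSet_le (hf.comp (measurable_id.prodMk h1)) measurable_const
  exact key.fst

section
variable {n : ℕ} {α : Type*} [MeasurableSpace α]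

theorem measurable_deflate {V : α → ℕ → EuclideanSpace ℝ (Fin n)} (hV : Measurable V) (m : ℕ)
    {x : α → EuclideanSpace ℝ (Fin n)} (hx : Measurable x) : Measurable fun a => deflate (V a) m (x a) := by
  induction m with
  | zero => exact hx
  | succ m ih =>
      have h1 : Measurable fun a => V a m := (measurable_pi_apply m).comp hV
      have h2 : Measurable fun a => (inner ℝ (V a m) (deflate (V a) m (x a)) : ℝ) := h1.inner ih
      exact ih.sub (h2.smul h1)

variable {M : EuclideanSpace ℝ (Fin n) → ℝ}

theorem measurable_crossing (hM : Measurable M) (T : ℕ) : Measurable (crossing M T) := by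
  refine measurable_bisect (f := fun (g : EuclideanSpace ℝ (Fin n)) c => M (c • g)) ?_ T
    measurable_const measurable_const
  exact hM.comp (measurable_snd.smul measurable_fst)

theorem measurable_response (hM : Measurable M) (K h : ℝ) (T : ℕ) {g y : α → EuclideanSpace ℝ (Fin n)}
    {c : α → ℝ} (hg : Measurable g) (hc : Measurable c) (hy : Measurable y) :
    Measurable fun a => response M K h T (g a) (c a) (y a) := by
  refine measurable_bisect (f := fun a t => M (c a • g a + h • y a + t • h • g a)) ?_ T
    measurable_const measurable_const
  refine hM.comp ?_
  exact (((hc.comp measurable_fst).smul (hg.comp measurable_fst)).add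
    ((hy.comp measurable_fst).const_smul h)).add (measurable_snd.smul ((hg.comp measurable_fst).const_smul h))

theorem measurable_responseVec (hM : Measurable M) (K h : ℝ) (T : ℕ) {g : α → EuclideanSpace ℝ (Fin n)}
    {c : α → ℝ} (hg : Measurable g) (hc : Measurable c) :
    Measurable fun a => responseVec M K h T (g a) (c a) :=
  (WithLp.measurable_toLp 2 _).comp
    (measurable_pi_lambda _ fun _ => measurable_response hM K h T hg hc measurable_const)

theorem measurable_nonlinearity (hM : Measurable M) (K h : ℝ) (T : ℕ) {g y : α → EuclideanSpace ℝ (Fin n)}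
    (hg : Measurable g) (hy : Measurable y) : Measurable fun a => nonlinearity M K h T (g a) (y a) := by
  have hc := (measurable_crossing hM T).comp hg
  exact (measurable_response hM K h T hg hc hy).sub ((measurable_responseVec hM K h T hg hc).inner hy)

/-- The condition for appending a vector. -/
def Accepts (M : EuclideanSpace ℝ (Fin n) → ℝ) (k : ℕ) (K h : ℝ) (T : ℕ)
    (s : (ℕ → EuclideanSpace ℝ (Fin n)) × ℕ) (g y : EuclideanSpace ℝ (Fin n)) : Prop :=
  s.2 < k ∧ nonlinearity M K h T (deflate s.1 k g) y * nonlinearity M K h T (deflate s.1 k g) y ≤ h ∧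
    1 / 2 ≤ K * ‖deflate s.1 k (responseVec M K h T (deflate s.1 k g)
      (crossing M T (deflate s.1 k g)))‖ ^ 2

/-- The state after appending a vector. -/
noncomputable def appended (M : EuclideanSpace ℝ (Fin n) → ℝ) (k : ℕ) (K h : ℝ) (T : ℕ)
    (s : (ℕ → EuclideanSpace ℝ (Fin n)) × ℕ) (g : EuclideanSpace ℝ (Fin n)) :
    (ℕ → EuclideanSpace ℝ (Fin n)) × ℕ :=
  (Function.update s.1 s.2
    (‖deflate s.1 k (responseVec M K h T (deflate s.1 k g) (crossing M T (deflate s.1 k g)))‖⁻¹ •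
      deflate s.1 k (responseVec M K h T (deflate s.1 k g) (crossing M T (deflate s.1 k g)))), s.2 + 1)

theorem learnStep_of_accepts {k : ℕ} {K h : ℝ} {T : ℕ} {s : (ℕ → EuclideanSpace ℝ (Fin n)) × ℕ}
    {g y : EuclideanSpace ℝ (Fin n)} (H : Accepts M k K h T s g y) :
    learnStep M k K h T s g y = appended M k K h T s g := if_pos H

theorem learnStep_of_not_accepts {k : ℕ} {K h : ℝ} {T : ℕ} {s : (ℕ → EuclideanSpace ℝ (Fin n)) × ℕ}
    {g y : EuclideanSpace ℝ (Fin n)} (H : ¬ Accepts M k K h T s g y) :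
    learnStep M k K h T s g y = s := if_neg H

variable {s : α → (ℕ → EuclideanSpace ℝ (Fin n)) × ℕ} {g y : α → EuclideanSpace ℝ (Fin n)}

theorem measurable_deflate_responseVec (hM : Measurable M) (k : ℕ) (K h : ℝ) (T : ℕ) (hs : Measurable s)
    (hg : Measurable g) : Measurable fun a => deflate (s a).1 k (responseVec M K h T
      (deflate (s a).1 k (g a)) (crossing M T (deflate (s a).1 k (g a)))) := by
  have hz := measurable_deflate hs.fst k hg
  exact measurable_deflate hs.fst k (measurable_responseVec hM K h T hz ((measurable_crossing hM T).comp hz))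

theorem measurableSet_accepts (hM : Measurable M) (k : ℕ) (K h : ℝ) (T : ℕ) (hs : Measurable s)
    (hg : Measurable g) (hy : Measurable y) :
    MeasurableSet {a | Accepts M k K h T (s a) (g a) (y a)} := by
  have hN := measurable_nonlinearity hM K h T (measurable_deflate hs.fst k hg) hy
  exact (measurableSet_lt hs.snd measurable_const).inter
    ((measurableSet_le (hN.mul hN) measurable_const).inter
      (measurableSet_le measurable_const
        (((measurable_deflate_responseVec hM k K h T hs hg).norm.pow_const 2).const_mul K)))

theorem measurable_learnStep (hM : Measurable M) (k : ℕ) (K h : ℝ) (T : ℕ) (hs : Measurable s)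
    (hg : Measurable g) (hy : Measurable y) :
    Measurable fun a => learnStep M k K h T (s a) (g a) (y a) := by
  have hb := measurable_deflate_responseVec hM k K h T hs hg
  refine Measurable.ite (measurableSet_accepts hM k K h T hs hg hy) ?_ hs
  refine Measurable.prodMk (measurable_pi_lambda _ fun i => ?_) (hs.snd.add_const 1)
  have hi : MeasurableSet {a | i = (s a).2} := measurableSet_eq_fun measurable_const hs.snd
  simp only [Function.update_apply]
  exact Measurable.ite hi (hb.norm.inv.smul hb) ((measurable_pi_apply i).comp hs.fst)

theorem measurable_headVec (n : ℕ) : Measurable (headVec n) :=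
  (WithLp.measurable_toLp 2 _).comp (measurable_pi_lambda _ fun _ => measurable_pi_apply _)

theorem measurable_shiftSource (n : ℕ) : Measurable (shiftSource n) :=
  measurable_pi_lambda _ fun _ => measurable_pi_apply _

theorem measurable_learn (hM : Measurable M) (k : ℕ) (K h : ℝ) (T R : ℕ) :
    ∀ {s : α → (ℕ → EuclideanSpace ℝ (Fin n)) × ℕ} {w : α → ℕ → ℝ}, Measurable s → Measurable w →
      Measurable fun a => learn M k K h T R (s a) (w a) := by
  induction R with
  | zero => intro s w hs hw; exact hs
  | succ R ih =>
      intro s w hs hw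
      have h1 := (measurable_shiftSource n).comp hw
      exact ih (measurable_learnStep hM k K h T hs ((measurable_headVec n).comp hw)
        ((measurable_headVec n).comp h1)) ((measurable_shiftSource n).comp h1)

theorem measurableSet_goodState (S : Submodule ℝ (EuclideanSpace ℝ (Fin n))) (τ W : ℝ) :
    MeasurableSet {s : (ℕ → EuclideanSpace ℝ (Fin n)) × ℕ | GoodState S τ W s} := by
  have hV : ∀ i, Measurable fun s : (ℕ → EuclideanSpace ℝ (Fin n)) × ℕ => s.1 i := fun i =>
    (measurable_pi_apply i).comp measurable_fst
  have h2 : Measurable fun s : (ℕ → EuclideanSpace ℝ (Fin n)) × ℕ => s.2 := measurable_snd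
  have e : {s : (ℕ → EuclideanSpace ℝ (Fin n)) × ℕ | GoodState S τ W s} =
      ((⋂ i, {s | s.2 ≤ i} ∪ {s | ‖s.1 i‖ = 1}) ∩ (⋂ i, {s | i < s.2} ∪ {s | s.1 i = 0}) ∩
        ⋂ i, ⋂ l, {s | i = l} ∪ {s | inner ℝ (s.1 i) (s.1 l) = (0 : ℝ)}) ∩
      ⋂ i, {s | ‖S.starProjection (s.1 i)‖ ≤ τ * W ^ s.2} := by
    ext s
    simp only [Set.mem_inter_iff, Set.mem_iInter, Set.mem_union, Set.mem_ofPred_eq]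
    constructor
    · rintro ⟨⟨a, b, c⟩, d⟩
      exact ⟨⟨⟨fun i => (le_or_gt s.2 i).imp_right (a i), fun i => (lt_or_ge i s.2).imp_right (b i)⟩,
        fun i l => (eq_or_ne i l).imp_right (c i l)⟩, d⟩
    · rintro ⟨⟨⟨a, b⟩, c⟩, d⟩
      exact ⟨⟨fun i hi => (a i).resolve_left hi.not_ge, fun i hi => (b i).resolve_left hi.not_gt,
        fun i l hil => (c i l).resolve_left hil⟩, d⟩
  rw [e]
  refine ((MeasurableSet.inter ?_ ?_).inter ?_).inter ?_
  · exact .iInter fun i => (measurableSet_le h2 measurable_const).union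
      (measurableSet_eq_fun (hV i).norm measurable_const)
  · exact .iInter fun i => (measurableSet_lt measurable_const h2).union
      (measurableSet_eq_fun (hV i) measurable_const)
  · exact .iInter fun i => .iInter fun l => (MeasurableSet.const _).union
      (measurableSet_eq_fun ((hV i).inner (hV l)) measurable_const)
  · exact .iInter fun i => measurableSet_le (S.starProjection.measurable.comp (hV i)).norm
      ((measurable_const.pow h2).const_mul τ)

end

/-! ### Gaussian estimates -/

theorem gaussianReal_Icc_le (a b : ℝ) :
    gaussianReal 0 1 (Set.Icc a b) ≤ ENNReal.ofReal (b - a) := by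
  rw [gaussianReal_apply _ one_ne_zero]
  calc ∫⁻ x in Set.Icc a b, gaussianPDF 0 1 x ≤ ∫⁻ _ in Set.Icc a b, 1 := by
        refine lintegral_mono fun x => ?_
        rw [gaussianPDF, ← ENNReal.ofReal_one]
        refine ENNReal.ofReal_le_ofReal ?_
        rw [gaussianPDFReal]
        have h1 : (√(2 * Real.pi * (1 : NNReal)))⁻¹ ≤ 1 := by
          refine inv_le_one_of_one_le₀ (Real.one_le_sqrt.2 ?_)
          have := Real.pi_gt_three
          norm_num
          linarith
        refine mul_le_one₀ h1 (Real.exp_nonneg _) (Real.exp_le_one_iff.2 ?_)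
        have : 0 ≤ (x - 0) ^ 2 / (2 * ((1 : NNReal) : ℝ)) := by positivity
        rw [neg_div]
        linarith
    _ = ENNReal.ofReal (b - a) := by simp

section
variable {n : ℕ}

/-- Replacing the component of a standard Gaussian vector in a direction `w` by an independent standard
Gaussian variable does not change its law. -/
theorem map_resample {w : EuclideanSpace ℝ (Fin n)} (hw : ‖w‖ = 1) :
    ((stdGaussian (EuclideanSpace ℝ (Fin n))).prod (gaussianReal 0 1)).map
      (fun p => p.1 - (inner ℝ w p.1 : ℝ) • w + p.2 • w) = stdGaussian (EuclideanSpace ℝ (Fin n)) := by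
  have hm : Measurable fun p : EuclideanSpace ℝ (Fin n) × ℝ =>
      p.1 - (inner ℝ w p.1 : ℝ) • w + p.2 • w := by fun_prop
  have : IsProbabilityMeasure (((stdGaussian (EuclideanSpace ℝ (Fin n))).prod (gaussianReal 0 1)).map
      (fun p => p.1 - (inner ℝ w p.1 : ℝ) • w + p.2 • w)) :=
    Measure.isProbabilityMeasure_map hm.aemeasurable
  refine Measure.ext_of_charFun ?_
  ext t
  rw [charFun_apply, integral_map hm.aemeasurable (by fun_prop), charFun_stdGaussian]
  set t' := t - (inner ℝ w t : ℝ) • w with ht'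
  have e : ∀ p : EuclideanSpace ℝ (Fin n) × ℝ,
      Complex.exp ((inner ℝ (p.1 - (inner ℝ w p.1 : ℝ) • w + p.2 • w) t : ℝ) * Complex.I) =
      Complex.exp ((inner ℝ p.1 t' : ℝ) * Complex.I) *
        Complex.exp ((inner ℝ w t : ℝ) * p.2 * Complex.I) := by
    intro p
    rw [← Complex.exp_add]
    congr 1
    rw [ht', inner_add_left, inner_sub_left, inner_sub_right, real_inner_smul_left, real_inner_smul_left,
      real_inner_smul_right, real_inner_comm p.1 w]
    push_cast
    ring
  simp_rw [e]
  rw [integral_prod_mul (fun y : EuclideanSpace ℝ (Fin n) => Complex.exp ((inner ℝ y t' : ℝ) * Complex.I))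
    (fun x : ℝ => Complex.exp ((inner ℝ w t : ℝ) * x * Complex.I)), ← charFun_apply,
    ← charFun_apply_real, charFun_stdGaussian, charFun_gaussianReal, ← Complex.exp_add]
  congr 1
  have h1 : ‖t'‖ ^ 2 + (inner ℝ w t) ^ 2 = ‖t‖ ^ 2 := by
    rw [ht', norm_sub_sq_real, real_inner_smul_right, norm_smul, hw, real_inner_comm t w]
    simp only [Real.norm_eq_abs, mul_one, sq_abs]
    ring
  rw [← Complex.ofReal_pow ‖t‖, ← h1]
  push_cast
  ring

/-- A function that is affine with slope `-β` in the direction of the unit vector `w` is rarely small. -/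
theorem stdGaussian_abs_le_le {w : EuclideanSpace ℝ (Fin n)} (hw : ‖w‖ = 1) {β s : ℝ} (hβ : 0 < β)
    {F : EuclideanSpace ℝ (Fin n) → ℝ} (hF : Measurable F) (hFw : ∀ y (t : ℝ), F (y + t • w) = F y - t * β) :
    stdGaussian (EuclideanSpace ℝ (Fin n)) {y | |F y| ≤ s} ≤ ENNReal.ofReal (2 * s / β) := by
  have hm : Measurable fun p : EuclideanSpace ℝ (Fin n) × ℝ =>
      p.1 - (inner ℝ w p.1 : ℝ) • w + p.2 • w := by fun_prop
  have hA : MeasurableSet {y | |F y| ≤ s} := measurableSet_le hF.abs measurable_const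
  rw [← map_resample hw, Measure.map_apply hm hA, Measure.prod_apply (hm hA)]
  calc _ ≤ ∫⁻ _, ENNReal.ofReal (2 * s / β) ∂(stdGaussian (EuclideanSpace ℝ (Fin n))) := by
        refine lintegral_mono fun y => ?_
        set a := F (y - (inner ℝ w y : ℝ) • w)
        have e : Prod.mk y ⁻¹' ((fun p : EuclideanSpace ℝ (Fin n) × ℝ =>
            p.1 - (inner ℝ w p.1 : ℝ) • w + p.2 • w) ⁻¹' {y | |F y| ≤ s}) ⊆
            Set.Icc ((a - s) / β) ((a + s) / β) := by
          intro ξ hξ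
          have hξ : |F (y - (inner ℝ w y : ℝ) • w + ξ • w)| ≤ s := hξ
          rw [hFw, abs_le] at hξ
          exact ⟨(div_le_iff₀ hβ).2 (by linarith), (le_div_iff₀ hβ).2 (by linarith)⟩
        refine (measure_mono e).trans ((gaussianReal_Icc_le _ _).trans (ENNReal.ofReal_le_ofReal ?_))
        rw [← sub_div]
        exact le_of_eq (by ring)
    _ = _ := by simp

/-- A crude bound for the tail of the norm of a standard Gaussian vector, from Chebyshev's inequality for the
coordinates. -/
theorem stdGaussian_norm_gt_le (n : ℕ) {q : ℝ} (hq : 0 < q) :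
    stdGaussian (EuclideanSpace ℝ (Fin n)) {g | q < ‖g‖} ≤ ENNReal.ofReal ((n : ℝ) ^ 3 / q ^ 2) := by
  rcases Nat.eq_zero_or_pos n with rfl | hn
  · have : {g : EuclideanSpace ℝ (Fin 0) | q < ‖g‖} = ∅ := by
      ext g
      have : ‖g‖ = 0 := by rw [Subsingleton.elim g 0, norm_zero]
      simp [this, hq.le]
    rw [this]; simp
  have hn' : (0 : ℝ) < n := by exact_mod_cast hn
  have hms : MeasurableSet {g : EuclideanSpace ℝ (Fin n) | q < ‖g‖} :=
    measurableSet_lt measurable_const measurable_norm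
  rw [← map_pi_eq_stdGaussian, Measure.map_apply (WithLp.measurable_toLp 2 _) hms]
  have hsub : WithLp.toLp 2 ⁻¹' {g : EuclideanSpace ℝ (Fin n) | q < ‖g‖} ⊆
      ⋃ i, (fun x : Fin n → ℝ => x i) ⁻¹' {r | q / n ≤ |r|} := by
    intro x hx
    by_contra hc
    simp only [Set.mem_iUnion, Set.mem_preimage, Set.mem_ofPred_eq, not_exists, not_le] at hc
    have hx : q < ‖WithLp.toLp 2 x‖ := hx
    have h1 : ‖WithLp.toLp 2 x‖ ^ 2 ≤ q ^ 2 := by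
      rw [EuclideanSpace.norm_sq_eq]
      calc ∑ i, ‖x i‖ ^ 2 ≤ ∑ _i : Fin n, (q / n) ^ 2 := Finset.sum_le_sum fun i _ => by
            gcongr
            exact (hc i).le
        _ = q ^ 2 / n := by simp; field_simp
        _ ≤ q ^ 2 := div_le_self (sq_nonneg q) (by exact_mod_cast hn)
    nlinarith
  refine (measure_mono hsub).trans ((measure_iUnion_le _).trans ?_)
  have h1 : ∀ i : Fin n, Measure.pi (fun _ : Fin n => gaussianReal 0 1)
      ((fun x : Fin n → ℝ => x i) ⁻¹' {r | q / n ≤ |r|}) ≤ ENNReal.ofReal ((n : ℝ) ^ 2 / q ^ 2) := by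
    intro i
    have hr : MeasurableSet {r : ℝ | q / n ≤ |r|} := measurableSet_le measurable_const measurable_norm
    refine ((measurePreserving_eval (fun _ : Fin n => gaussianReal 0 1) i).measure_preimage
      hr.nullMeasurableSet).trans_le ?_
    have := meas_ge_le_variance_div_sq (μ := gaussianReal 0 1) (X := id) (memLp_id_gaussianReal 2)
      (div_pos hq hn')
    rw [variance_id_gaussianReal] at this
    simp only [id_eq, integral_id_gaussianReal, sub_zero] at this
    refine this.trans (ENNReal.ofReal_le_ofReal (le_of_eq ?_))
    rw [NNReal.coe_one, div_pow, one_div_div]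
  rw [tsum_fintype]
  calc _ ≤ ∑ _i : Fin n, ENNReal.ofReal ((n : ℝ) ^ 2 / q ^ 2) := Finset.sum_le_sum fun i _ => h1 i
    _ = ENNReal.ofReal ((n : ℝ) ^ 3 / q ^ 2) := by
      rw [Finset.sum_const, Finset.card_univ, Fintype.card_fin, nsmul_eq_mul, ← ENNReal.ofReal_natCast,
        ← ENNReal.ofReal_mul hn'.le]
      congr 1
      ring

/-! ### The random source -/

instance : IsProbabilityMeasure gaussianSource := by unfold gaussianSource; infer_instance

/-- A vector of length `n` followed by a sequence. -/
def joinSource (n : ℕ) (p : (Fin n → ℝ) × (ℕ → ℝ)) (i : ℕ) : ℝ :=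
  if h : i < n then p.1 ⟨i, h⟩ else p.2 (i - n)

theorem measurable_joinSource (n : ℕ) : Measurable (joinSource n) := by
  refine measurable_pi_lambda _ fun i => ?_
  unfold joinSource
  split_ifs with h
  · exact (measurable_pi_apply _).comp measurable_fst
  · exact (measurable_pi_apply _).comp measurable_snd

/-- Prepending independent Gaussians to the random source does not change its law. -/
theorem map_joinSource (n : ℕ) :
    ((Measure.pi fun _ : Fin n => gaussianReal 0 1).prod gaussianSource).map (joinSource n) =
      gaussianSource := by
  refine Measure.eq_infinitePi _ fun s t ht => ?_
  classical
  obtain ⟨m, hm⟩ : ∃ m, s ⊆ Finset.range (n + m) := by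
    obtain ⟨m, hm⟩ := s.exists_nat_subset_range
    exact ⟨m, hm.trans (Finset.range_mono (by omega))⟩
  set u : ℕ → Set ℝ := fun i => if i ∈ s then t i else Set.univ with hu
  have hum : ∀ i, MeasurableSet (u i) := fun i => by
    simp only [hu]; split_ifs
    · exact ht i
    · exact MeasurableSet.univ
  have e1 : joinSource n ⁻¹' Set.pi s t =
      (Set.pi Set.univ fun i : Fin n => u i) ×ˢ Set.pi (Finset.range m) fun i => u (n + i) := by
    ext p
    simp only [Set.mem_preimage, Set.mem_pi, Set.mem_prod, Finset.mem_coe, Set.mem_univ, true_imp_iff,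
      Finset.mem_range]
    constructor
    · intro H
      refine ⟨fun i => ?_, fun i _ => ?_⟩
      · simp only [hu]; split_ifs with h
        · simpa [joinSource] using H i h
        · trivial
      · simp only [hu]; split_ifs with h
        · simpa [joinSource] using H (n + i) h
        · trivial
    · rintro ⟨H1, H2⟩ i hi
      unfold joinSource
      split_ifs with h
      · have := H1 ⟨i, h⟩
        simpa [hu, hi] using this
      · have h1 : i < n + m := Finset.mem_range.1 (hm hi)
        have := H2 (i - n) (by omega)
        rw [show n + (i - n) = i by omega] at this
        simpa [hu, hi] using this
  have hpi : MeasurableSet (Set.pi (s : Set ℕ) t) :=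
    MeasurableSet.pi s.countable_toSet fun i _ => ht i
  rw [Measure.map_apply (measurable_joinSource n) hpi, e1, Measure.prod_prod, Measure.pi_pi,
    gaussianSource, Measure.infinitePi_pi _ fun i _ => hum _,
    Fin.prod_univ_eq_prod_range (fun i => gaussianReal 0 1 (u i)) n, ← Finset.prod_range_add]
  rw [← Finset.prod_subset hm]
  · exact Finset.prod_congr rfl fun i hi => by simp [hu, hi]
  · intro i _ hi
    simp [hu, hi]

theorem map_headVec_shiftSource (n : ℕ) :
    gaussianSource.map (fun w => (headVec n w, shiftSource n w)) =
      (stdGaussian (EuclideanSpace ℝ (Fin n))).prod gaussianSource := by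
  have h1 : Measurable fun w => (headVec n w, shiftSource n w) :=
    (measurable_headVec n).prodMk (measurable_shiftSource n)
  have e : (fun w => (headVec n w, shiftSource n w)) ∘ joinSource n = Prod.map (WithLp.toLp 2) id := by
    funext p
    refine Prod.ext ?_ ?_
    · ext i; simp [headVec, joinSource]
    · funext i; simp [shiftSource, joinSource]
  conv_lhs => rw [← map_joinSource n]
  rw [Measure.map_map h1 (measurable_joinSource n), e, ← Measure.map_prod_map _ _
    (WithLp.measurable_toLp 2 _) measurable_id, map_pi_eq_stdGaussian, Measure.map_id]

/-- Two independent standard Gaussian vectors may be taken from the random source. -/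
theorem map_headVec_headVec_shiftSource (n : ℕ) :
    gaussianSource.map (fun w => ((headVec n w, headVec n (shiftSource n w)),
      shiftSource n (shiftSource n w))) =
      ((stdGaussian (EuclideanSpace ℝ (Fin n))).prod
        (stdGaussian (EuclideanSpace ℝ (Fin n)))).prod gaussianSource := by
  have h1 : Measurable fun w => (headVec n w, shiftSource n w) :=
    (measurable_headVec n).prodMk (measurable_shiftSource n)
  have e : (fun w => ((headVec n w, headVec n (shiftSource n w)), shiftSource n (shiftSource n w))) =
      MeasurableEquiv.prodAssoc.symm ∘ (Prod.map id fun w => (headVec n w, shiftSource n w)) ∘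
        fun w => (headVec n w, shiftSource n w) := rfl
  rw [e, ← Measure.map_map (by fun_prop) (by fun_prop), ← Measure.map_map (by fun_prop) h1,
    map_headVec_shiftSource, ← Measure.map_prod_map _ _ measurable_id h1, Measure.map_id,
    map_headVec_shiftSource]
  rw [← Measure.prodAssoc_prod, MeasurableEquiv.map_symm_map]

end

/-! ### The probability of failure -/

section
variable {n : ℕ} {M : EuclideanSpace ℝ (Fin n) → ℝ} {S : Submodule ℝ (EuclideanSpace ℝ (Fin n))}

/-- Where the oracle is blind, the failure of linearity is an affine function, since the response does not
change. -/
theorem nonlinearity_add_smul (hMS : ∀ x, ∀ z ∈ S, M (x + z) = M x) (K h : ℝ) (T : ℕ)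
    (g y : EuclideanSpace ℝ (Fin n)) {w : EuclideanSpace ℝ (Fin n)} (hw : w ∈ S) (t : ℝ) :
    nonlinearity M K h T g (y + t • w) = nonlinearity M K h T g y -
      t * inner ℝ (responseVec M K h T g (crossing M T g)) w := by
  have e : response M K h T g (crossing M T g) (y + t • w) =
      response M K h T g (crossing M T g) y := by
    unfold response
    congr 1
    funext u
    rw [show crossing M T g • g + h • (y + t • w) + u • h • g =
      (crossing M T g • g + h • y + u • h • g) + (h * t) • w by module]
    exact hMS _ _ (S.smul_mem _ hw)
  rw [nonlinearity, nonlinearity, e, inner_add_right, real_inner_smul_right]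
  ring

/-- If the response vector is far from the orthogonal complement of `S`, to which the oracle is blind, then
the random linearity test detects this. -/
theorem stdGaussian_nonlinearity_le (hM : Measurable M) (hMS : ∀ x, ∀ z ∈ S, M (x + z) = M x)
    (K : ℝ) (T : ℕ) {τ : ℝ} (hτ : 0 < τ) (g : EuclideanSpace ℝ (Fin n))
    (hb : τ < ‖S.starProjection (responseVec M K (τ ^ 4) T g (crossing M T g))‖) :
    stdGaussian (EuclideanSpace ℝ (Fin n))
      {y | nonlinearity M K (τ ^ 4) T g y * nonlinearity M K (τ ^ 4) T g y ≤ τ ^ 4} ≤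
      ENNReal.ofReal (2 * τ) := by
  set b := responseVec M K (τ ^ 4) T g (crossing M T g) with hbdef
  set p := S.starProjection b with hp
  have hp0 : 0 < ‖p‖ := hτ.trans hb
  have hpS : p ∈ S := Submodule.starProjection_apply_mem _ _
  have hip : inner ℝ b (‖p‖⁻¹ • p) = ‖p‖ := by
    have h1 : inner ℝ (b - p) p = (0 : ℝ) := by
      rw [real_inner_comm]
      exact (Submodule.mem_orthogonal _ _).1 (S.sub_starProjection_mem_orthogonal b) p hpS
    rw [inner_sub_left, real_inner_self_eq_norm_sq] at h1
    rw [real_inner_smul_right, show (inner ℝ b p : ℝ) = ‖p‖ ^ 2 by linarith]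
    field_simp
  have key := stdGaussian_abs_le_le (w := ‖p‖⁻¹ • p) (β := ‖p‖) (s := τ ^ 2)
    (by rw [norm_smul, norm_inv, norm_norm, inv_mul_cancel₀ hp0.ne']) hp0
    (F := nonlinearity M K (τ ^ 4) T g) (measurable_nonlinearity hM K _ T measurable_const measurable_id)
    (fun y t => by
      rw [nonlinearity_add_smul hMS K _ T g y (S.smul_mem _ hpS), ← hbdef, hip])
  refine (measure_mono fun y hy => ?_).trans (key.trans (ENNReal.ofReal_le_ofReal ?_))
  · have hy : nonlinearity M K (τ ^ 4) T g y * nonlinearity M K (τ ^ 4) T g y ≤ τ ^ 4 := hy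
    refine abs_le_of_sq_le_sq (a := nonlinearity M K (τ ^ 4) T g y) ?_ (sq_nonneg τ)
    calc _ = nonlinearity M K (τ ^ 4) T g y * nonlinearity M K (τ ^ 4) T g y := sq _
      _ ≤ τ ^ 4 := hy
      _ = (τ ^ 2) ^ 2 := by ring
  · rw [div_le_iff₀ hp0]
    nlinarith

/-- Starting from a good state, a round rarely leads to a bad one. -/
theorem prod_accepts_not_goodState_le (hM : Measurable M) (hMS : ∀ x, ∀ z ∈ S, M (x + z) = M x)
    {k : ℕ} {q τ : ℝ} (T : ℕ) (hτ : 0 < τ) (hq : 2 ≤ q) (hn : (n : ℝ) ≤ q) (hk : (k : ℝ) ≤ q)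
    {s : (ℕ → EuclideanSpace ℝ (Fin n)) × ℕ} (hs : GoodState S τ (q ^ 12) s) :
    ((stdGaussian (EuclideanSpace ℝ (Fin n))).prod (stdGaussian (EuclideanSpace ℝ (Fin n))))
      {p | Accepts M k (q ^ 4) (τ ^ 4) T s p.1 p.2 ∧
        ¬ GoodState S τ (q ^ 12) (appended M k (q ^ 4) (τ ^ 4) T s p.1)} ≤ ENNReal.ofReal (2 * τ) := by
  set z : EuclideanSpace ℝ (Fin n) → EuclideanSpace ℝ (Fin n) := fun g => deflate s.1 k g with hz
  set b : EuclideanSpace ℝ (Fin n) → EuclideanSpace ℝ (Fin n) :=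
    fun g => responseVec M (q ^ 4) (τ ^ 4) T (z g) (crossing M T (z g)) with hb
  have hzm : Measurable z := measurable_deflate measurable_const k measurable_id
  have hbm : Measurable b := measurable_responseVec hM _ _ T hzm ((measurable_crossing hM T).comp hzm)
  set D : Set (EuclideanSpace ℝ (Fin n) × EuclideanSpace ℝ (Fin n)) :=
    {p | τ < ‖S.starProjection (b p.1)‖ ∧ nonlinearity M (q ^ 4) (τ ^ 4) T (z p.1) p.2 *
      nonlinearity M (q ^ 4) (τ ^ 4) T (z p.1) p.2 ≤ τ ^ 4} with hD
  have hNm : Measurable fun p : EuclideanSpace ℝ (Fin n) × EuclideanSpace ℝ (Fin n) =>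
      nonlinearity M (q ^ 4) (τ ^ 4) T (z p.1) p.2 :=
    measurable_nonlinearity hM _ _ T (hzm.comp measurable_fst) measurable_snd
  have hDm : MeasurableSet D :=
    (measurableSet_lt measurable_const
      (S.starProjection.measurable.comp (hbm.comp measurable_fst)).norm).inter
      (measurableSet_le (hNm.mul hNm) measurable_const)
  refine (measure_mono (t := D) ?_).trans ?_
  · rintro p ⟨⟨h1, h2, h3⟩, h4⟩
    refine ⟨?_, h2⟩
    by_contra hc
    refine h4 ?_
    have q0 : 0 ≤ q ^ 4 := by positivity
    exact hs.update hτ.le hq hn hk h1 (norm_responseVec_le M q0 _ T _ _) (not_lt.1 hc) h3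
  · rw [Measure.prod_apply hDm]
    calc _ ≤ ∫⁻ _, ENNReal.ofReal (2 * τ) ∂(stdGaussian (EuclideanSpace ℝ (Fin n))) := by
          refine lintegral_mono fun g => ?_
          by_cases hg : τ < ‖S.starProjection (b g)‖
          · refine (measure_mono fun y hy => ?_).trans
              (stdGaussian_nonlinearity_le hM hMS (q ^ 4) T hτ (z g) hg)
            exact hy.2
          · have : Prod.mk g ⁻¹' D = ∅ := by
              ext y
              simp [hD, hg]
            rw [this]
            simp
      _ = _ := by simp

theorem learn_of_le {k : ℕ} {K h : ℝ} {T : ℕ} {s : (ℕ → EuclideanSpace ℝ (Fin n)) × ℕ} (hs : k ≤ s.2)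
    (R : ℕ) : ∀ w, learn M k K h T R s w = s := by
  induction R with
  | zero => intro w; rfl
  | succ R ih =>
      intro w
      rw [learn, learnStep_of_not_accepts fun H => absurd H.1 (not_lt.2 hs), ih]

/-- The algorithm fails: it does not end in a good state with `k` vectors. -/
def failureSet (M : EuclideanSpace ℝ (Fin n) → ℝ) (S : Submodule ℝ (EuclideanSpace ℝ (Fin n))) (k : ℕ)
    (q τ : ℝ) (T R : ℕ) (s : (ℕ → EuclideanSpace ℝ (Fin n)) × ℕ) : Set (ℕ → ℝ) :=
  {w | ¬ (GoodState S τ (q ^ 12) (learn M k (q ^ 4) (τ ^ 4) T R s w) ∧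
    (learn M k (q ^ 4) (τ ^ 4) T R s w).2 = k)}

/-- The rounds are independent: the first round only changes the starting state of the others. -/
theorem gaussianSource_failureSet_succ (hM : Measurable M) (k : ℕ) (q τ : ℝ) (T R : ℕ)
    (s : (ℕ → EuclideanSpace ℝ (Fin n)) × ℕ) :
    gaussianSource (failureSet M S k q τ T (R + 1) s) =
      ∫⁻ p, gaussianSource (failureSet M S k q τ T R (learnStep M k (q ^ 4) (τ ^ 4) T s p.1 p.2))
        ∂((stdGaussian (EuclideanSpace ℝ (Fin n))).prod (stdGaussian (EuclideanSpace ℝ (Fin n)))) := by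
  set F : Set ((EuclideanSpace ℝ (Fin n) × EuclideanSpace ℝ (Fin n)) × (ℕ → ℝ)) :=
    {x | x.2 ∈ failureSet M S k q τ T R (learnStep M k (q ^ 4) (τ ^ 4) T s x.1.1 x.1.2)} with hF
  have hL : Measurable fun x : (EuclideanSpace ℝ (Fin n) × EuclideanSpace ℝ (Fin n)) × (ℕ → ℝ) =>
      learn M k (q ^ 4) (τ ^ 4) T R (learnStep M k (q ^ 4) (τ ^ 4) T s x.1.1 x.1.2) x.2 :=
    measurable_learn hM k _ _ T R (measurable_learnStep hM k _ _ T measurable_const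
      (measurable_fst.comp measurable_fst) (measurable_snd.comp measurable_fst)) measurable_snd
  have hFm : MeasurableSet F :=
    ((hL (measurableSet_goodState S τ (q ^ 12))).inter
      (measurableSet_eq_fun hL.snd measurable_const)).compl
  have hsplit : Measurable fun w : ℕ → ℝ => ((headVec n w, headVec n (shiftSource n w)),
      shiftSource n (shiftSource n w)) :=
    ((measurable_headVec n).prodMk ((measurable_headVec n).comp (measurable_shiftSource n))).prodMk
      ((measurable_shiftSource n).comp (measurable_shiftSource n))
  have e : failureSet M S k q τ T (R + 1) s = (fun w : ℕ → ℝ => ((headVec n w, headVec n (shiftSource n w)),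
      shiftSource n (shiftSource n w))) ⁻¹' F := rfl
  rw [e, ← Measure.map_apply hsplit hFm, map_headVec_headVec_shiftSource, Measure.prod_apply hFm]
  rfl

/-- If every round that starts in a good state appends a vector with probability at least `a`, then the
probability of failure decays exponentially, up to the errors of the linearity tests. Here `i` is the number of
missing vectors. The factor `2 ^ i - 1` vanishes for `i = 0`, and it drops by `2 ^ (i - 1)`, which is at least
half its value, when a vector is appended; therefore it decays by the factor `1 - a / 2` on average. -/
theorem gaussianSource_failureSet_le (hM : Measurable M) (hMS : ∀ x, ∀ z ∈ S, M (x + z) = M x)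
    {k : ℕ} {q τ : ℝ} (T : ℕ) (hτ : 0 < τ) (hq : 2 ≤ q) (hn : (n : ℝ) ≤ q) (hk : (k : ℝ) ≤ q)
    {a : ℝ} (ha : 0 ≤ a) (ha1 : a ≤ 1)
    (hacc : ∀ s : (ℕ → EuclideanSpace ℝ (Fin n)) × ℕ, GoodState S τ (q ^ 12) s → s.2 < k →
      ENNReal.ofReal a ≤ ((stdGaussian (EuclideanSpace ℝ (Fin n))).prod
        (stdGaussian (EuclideanSpace ℝ (Fin n)))) {p | Accepts M k (q ^ 4) (τ ^ 4) T s p.1 p.2})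
    (R : ℕ) : ∀ (s : (ℕ → EuclideanSpace ℝ (Fin n)) × ℕ) (i : ℕ), GoodState S τ (q ^ 12) s →
      s.2 + i = k → gaussianSource (failureSet M S k q τ T R s) ≤
        ENNReal.ofReal ((2 ^ i - 1) * (1 - a / 2) ^ R + R * (2 * τ)) := by
  have hcomplete : ∀ R, ∀ s : (ℕ → EuclideanSpace ℝ (Fin n)) × ℕ, GoodState S τ (q ^ 12) s → s.2 = k →
      gaussianSource (failureSet M S k q τ T R s) = 0 := by
    intro R s hs hsk
    have : failureSet M S k q τ T R s = ∅ := by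
      ext w
      simp [failureSet, learn_of_le hsk.ge, hs, hsk]
    rw [this, measure_empty]
  have hρ : 0 ≤ 1 - a / 2 := by linarith
  induction R with
  | zero =>
      intro s i hs hi
      cases i with
      | zero => rw [hcomplete 0 s hs (by omega)]; exact zero_le
      | succ i =>
          refine prob_le_one.trans ?_
          rw [← ENNReal.ofReal_one]
          refine ENNReal.ofReal_le_ofReal ?_
          have : (1 : ℝ) ≤ 2 ^ i := one_le_pow₀ (by norm_num)
          rw [pow_succ]
          simp
          linarith
  | succ R ih =>
      intro s i hs hi
      cases i with
      | zero => rw [hcomplete _ s hs (by omega)]; exact zero_le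
      | succ i =>
          have hsk : s.2 < k := by omega
          set ν := (stdGaussian (EuclideanSpace ℝ (Fin n))).prod (stdGaussian (EuclideanSpace ℝ (Fin n)))
            with hν
          set A := {p : EuclideanSpace ℝ (Fin n) × EuclideanSpace ℝ (Fin n) |
            Accepts M k (q ^ 4) (τ ^ 4) T s p.1 p.2} with hA
          set D := {p : EuclideanSpace ℝ (Fin n) × EuclideanSpace ℝ (Fin n) |
            Accepts M k (q ^ 4) (τ ^ 4) T s p.1 p.2 ∧
            ¬ GoodState S τ (q ^ 12) (appended M k (q ^ 4) (τ ^ 4) T s p.1)} with hD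
          have hAm : MeasurableSet A :=
            measurableSet_accepts hM k _ _ T measurable_const measurable_fst measurable_snd
          set ρ := 1 - a / 2 with hρdef
          have hpow : 0 ≤ ρ ^ R := pow_nonneg hρ R
          have h2i : (1 : ℝ) ≤ 2 ^ i := one_le_pow₀ (by norm_num)
          set f := (2 ^ (i + 1) - 1) * ρ ^ R + R * (2 * τ) with hf
          set f' := (2 ^ i - 1) * ρ ^ R + R * (2 * τ) with hf'
          set Δ := 2 ^ i * ρ ^ R with hΔ
          have hff : f' + Δ = f := by rw [hf, hf', hΔ, pow_succ]; ring
          have hf'0 : 0 ≤ f' := by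
            have : 0 ≤ (2 ^ i - 1 : ℝ) := by linarith
            positivity
          have hΔ0 : 0 ≤ Δ := by positivity
          -- a round either reaches a bad state, or appends a vector, or leaves the state unchanged
          have hpt : ∀ p, gaussianSource (failureSet M S k q τ T R
              (learnStep M k (q ^ 4) (τ ^ 4) T s p.1 p.2)) + A.indicator (fun _ => ENNReal.ofReal Δ) p ≤
              D.indicator (fun _ => 1) p + ENNReal.ofReal f := by
            intro p
            by_cases hp : p ∈ A
            · rw [Set.indicator_of_mem hp, learnStep_of_accepts hp]
              by_cases hpg : GoodState S τ (q ^ 12) (appended M k (q ^ 4) (τ ^ 4) T s p.1)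
              · refine le_add_left ?_
                rw [← hff, ENNReal.ofReal_add hf'0 hΔ0]
                gcongr
                exact ih _ i hpg (by simp only [appended]; omega)
              · rw [Set.indicator_of_mem (show p ∈ D from ⟨hp, hpg⟩)]
                gcongr
                · exact prob_le_one
                · linarith
            · rw [Set.indicator_of_notMem hp, learnStep_of_not_accepts hp, add_zero]
              exact le_add_left (ih s (i + 1) hs hi)
          have hint : gaussianSource (failureSet M S k q τ T (R + 1) s) + ENNReal.ofReal Δ * ENNReal.ofReal a ≤
              ENNReal.ofReal (2 * τ) + ENNReal.ofReal f := by
            calc _ ≤ (∫⁻ p, gaussianSource (failureSet M S k q τ T R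
                  (learnStep M k (q ^ 4) (τ ^ 4) T s p.1 p.2)) ∂ν) + ENNReal.ofReal Δ * ν A := by
                  rw [gaussianSource_failureSet_succ hM]
                  gcongr
                  exact hacc s hs hsk
              _ = ∫⁻ p, gaussianSource (failureSet M S k q τ T R
                  (learnStep M k (q ^ 4) (τ ^ 4) T s p.1 p.2)) +
                    A.indicator (fun _ => ENNReal.ofReal Δ) p ∂ν := by
                  rw [lintegral_add_right _ (measurable_const.indicator hAm),
                    lintegral_indicator_const hAm]
              _ ≤ ∫⁻ p, D.indicator (fun _ => 1) p + ENNReal.ofReal f ∂ν := lintegral_mono hpt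
              _ = (∫⁻ p, D.indicator (fun _ => 1) p ∂ν) + ENNReal.ofReal f := by
                  rw [lintegral_add_right _ measurable_const]
                  simp
              _ ≤ _ := by
                  gcongr
                  exact (lintegral_indicator_one_le D).trans
                    (prod_accepts_not_goodState_le hM hMS T hτ hq hn hk hs)
          have hf0 : 0 ≤ f := by linarith
          rw [← ENNReal.ofReal_mul hΔ0, ← ENNReal.ofReal_add (by positivity) hf0] at hint
          have hle := ENNReal.le_sub_of_add_le_right ENNReal.ofReal_ne_top hint
          rw [← ENNReal.ofReal_sub _ (by positivity)] at hle
          refine hle.trans (ENNReal.ofReal_le_ofReal ?_)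
          have e1 : f = (2 ^ (i + 1) - 1) * ρ ^ (R + 1) + (2 ^ (i + 1) - 1) * ρ ^ R * (a / 2) +
              R * (2 * τ) := by
            rw [hf, pow_succ ρ R, hρdef]
            ring
          have e2 : (2 ^ (i + 1) - 1) * ρ ^ R * (a / 2) ≤ Δ * a := by
            rw [hΔ, pow_succ]
            have : 0 ≤ ρ ^ R * a := by positivity
            nlinarith
          push_cast
          linarith

end

/-! ### The probability of progress -/

theorem hasDerivAt_zero_of_abs_le {f : ℝ → ℝ} {a C : ℝ} (h : ∀ t, |f t - f 0 - t * a| ≤ C * t ^ 2) :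
    HasDerivAt f a 0 := by
  rw [hasDerivAt_iff_isLittleO]
  have h1 : (fun t : ℝ => f t - f 0 - (t - 0) • a) =O[nhds 0] fun t : ℝ => t ^ 2 :=
    Asymptotics.IsBigO.of_bound C (Filter.Eventually.of_forall fun t => by
      simpa [abs_of_nonneg (sq_nonneg t)] using h t)
  refine h1.trans_isLittleO ?_
  simpa using Asymptotics.isLittleO_pow_id (𝕜 := ℝ) one_lt_two

namespace ThresholdNetwork

variable {n : ℕ} {net : ThresholdNetwork n} {L κ : ℕ → ℝ} {γ η : ℝ}

theorem sigmaOff_smul_add_smul (U : Submodule ℝ (EuclideanSpace ℝ (Fin n))) (g : EuclideanSpace ℝ (Fin n))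
    (c t : ℝ) : net.sigmaOff U (c • g + t • g) =
      net.sigma (c • (g - U.starProjection g) + t • (g - U.starProjection g)) := by
  unfold sigmaOff
  congr 1
  rw [map_add, map_smul, map_smul]
  module

/-- The directional derivative in the gradient assumption is the derivative of the network at the projected
point in the projected direction. -/
theorem lineDeriv_sigmaOff {U : Submodule ℝ (EuclideanSpace ℝ (Fin n))} {g : EuclideanSpace ℝ (Fin n)}
    {c C : ℝ} {ℓ : EuclideanSpace ℝ (Fin n) →ₗ[ℝ] ℝ}
    (h : ∀ v, |net.sigma (c • (g - U.starProjection g) + v) - net.sigma (c • (g - U.starProjection g)) - ℓ v|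
      ≤ C * ‖v‖ ^ 2) :
    lineDeriv ℝ (net.sigmaOff U) (c • g) g = ℓ (g - U.starProjection g) := by
  unfold lineDeriv
  refine HasDerivAt.deriv (hasDerivAt_zero_of_abs_le (C := C * ‖g - U.starProjection g‖ ^ 2) fun t => ?_)
  rw [sigmaOff_smul_add_smul, sigmaOff_smul_add_smul, zero_smul, add_zero]
  have := h (t • (g - U.starProjection g))
  rw [map_smul, smul_eq_mul, norm_smul, mul_pow, Real.norm_eq_abs, sq_abs] at this
  refine this.trans (le_of_eq ?_)
  ring

/-- A round that starts in a good state appends a vector with probability at least `γ / 2`. The set in the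
gradient assumption need not be measurable, so that it is only covered by measurable sets. -/
theorem Assumptions.ofReal_le_prod_accepts (H : net.Assumptions L κ γ η) {q h : ℝ} {T : ℕ}
    (hq : Scales q h T) (hn : (n : ℝ) ≤ q) (hσ : TaylorBound net.sigma q q) (hη : 1 ≤ q * η)
    (htail : (n : ℝ) ^ 3 / q ^ 2 ≤ γ / 4) {s : (ℕ → EuclideanSpace ℝ (Fin n)) × ℕ}
    (hs : OrthonormalUpTo s.1 s.2) (hsk : s.2 < net.k) :
    ENNReal.ofReal (γ / 2) ≤ ((stdGaussian (EuclideanSpace ℝ (Fin n))).prod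
      (stdGaussian (EuclideanSpace ℝ (Fin n)))) {p | Accepts net.M net.k (q ^ 4) h T s p.1 p.2} := by
  set U := spanUpTo s.1 s.2 with hU
  set ν := stdGaussian (EuclideanSpace ℝ (Fin n)) with hν
  have hγ := H.gamma_pos
  have hgrad := H.gradient U ((finrank_spanUpTo_le _ _).trans_lt hsk)
  set G := {g | (∀ c : ℝ, 0 < c → net.sigmaOff U (c • g) = 1 →
    η ≤ |lineDeriv ℝ (net.sigmaOff U) (c • g) g|) ∧ 1 ≤ net.sigmaOff U g} with hG
  set B := {g : EuclideanSpace ℝ (Fin n) | q < ‖g‖} with hB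
  have hB4 : ν B ≤ ENNReal.ofReal (γ / 4) :=
    (stdGaussian_norm_gt_le n (by linarith [hq.two_le])).trans (ENNReal.ofReal_le_ofReal htail)
  set A := {p : EuclideanSpace ℝ (Fin n) × EuclideanSpace ℝ (Fin n) |
    Accepts net.M net.k (q ^ 4) h T s p.1 p.2} with hA
  have hsub : G ×ˢ Set.univ ⊆ A ∪ (B ×ˢ Set.univ ∪ Set.univ ×ˢ B) := by
    rintro ⟨g, y⟩ ⟨hg, -⟩
    by_cases hgB : q < ‖g‖
    · exact Or.inr (Or.inl ⟨hgB, trivial⟩)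
    by_cases hyB : q < ‖y‖
    · exact Or.inr (Or.inr ⟨trivial, hyB⟩)
    refine Or.inl ⟨hsk, ?_⟩
    have hz : deflate s.1 net.k g = g - U.starProjection g := hs.deflate_eq hsk.le g
    refine accept_of_good hq hn hσ H.sigma_zero hs hsk.le (not_lt.1 hgB) (not_lt.1 hyB) ?_ hη ?_
    · rw [hz]
      exact hg.2
    · rw [hz]
      intro c hc hc1 ℓ hℓ
      rw [← lineDeriv_sigmaOff hℓ]
      refine hg.1 c hc ?_
      rw [← hc1]
      have := net.sigmaOff_smul_add_smul U g c 0
      simpa using this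
  have h1 : ENNReal.ofReal γ ≤ ν G := by
    rw [← ENNReal.ofReal_toReal (measure_ne_top ν G)]
    exact ENNReal.ofReal_le_ofReal hgrad
  have h2 : ENNReal.ofReal γ ≤ (ν.prod ν) A + ENNReal.ofReal (γ / 2) := by
    calc ENNReal.ofReal γ ≤ ν G := h1
      _ = (ν.prod ν) (G ×ˢ Set.univ) := by rw [Measure.prod_prod, measure_univ, mul_one]
      _ ≤ (ν.prod ν) A + ((ν.prod ν) (B ×ˢ Set.univ) + (ν.prod ν) (Set.univ ×ˢ B)) :=
          (measure_mono hsub).trans ((measure_union_le _ _).trans (by gcongr; exact measure_union_le _ _))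
      _ ≤ (ν.prod ν) A + (ENNReal.ofReal (γ / 4) + ENNReal.ofReal (γ / 4)) := by
          rw [Measure.prod_prod, Measure.prod_prod, measure_univ, mul_one, one_mul]
          gcongr
      _ = _ := by
          rw [← ENNReal.ofReal_add (by positivity) (by positivity)]
          congr 2
          ring
  have h3 := tsub_le_iff_right.2 h2
  rw [← ENNReal.ofReal_sub _ (by positivity)] at h3
  refine le_trans (ENNReal.ofReal_le_ofReal ?_) h3
  linarith

end ThresholdNetwork

/-! ### The choice of the parameters -/

section
variable {n : ℕ} {net : ThresholdNetwork n} {L κ : ℕ → ℝ} {γ η ε δ : ℝ} {N : ℕ}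

/-- What the size parameter gives: all quantities of the problem are bounded in terms of `N`. -/
theorem sizeParam_bounds (H : net.Assumptions L κ γ η) (hε : 0 < ε) (hε1 : ε < 1) (hδ : 0 < δ)
    (hδ1 : δ < 1) (hN : N = sizeParam n net.k net.depth L κ γ η ε δ) :
    n ≤ N ∧ net.k ≤ N ∧ 1 / γ ≤ N ∧ ThresholdNetwork.gradBound net.depth L κ ≤ 4 ^ N ∧ 1 / η ≤ 4 ^ N ∧
      1 / ε ≤ 4 ^ N ∧ 1 / δ ≤ 4 ^ N := by
  have hγ := H.gamma_pos
  have hη := H.eta_pos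
  have t1 : 0 ≤ 1 / γ := by positivity
  have t2 : 0 ≤ ∑ i ∈ Finset.range net.depth, Real.log (2 + L i) := Finset.sum_nonneg fun i hi =>
    Real.log_nonneg (by linarith [H.L_nonneg (Finset.mem_range.1 hi)])
  have t3 : 0 ≤ ∑ i ∈ Finset.range (net.depth + 1), Real.log (2 + κ i) := Finset.sum_nonneg fun i hi =>
    Real.log_nonneg (by linarith [H.kappa_nonneg i (by have := Finset.mem_range.1 hi; omega)])
  have t4 : 0 ≤ Real.log (2 + 1 / η) := Real.log_nonneg (by
    have : 0 ≤ 1 / η := by positivity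
    linarith)
  have t5 : 0 ≤ Real.log (1 / ε) := Real.log_nonneg (one_le_one_div hε hε1.le)
  have t6 : 0 ≤ Real.log (1 / δ) := Real.log_nonneg (one_le_one_div hδ hδ1.le)
  have t7 : (0 : ℝ) ≤ n := Nat.cast_nonneg _
  have t8 : (0 : ℝ) ≤ net.k := Nat.cast_nonneg _
  have hX := Nat.le_ceil ((n : ℝ) + net.k + 1 / γ + ∑ i ∈ Finset.range net.depth, Real.log (2 + L i)
    + ∑ i ∈ Finset.range (net.depth + 1), Real.log (2 + κ i)
    + Real.log (2 + 1 / η) + Real.log (1 / ε) + Real.log (1 / δ))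
  change _ ≤ ((sizeParam n net.k net.depth L κ γ η ε δ : ℕ) : ℝ) at hX
  rw [← hN] at hX
  have hexp : ∀ {x : ℝ}, x ≤ N → Real.exp x ≤ 4 ^ N := by
    intro x hx
    calc Real.exp x ≤ Real.exp (N * 1) := Real.exp_le_exp.2 (by linarith)
      _ = Real.exp 1 ^ N := Real.exp_nat_mul 1 N
      _ ≤ 4 ^ N := by
        gcongr
        linarith [Real.exp_one_lt_d9]
  have hlog : ∀ {x : ℝ}, 0 < x → Real.log x ≤ N → x ≤ 4 ^ N := by
    intro x hx h
    rw [← Real.exp_log hx]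
    exact hexp h
  refine ⟨?_, ?_, by linarith, ?_, ?_, ?_, ?_⟩
  · have : (n : ℝ) ≤ N := by linarith
    exact_mod_cast this
  · have : (net.k : ℝ) ≤ N := by linarith
    exact_mod_cast this
  · rw [H.gradBound_eq_exp]
    exact hexp (by linarith)
  · have := hlog (x := 2 + 1 / η) (by positivity) (by linarith)
    linarith
  · exact hlog (by positivity) (by linarith)
  · exact hlog (by positivity) (by linarith)

theorem cast_le_two_pow {m N : ℕ} (h : m ≤ N) : (m : ℝ) ≤ 2 ^ N := by
  exact_mod_cast h.trans Nat.lt_two_pow_self.le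

theorem one_half_pow_le {x : ℝ} (hx : 0 < x) {m : ℕ} (h : 1 / x ≤ 2 ^ m) : (1 / 2 : ℝ) ^ m ≤ x := by
  rw [one_div_pow]
  exact (one_div_le (by positivity) hx).2 h

theorem two_pow_mul_half_pow_le {a b c : ℕ} (h : a + c ≤ b) :
    (2 : ℝ) ^ a * (1 / 2) ^ b ≤ (1 / 2) ^ c := by
  obtain ⟨d, rfl⟩ := Nat.exists_eq_add_of_le h
  have h1 : (1 / 2 : ℝ) ^ d ≤ 1 := pow_le_one₀ (by norm_num) (by norm_num)
  have h2 : (2 : ℝ) ^ a * (1 / 2) ^ a = 1 := by rw [← mul_pow]; norm_num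
  calc (2 : ℝ) ^ a * (1 / 2) ^ (a + c + d) = 2 ^ a * (1 / 2) ^ a * ((1 / 2) ^ c * (1 / 2) ^ d) := by ring
    _ = (1 / 2) ^ c * (1 / 2) ^ d := by rw [h2, one_mul]
    _ ≤ (1 / 2) ^ c := mul_le_of_le_one_right (by positivity) h1

/-- The scales of the algorithm for the size parameter `N`. The fourth power is the form in which the linearity
test uses `h`: its tolerance is `τ ^ 2`, where `τ` is the tolerated distance from the row span. -/
theorem scales_of_one_le (hN : 1 ≤ N) :
    Scales ((2 : ℝ) ^ (8 * N)) (((1 / 2 : ℝ) ^ (128 * N ^ 2)) ^ 4) (1024 * N ^ 2) where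
  two_le := le_self_pow₀ (by norm_num) (by omega)
  h_pos := by positivity
  half_pow := by rw [← pow_mul, ← pow_mul]; congr 1; ring
  small := by
    rw [← pow_mul, ← pow_mul]
    refine (two_pow_mul_half_pow_le (c := 0) ?_).trans (by norm_num)
    nlinarith

theorem four_pow_eq (N : ℕ) : (4 : ℝ) ^ N = 2 ^ (2 * N) := by
  rw [pow_mul]; norm_num

/-- The probability of failure for the chosen parameters. -/
theorem failure_bound_le {k : ℕ} (hN : 1 ≤ N) (hk : k ≤ N) (hδ : 0 < δ) (hδN : 1 / δ ≤ 4 ^ N) :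
    ((2 : ℝ) ^ k - 1) * (1 - 1 / (2 * N) / 2) ^ (16 * N ^ 2) +
      ((16 * N ^ 2 : ℕ) : ℝ) * (2 * (1 / 2) ^ (128 * N ^ 2)) ≤ δ := by
  rw [four_pow_eq] at hδN
  have h1 := one_half_pow_le hδ hδN
  have hN0 : (1 : ℝ) ≤ N := by exact_mod_cast hN
  have e3 : (0 : ℝ) ≤ 1 - 1 / (2 * N) / 2 := by
    have : 1 / (2 * N) / 2 ≤ (1 : ℝ) := by
      rw [div_div, div_le_one (by positivity)]
      linarith
    linarith
  have e1 : (1 - 1 / (2 * N) / 2 : ℝ) ^ (16 * N ^ 2) ≤ (1 / 2) ^ (4 * N) := by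
    have e2 : (1 - 1 / (2 * N) / 2 : ℝ) ≤ Real.exp (-(1 / (4 * N))) := by
      have := Real.add_one_le_exp (-(1 / (4 * N) : ℝ))
      refine le_trans (le_of_eq ?_) this
      field_simp
      ring
    calc (1 - 1 / (2 * N) / 2 : ℝ) ^ (16 * N ^ 2) ≤ Real.exp (-(1 / (4 * N))) ^ (16 * N ^ 2) := by gcongr
      _ = Real.exp (-1) ^ (4 * N) := by
        rw [← Real.exp_nat_mul, ← Real.exp_nat_mul]
        congr 1
        push_cast
        field_simp
        ring
      _ ≤ (1 / 2) ^ (4 * N) := by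
        gcongr
        rw [Real.exp_neg, one_div]
        gcongr
        linarith [Real.exp_one_gt_d9]
  have e4 : ((2 : ℝ) ^ k - 1) * (1 - 1 / (2 * N) / 2) ^ (16 * N ^ 2) ≤ (1 / 2) ^ (2 * N + 1) := by
    have : (1 : ℝ) ≤ 2 ^ k := one_le_pow₀ (by norm_num)
    calc ((2 : ℝ) ^ k - 1) * (1 - 1 / (2 * N) / 2) ^ (16 * N ^ 2) ≤ 2 ^ k * (1 / 2) ^ (4 * N) := by
          refine mul_le_mul (by linarith) e1 (pow_nonneg e3 _) (by positivity)
      _ ≤ _ := two_pow_mul_half_pow_le (by omega)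
  have e5 : ((16 * N ^ 2 : ℕ) : ℝ) * (2 * (1 / 2) ^ (128 * N ^ 2)) ≤ (1 / 2) ^ (2 * N + 1) := by
    have := cast_le_two_pow (le_refl N)
    calc ((16 * N ^ 2 : ℕ) : ℝ) * (2 * (1 / 2) ^ (128 * N ^ 2))
        = 2 ^ 5 * (N : ℝ) ^ 2 * (1 / 2) ^ (128 * N ^ 2) := by push_cast; ring
      _ ≤ 2 ^ 5 * ((2 : ℝ) ^ N) ^ 2 * (1 / 2) ^ (128 * N ^ 2) := by gcongr
      _ = 2 ^ (5 + N * 2) * (1 / 2) ^ (128 * N ^ 2) := by rw [← pow_mul, ← pow_add]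
      _ ≤ _ := two_pow_mul_half_pow_le (by nlinarith)
  have e6 : (1 / 2 : ℝ) ^ (2 * N + 1) + (1 / 2) ^ (2 * N + 1) = (1 / 2) ^ (2 * N) := by ring
  linarith

/-- The accumulated error of the vectors is at most `ε` for the chosen parameters. -/
theorem accuracy_bound_le {k : ℕ} (hN : 1 ≤ N) (hk : k ≤ N) (hε : 0 < ε) (hεN : 1 / ε ≤ 4 ^ N) :
    (k : ℝ) * ((1 / 2) ^ (128 * N ^ 2) * (((2 : ℝ) ^ (8 * N)) ^ 12) ^ k) ≤ ε := by
  rw [four_pow_eq] at hεN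
  refine le_trans ?_ (one_half_pow_le hε hεN)
  have := cast_le_two_pow hk
  calc (k : ℝ) * ((1 / 2) ^ (128 * N ^ 2) * (((2 : ℝ) ^ (8 * N)) ^ 12) ^ k)
      ≤ 2 ^ N * ((1 / 2) ^ (128 * N ^ 2) * (((2 : ℝ) ^ (8 * N)) ^ 12) ^ k) := by gcongr
    _ = 2 ^ (N + 8 * N * 12 * k) * (1 / 2) ^ (128 * N ^ 2) := by
      rw [← pow_mul, ← pow_mul, pow_add]; ring
    _ ≤ _ := two_pow_mul_half_pow_le (by nlinarith)

/-- The probability that a random vector is too long is at most `γ / 4` for the chosen parameters. -/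
theorem tail_bound_le (hN : 1 ≤ N) (hn : n ≤ N) (hγ : 0 < γ) (hγN : 1 / γ ≤ N) :
    (n : ℝ) ^ 3 / ((2 : ℝ) ^ (8 * N)) ^ 2 ≤ γ / 4 := by
  have h1 := one_half_pow_le hγ (hγN.trans (cast_le_two_pow le_rfl))
  have h2 := cast_le_two_pow hn
  rw [div_le_iff₀ (by positivity)]
  have e : (1 : ℝ) = 2 ^ (16 * N) * (1 / 2) ^ (16 * N) := by rw [← mul_pow]; norm_num
  calc (n : ℝ) ^ 3 ≤ (2 ^ N) ^ 3 := by gcongr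
    _ = 2 ^ (3 * N) * (1 / 2) ^ (16 * N) * 2 ^ (16 * N) := by
      rw [mul_assoc, mul_comm _ ((2 : ℝ) ^ (16 * N)), ← e, mul_one, ← pow_mul, mul_comm N]
    _ ≤ (1 / 2) ^ (N + 2) * 2 ^ (16 * N) := by
      gcongr
      exact two_pow_mul_half_pow_le (by omega)
    _ = (1 / 2) ^ N / 4 * 2 ^ (16 * N) := by ring
    _ ≤ γ / 4 * 2 ^ (16 * N) := by gcongr
    _ = _ := by rw [← pow_mul]; congr 2; ring

theorem goodState_init (S : Submodule ℝ (EuclideanSpace ℝ (Fin n))) {τ : ℝ} (hτ : 0 ≤ τ) (W : ℝ) :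
    GoodState S τ W ((fun _ => 0, 0) : (ℕ → EuclideanSpace ℝ (Fin n)) × ℕ) where
  orthonormal := ⟨fun i hi => absurd hi (Nat.not_lt_zero i), fun _ _ => rfl, fun _ _ _ => inner_zero_left _⟩
  near i := by simpa using hτ

/-- With probability at least `1 - δ` the algorithm ends in a good state with `k` vectors. A round is only used
to append a vector with probability `1 / (2 * N) ≤ γ / 2`, a bound that the number of rounds may depend on. -/
theorem gaussianSource_failureSet_le_delta (H : net.Assumptions L κ γ η) (hn0 : 0 < n) (hε : 0 < ε)
    (hε1 : ε < 1) (hδ : 0 < δ) (hδ1 : δ < 1) (hN : N = sizeParam n net.k net.depth L κ γ η ε δ) :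
    gaussianSource (failureSet net.M net.rowSpanᗮ net.k (2 ^ (8 * N)) ((1 / 2) ^ (128 * N ^ 2))
      (1024 * N ^ 2) (16 * N ^ 2) (fun _ => 0, 0)) ≤ ENNReal.ofReal δ := by
  obtain ⟨hnN, hkN, hγN, hgN, hηN, -, hδN⟩ := sizeParam_bounds H hε hε1 hδ hδ1 hN
  have hN1 : 1 ≤ N := by omega
  have hN0 : (1 : ℝ) ≤ N := by exact_mod_cast hN1
  have hq := scales_of_one_le hN1
  have hNq : (2 : ℝ) ^ N ≤ 2 ^ (8 * N) := pow_le_pow_right₀ (by norm_num) (by omega)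
  have h4q : (4 : ℝ) ^ N ≤ 2 ^ (8 * N) := by
    rw [four_pow_eq]
    exact pow_le_pow_right₀ (by norm_num) (by omega)
  have hg0 : 0 ≤ ThresholdNetwork.gradBound net.depth L κ := by
    rw [H.gradBound_eq_exp]
    exact (Real.exp_pos _).le
  have hσ : TaylorBound net.sigma (2 ^ (8 * N)) (2 ^ (8 * N)) := by
    refine H.taylorBound_sigma.mono (hgN.trans h4q) ?_
    calc ThresholdNetwork.gradBound net.depth L κ ^ 2 ≤ (4 ^ N) ^ 2 := by gcongr
      _ = 2 ^ (4 * N) := by rw [four_pow_eq, ← pow_mul]; congr 1; ring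
      _ ≤ 2 ^ (8 * N) := pow_le_pow_right₀ (by norm_num) (by omega)
  have hη : 1 ≤ (2 : ℝ) ^ (8 * N) * η := (div_le_iff₀ H.eta_pos).1 (hηN.trans h4q)
  have hnq : (n : ℝ) ≤ 2 ^ (8 * N) := (cast_le_two_pow hnN).trans hNq
  have hkq : (net.k : ℝ) ≤ 2 ^ (8 * N) := (cast_le_two_pow hkN).trans hNq
  have ha : 1 / (2 * N) ≤ γ / 2 := by
    have := (one_div_le H.gamma_pos (by positivity)).1 hγN
    rw [← div_div, div_right_comm]
    gcongr
  refine (gaussianSource_failureSet_le H.measurable_M (fun x z hz => net.M_add_of_mem_orthogonal hz)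
    (1024 * N ^ 2) (τ := (1 / 2) ^ (128 * N ^ 2)) (by positivity) hq.two_le hnq hkq
    (a := 1 / (2 * N)) (by positivity) ?_ ?_ (16 * N ^ 2) _ net.k
    (goodState_init _ (by positivity) _) (zero_add _)).trans
    (ENNReal.ofReal_le_ofReal (failure_bound_le hN1 hkN hδ hδN))
  · rw [div_le_one (by positivity)]
    linarith
  · intro s hs hsk
    exact (ENNReal.ofReal_le_ofReal ha).trans
      (H.ofReal_le_prod_accepts hq hnq hσ hη (tail_bound_le hN1 hnN H.gamma_pos hγN) hs.orthonormal hsk)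

end

theorem theorem4p3 :
    ∃ (P : RProg) (C : ℕ),
      ∀ (n : ℕ) (net : ThresholdNetwork n) (L κ : ℕ → ℝ) (γ η ε δ : ℝ),
        net.k < n → net.Assumptions L κ γ η →
        0 < ε → ε < 1 → 0 < δ → δ < 1 →
        ∀ N : ℕ, N = sizeParam n net.k net.depth L κ γ η ε δ →
          (∀ ω : ℕ → ℝ,
            (P.run net.M ω (RState.init n net.k N)).time ≤ C * N ^ C ∧
            (P.run net.M ω (RState.init n net.k N)).queries ≤ C * N ^ C) ∧
          1 - δ ≤ gaussianSource.real
            {ω | Module.finrank ℝ ((P.run net.M ω (RState.init n net.k N)).output n net.k) = net.k ∧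
              ∀ x ∈ (P.run net.M ω (RState.init n net.k N)).output n net.k,
                (1 - ε) * ‖x‖ ≤ ‖net.rowSpan.starProjection x‖} := by
  refine ⟨RProg.learnProg, 10 ^ 7, fun n net L κ γ η ε δ hkn H hε hε1 hδ hδ1 N hN => ?_⟩
  have hn0 : 0 < n := by omega
  obtain ⟨hnN, hkN, -, -, -, hεN, -⟩ := sizeParam_bounds H hε hε1 hδ hδ1 hN
  have hN1 : 1 ≤ N := by omega
  refine ⟨fun ω => ?_, ?_⟩
  · have ht := RProg.time_learnProg_le (M := net.M) hnN hkN hN1 ω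
    have hle : 10 ^ 7 * N ^ 6 ≤ 10 ^ 7 * N ^ (10 ^ 7) :=
      Nat.mul_le_mul_left _ (Nat.pow_le_pow_right hN1 (by norm_num))
    have hqt := RProg.queries_add_time_le (M := net.M) ω RProg.learnProg (RState.init n net.k N)
    have e : (RState.init n net.k N).time = 0 ∧ (RState.init n net.k N).queries = 0 := ⟨rfl, rfl⟩
    exact ⟨ht.trans hle, by omega⟩
  · set F := failureSet net.M net.rowSpanᗮ net.k (2 ^ (8 * N)) ((1 / 2) ^ (128 * N ^ 2))
      (1024 * N ^ 2) (16 * N ^ 2) (fun _ => 0, 0) with hF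
    have hFδ : gaussianSource.real F ≤ δ := by
      refine ENNReal.toReal_le_of_le_ofReal hδ.le ?_
      exact gaussianSource_failureSet_le_delta H hn0 hε hε1 hδ hδ1 hN
    set G := {ω | Module.finrank ℝ ((RProg.learnProg.run net.M ω (RState.init n net.k N)).output n net.k) = net.k ∧
      ∀ x ∈ (RProg.learnProg.run net.M ω (RState.init n net.k N)).output n net.k,
        (1 - ε) * ‖x‖ ≤ ‖net.rowSpan.starProjection x‖} with hG
    -- the set `G` need not be known to be measurable: a union bound suffices
    have hcover : (Set.univ : Set (ℕ → ℝ)) ⊆ G ∪ F := by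
      intro ω _
      by_cases hω : ω ∈ F
      · exact Or.inr hω
      · obtain ⟨h1, h2⟩ := not_not.1 hω
        refine Or.inl ?_
        rw [show ((2 : ℝ) ^ (8 * N)) ^ 4 = 2 ^ (32 * N) by rw [← pow_mul]; congr 1; ring,
          show ((1 / 2 : ℝ) ^ (128 * N ^ 2)) ^ 4 = (1 / 2) ^ (512 * N ^ 2) by
            rw [← pow_mul]; congr 1; ring] at h1 h2
        set s := learn net.M net.k (2 ^ (32 * N)) ((1 / 2) ^ (512 * N ^ 2)) (1024 * N ^ 2) (16 * N ^ 2)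
          (fun _ => 0, 0) ω with hs
        have hout : (RProg.learnProg.run net.M ω (RState.init n net.k N)).output n net.k =
            spanUpTo s.1 s.2 := by
          rw [h2]
          exact RProg.output_learnProg hn0 net.k N ω
        refine ⟨?_, fun x hx => ?_⟩
        · rw [hout, h1.orthonormal.finrank_spanUpTo, h2]
        · rw [hout] at hx
          refine h1.one_sub_mul_norm_le ?_ hx
          rw [h2]
          exact accuracy_bound_le hN1 hkN hε hεN
    have h1 : (1 : ℝ) ≤ gaussianSource.real G + gaussianSource.real F := by
      calc (1 : ℝ) = gaussianSource.real Set.univ := by simp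
        _ ≤ gaussianSource.real (G ∪ F) := measureReal_mono hcover
        _ ≤ _ := measureReal_union_le _ _
    linarith
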